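/- \textbf{Theorem.} A polylogarithmic function is a map $\ell:\mathbb N\to\mathbb R$ of the form $\ell(n)=p(\log_2 n)$, where $p$ is a polynomial with nonnegative integer coefficients and $\log_2 0:=0$. For a decision problem $P$ with a size parameter $m$ (a function from the instances of $P$ to $\mathbb N$), the \emph{linear space hypothesis} $\mathrm{LSH}(P,m)$ is the assertion that for every $\varepsilon\in(0,1)$ and every polylogarithmic function $\ell$ there is no deterministic multi-tape Turing machine (with a read-only input tape) that on every instance $x$ of $P$ gives the correct answer in time polynomial in $|x|$ while using at most $\max(1,m(x))^{\varepsilon}\,\ell(|x|)$ space on its work tapes, where $|x|$ is the length of the string that represents $x$. Consider the following problems. (a) $\mathrm{2SAT}_3$: given a Boolean formula in conjunctive normal form, each of whose clauses has one or two literals and in which every variable has at most three occurrences (negated or not), is it satisfiable? Size parameter: $m_{vbl}$, the number of variables that appear in the formula. (b) $\mathrm{LP}_{2,3}$: given a rational $m\times n$ matrix $A$ with $m,n\ge 1$, with at most two nonzero entries in each row and at most three nonzero entries in each column, and a rational vector $b$ of dimension $m$, is there a vector $x\in\{0,1\}^n$ with $Ax\ge b$? Size parameters: $m_{row}=m$ and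 $m_{col}=n$. (c) $3\mathrm{DSTCON}$: given a directed graph in which indegree plus outdegree of every vertex is at most $3$, and two vertices $s,t$, is there a directed path from $s$ to $t$? Size parameters: $m_{ver}$, the number of vertices, and $m_{edg}$, the number of edges. Then the five statements $\mathrm{LSH}(\mathrm{2SAT}_3,m_{vbl})$, $\mathrm{LSH}(\mathrm{LP}_{2,3},m_{row})$, $\mathrm{LSH}(\mathrm{LP}_{2,3},m_{col})$, $\mathrm{LSH}(3\mathrm{DSTCON},m_{ver})$ and $\mathrm{LSH}(3\mathrm{DSTCON},m_{edg})$ are logically equivalent. -/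

import Mathlib

open scoped Matrix

/-! ## Multi-tape deterministic Turing machines with a read-only input tape -/

/-- What the input head can scan: an input symbol or one of the two endmarkers. -/
inductive InCell (α : Type) where
  | left : InCell α
  | sym (a : α) : InCell α
  | right : InCell α

/-- Head movements. -/
inductive HeadMove where
  | left
  | stay
  | right

/-- What a machine with `k` work tapes does in one step: the next state, the movement of the input
head, and for every work tape the symbol written and the movement of its head. -/
structure TMAction (k : ℕ) (Q Γ : Type) where
  next : Q
  inMove : HeadMove
  write : Fin k → Γ
  move : Fin k → HeadMove

/-- A deterministic Turing machine with a two-way read-only input tape over the alphabet `α` and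
`k` read-write work tapes, each infinite to the right. The machine halts when the
transition function is undefined; it then accepts iff its state is an accepting one. -/
structure MultiTapeTM (α : Type) where
  k : ℕ
  Q : Type
  Γ : Type
  finite_Q : Finite Q
  finite_Γ : Finite Γ
  blank : Γ
  start : Q
  accepting : Set Q
  δ : Q → InCell α → (Fin k → Γ) → Option (TMAction k Q Γ)

namespace MultiTapeTM

variable {α : Type}

/-- Configurations: state, position of the input head, contents and head positions of the work
tapes. -/
structure Cfg (M : MultiTapeTM α) where
  state : M.Q
  inHead : ℕ
  tape : Fin M.k → ℕ → M.Γ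
  head : Fin M.k → ℕ

/-- Cell `i` of the input tape: cell `0` holds the left endmarker, cells `1, …, |x|` hold `x`,
and cell `|x| + 1` holds the right endmarker. -/
def inputCell (x : List α) : ℕ → InCell α
  | 0 => InCell.left
  | i + 1 =>
    match x[i]? with
    | some a => InCell.sym a
    | none => InCell.right

/-- Movement of the input head, which never leaves the cells `0, …, |x| + 1`. -/
def moveIn (x : List α) : HeadMove → ℕ → ℕ
  | .left, i => i - 1
  | .stay, i => i
  | .right, i => min (i + 1) (x.length + 1)

/-- Movement of a work head; a left move in the leftmost cell has no effect. -/
def moveWork : HeadMove → ℕ → ℕ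
  | .left, i => i - 1
  | .stay, i => i
  | .right, i => i + 1

/-- The initial configuration: all work tapes blank, all heads in their leftmost cells. -/
def init (M : MultiTapeTM α) : M.Cfg where
  state := M.start
  inHead := 0
  tape := fun _ _ => M.blank
  head := fun _ => 0

/-- The action that the machine takes in configuration `c` on input `x`, if any. -/
def action (M : MultiTapeTM α) (x : List α) (c : M.Cfg) : Option (TMAction M.k M.Q M.Γ) :=
  M.δ c.state (inputCell x c.inHead) (fun j => c.tape j (c.head j))

/-- One step on input `x`; a halted configuration is left unchanged. -/
def step (M : MultiTapeTM α) (x : List α) (c : M.Cfg) : M.Cfg :=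
  match M.action x c with
  | none => c
  | some a =>
    { state := a.next
      inHead := moveIn x a.inMove c.inHead
      tape := fun j => Function.update (c.tape j) (c.head j) (a.write j)
      head := fun j => moveWork (a.move j) (c.head j) }

/-- The configuration after `t` steps on input `x`. -/
def run (M : MultiTapeTM α) (x : List α) (t : ℕ) : M.Cfg :=
  (M.step x)^[t] M.init

/-- On input `x`, after at most `T` steps the machine has halted, in an accepting state iff
`answer` holds. -/
def AnswersWithin (M : MultiTapeTM α) (x : List α) (answer : Prop) (T : ℕ) : Prop :=
  ∃ t ≤ T, M.action x (M.run x t) = none ∧ ((M.run x t).state ∈ M.accepting ↔ answer)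

/-- On input `x`, on each work tape the machine visits at most `S` cells during its whole run.
(A head starts in cell `0` and moves by at most one cell per step, so that `h + 1` cells have been
visited when the rightmost visited cell is cell `h`.) -/
def UsesSpace (M : MultiTapeTM α) (x : List α) (S : ℝ) : Prop :=
  ∀ (t : ℕ) (j : Fin M.k), ((M.run x t).head j : ℝ) + 1 ≤ S

end MultiTapeTM

/-! ## Parameterized decision problems and the linear space hypothesis -/

/-- Input symbols: binary digits and a separator. -/
inductive InSym where
  | bit (b : Bool)
  | sep

/-- A decision problem together with a size parameter: its instances, their representation as
strings, the yes-instances, and the size parameter. -/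
structure ParamProblem where
  Inst : Type
  encode : Inst → List InSym
  encode_injective : Function.Injective encode
  yes : Inst → Prop
  size : Inst → ℕ

/-- Polylogarithmic functions: `ℓ n = p (log₂ n)` for a polynomial `p` with nonnegative integer
coefficients, where `log₂ 0` is `0`. -/
def IsPolylog (ℓ : ℕ → ℝ) : Prop :=
  ∃ p : Polynomial ℕ, ∀ n : ℕ, ℓ n = Polynomial.aeval (Real.logb 2 (n : ℝ)) p

/-- `M` solves `P` simultaneously in polynomial time and with at most `m(x)^ε · ℓ(|x|)` space on
every instance `x`, where `m` is the size parameter of `P`, with the value `0` replaced by `1`. -/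
def SolvesPolyTimeSpace (M : MultiTapeTM InSym) (P : ParamProblem) (ε : ℝ) (ℓ : ℕ → ℝ) : Prop :=
  ∃ p : Polynomial ℕ, ∀ x : P.Inst,
    M.AnswersWithin (P.encode x) (P.yes x) (p.eval (P.encode x).length) ∧
    M.UsesSpace (P.encode x) (((max 1 (P.size x) : ℕ) : ℝ) ^ ε * ℓ (P.encode x).length)

/-- The linear space hypothesis for the parameterized problem `P`: for no `ε ∈ (0,1)` and no
polylogarithmic function `ℓ` is there a deterministic Turing machine that solves `P`
simultaneously in polynomial time and `m(x)^ε · ℓ(|x|)` space. -/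
def LSH (P : ParamProblem) : Prop :=
  ∀ ε : ℝ, 0 < ε → ε < 1 → ∀ ℓ : ℕ → ℝ, IsPolylog ℓ →
    ¬ ∃ M : MultiTapeTM InSym, SolvesPolyTimeSpace M P ε ℓ

/-! ## Strings that represent instances -/

/-- A list of binary words as a string: each word is followed by a separator. -/
def encodeWords (ws : List (List Bool)) : List InSym :=
  (ws.map (fun w => w.map InSym.bit)).flatMap (fun w => w ++ [InSym.sep])

theorem terminated_injective {β : Type} (z : β) :
    ∀ L L' : List (List β), (∀ c ∈ L, z ∉ c) → (∀ c ∈ L', z ∉ c) →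
      L.flatMap (fun c => c ++ [z]) = L'.flatMap (fun c => c ++ [z]) → L = L' := by
  have key : ∀ (c c' r r' : List β), z ∉ c → z ∉ c' → c ++ z :: r = c' ++ z :: r' →
      c = c' ∧ r = r' := by
    intro c
    induction c with
    | nil =>
      intro c' r r' _ h' h
      cases c' with
      | nil => simpa using h
      | cons a c' =>
        simp at h h'
        exact absurd h.1 h'.1
    | cons a c ih =>
      intro c' r r' h1 h' h
      cases c' with
      | nil =>
        simp at h h1
        exact absurd h.1.symm h1.1
      | cons a' c' =>
        simp at h h1 h'
        obtain ⟨h2, h3⟩ := ih c' r r' h1.2 h'.2 h.2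
        exact ⟨by rw [h.1, h2], h3⟩
  intro L
  induction L with
  | nil =>
    intro L' _ _ h
    cases L' with
    | nil => rfl
    | cons c' L' => simp at h
  | cons c L ih =>
    intro L' h1 h2 h
    cases L' with
    | nil => simp at h
    | cons c' L' =>
      simp only [List.flatMap_cons, List.append_assoc, List.singleton_append] at h
      obtain ⟨h3, h4⟩ := key c c' _ _ (h1 c (by simp)) (h2 c' (by simp)) h
      rw [h3, ih L' (fun d hd => h1 d (by simp [hd])) (fun d hd => h2 d (by simp [hd])) h4]

theorem encodeWords_injective : Function.Injective encodeWords := by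
  intro ws ws' h
  have h1 := terminated_injective InSym.sep _ _ (by simp) (by simp) h
  refine List.map_injective_iff.mpr (List.map_injective_iff.mpr ?_) h1
  intro a b hab
  simpa using hab

/-- A table of nonempty binary words as a list of words: the words of each row are followed by the
empty word. -/
def tableWords (rows : List (List (List Bool))) : List (List Bool) :=
  rows.flatMap (fun r => r ++ [[]])

theorem natBits_injective : Function.Injective Nat.bits := by
  intro a b h
  have h' : Nat.ofDigits 2 ((Nat.bits a).map (fun b : Bool => cond b 1 0)) =
      Nat.ofDigits 2 ((Nat.bits b).map (fun b : Bool => cond b 1 0)) := by rw [h]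
  rwa [← Nat.digits_two_eq_bits, ← Nat.digits_two_eq_bits, Nat.ofDigits_digits,
    Nat.ofDigits_digits] at h'

/-! ## 2SAT with at most three occurrences of each variable -/

/-- 2CNF formulas (lists of clauses with one or two literals) in which every variable has at most
three occurrences, negated or not. Variables are natural numbers; the literal `(v, true)` is `v`
and `(v, false)` is its negation. -/
structure TwoSATThree where
  clauses : List (List (ℕ × Bool))
  clause_length : ∀ c ∈ clauses, c.length = 1 ∨ c.length = 2
  occurrences : ∀ v : ℕ, clauses.flatten.countP (fun l => l.1 = v) ≤ 3

namespace TwoSATThree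

/-- Some truth assignment makes a literal true in every clause. -/
def Satisfiable (φ : TwoSATThree) : Prop :=
  ∃ τ : ℕ → Bool, ∀ c ∈ φ.clauses, ∃ l ∈ c, τ l.1 = l.2

/-- The number of variables that appear in the formula. -/
def numVars (φ : TwoSATThree) : ℕ :=
  (φ.clauses.flatten.map Prod.fst).toFinset.card

/-- A literal as a binary word: its sign and its variable in binary (least significant bit
first). -/
def literalWord (l : ℕ × Bool) : List Bool :=
  l.2 :: Nat.bits l.1

/-- A formula as a string. -/
def encode (φ : TwoSATThree) : List InSym :=
  encodeWords (tableWords (φ.clauses.map (fun c => c.map literalWord)))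

theorem encode_injective : Function.Injective encode := by
  intro φ ψ h
  have h1 := terminated_injective ([] : List Bool) _ _ (by simp [literalWord])
    (by simp [literalWord]) (encodeWords_injective h)
  have h2 : φ.clauses = ψ.clauses := by
    refine List.map_injective_iff.mpr (List.map_injective_iff.mpr ?_) h1
    rintro ⟨v, b⟩ ⟨v', b'⟩ hl
    simp only [literalWord, List.cons.injEq] at hl
    rw [hl.1, natBits_injective hl.2]
  cases φ
  cases ψ
  simpa using h2

end TwoSATThree

/-- `2SAT₃` with the number of variables as size parameter. -/
def twoSATThree : ParamProblem where
  Inst := TwoSATThree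
  encode := TwoSATThree.encode
  encode_injective := TwoSATThree.encode_injective
  yes := TwoSATThree.Satisfiable
  size := TwoSATThree.numVars

/-! ## {0,1}-linear programming with sparse rows and columns -/

/-- A rational `m × n` matrix `A` with `m, n ≥ 1`, at most two nonzero entries in each row and at
most three nonzero entries in each column, and a rational vector `b` with one entry for each
row. -/
structure LPTwoThree where
  m : ℕ
  n : ℕ
  m_pos : 1 ≤ m
  n_pos : 1 ≤ n
  A : Matrix (Fin m) (Fin n) ℚ
  b : Fin m → ℚ
  row_sparse : ∀ i, (Finset.univ.filter (fun j => A i j ≠ 0)).card ≤ 2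
  col_sparse : ∀ j, (Finset.univ.filter (fun i => A i j ≠ 0)).card ≤ 3

namespace LPTwoThree

/-- Some `{0,1}`-vector `x` satisfies `A x ≥ b`. -/
def Feasible (P : LPTwoThree) : Prop :=
  ∃ x : Fin P.n → ℚ, (∀ j, x j = 0 ∨ x j = 1) ∧ ∀ i, (P.A *ᵥ x) i ≥ P.b i

/-- A rational number as two binary words: the sign and absolute value of the numerator, and the
denominator. -/
def ratWords (q : ℚ) : List (List Bool) :=
  [decide (q.num < 0) :: Nat.bits q.num.natAbs, Nat.bits q.den]

/-- An instance as a string: row by row, the entries of `A` and then the entry of `b`. -/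
def encode (P : LPTwoThree) : List InSym :=
  encodeWords (tableWords
    (List.ofFn (fun i => (List.ofFn (P.A i) ++ [P.b i]).flatMap ratWords)))

theorem ratWords_inj {q q' : ℚ} (h : ratWords q = ratWords q') : q = q' := by
  simp only [ratWords, List.cons.injEq, and_true] at h
  obtain ⟨⟨hs, hn⟩, hd⟩ := h
  have hn' := natBits_injective hn
  refine Rat.ext ?_ (natBits_injective hd)
  have hs' : q.num < 0 ↔ q'.num < 0 := by simpa using hs
  omega

theorem flatMap_ratWords_injective :
    ∀ L L' : List ℚ, L.flatMap ratWords = L'.flatMap ratWords → L = L' := by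
  intro L
  induction L with
  | nil =>
    intro L' h
    cases L' with
    | nil => rfl
    | cons q L' => simp [ratWords] at h
  | cons q L ih =>
    intro L' h
    cases L' with
    | nil => simp [ratWords] at h
    | cons q' L' =>
      have h1 := List.append_inj h (by simp [ratWords])
      rw [ratWords_inj h1.1, ih L' h1.2]

theorem nil_notMem_flatMap_ratWords (L : List ℚ) : [] ∉ L.flatMap ratWords := by
  simp only [List.mem_flatMap, ratWords, not_exists, not_and]
  intro q _ h
  simp only [List.mem_cons, List.not_mem_nil, or_false, reduceCtorEq, false_or] at h
  exact q.den_ne_zero (natBits_injective (h.symm.trans Nat.zero_bits.symm))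

theorem encode_injective : Function.Injective encode := by
  intro P P' h
  have h1 := terminated_injective ([] : List Bool) _ _
    (by simp only [List.mem_ofFn]; rintro c ⟨i, rfl⟩; exact nil_notMem_flatMap_ratWords _)
    (by simp only [List.mem_ofFn]; rintro c ⟨i, rfl⟩; exact nil_notMem_flatMap_ratWords _)
    (encodeWords_injective h)
  obtain ⟨m, n, hm, hn, A, b, hr, hc⟩ := P
  obtain ⟨m', n', hm', hn', A', b', hr', hc'⟩ := P'
  dsimp only at h1
  have e1 : m = m' := by simpa using congrArg List.length h1
  subst e1
  have h2 : ∀ i, List.ofFn (A i) ++ [b i] = List.ofFn (A' i) ++ [b' i] := fun i =>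
    flatMap_ratWords_injective _ _ (congrFun (List.ofFn_injective h1) i)
  have e2 : n = n' := by simpa using congrArg List.length (h2 ⟨0, hm⟩)
  subst e2
  have h3 : A = A' := funext fun i =>
    List.ofFn_injective (List.append_inj (h2 i) (by simp)).1
  have h4 : b = b' := funext fun i => by
    simpa using (List.append_inj (h2 i) (by simp)).2
  subst h3 h4
  rfl

end LPTwoThree

/-- `LP_{2,3}` with the number of rows as size parameter. -/
def lpTwoThreeRow : ParamProblem where
  Inst := LPTwoThree
  encode := LPTwoThree.encode
  encode_injective := LPTwoThree.encode_injective
  yes := LPTwoThree.Feasible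
  size := LPTwoThree.m

/-- `LP_{2,3}` with the number of columns as size parameter. -/
def lpTwoThreeCol : ParamProblem where
  Inst := LPTwoThree
  encode := LPTwoThree.encode
  encode_injective := LPTwoThree.encode_injective
  yes := LPTwoThree.Feasible
  size := LPTwoThree.n

/-! ## Directed s-t connectivity for graphs of degree at most three -/

/-- A directed graph on the vertices `0, …, n - 1` with edge set `E`, in which indegree plus
outdegree of every vertex is at most three, and two designated vertices. -/
structure ThreeDSTCON where
  n : ℕ
  E : Finset (Fin n × Fin n)
  s : Fin n
  t : Fin n
  degree_le : ∀ v, (E.filter (fun e => e.2 = v)).card + (E.filter (fun e => e.1 = v)).card ≤ 3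

namespace ThreeDSTCON

/-- There is a directed path from `s` to `t`. -/
def Connected (G : ThreeDSTCON) : Prop :=
  Relation.ReflTransGen (fun u v => (u, v) ∈ G.E) G.s G.t

/-- An instance as a string: the rows of the adjacency matrix, and then `s` and `t` in binary. -/
def encode (G : ThreeDSTCON) : List InSym :=
  encodeWords
    (List.ofFn (fun u => List.ofFn (fun v => decide ((u, v) ∈ G.E))) ++
      [Nat.bits G.s, Nat.bits G.t])

theorem encode_injective : Function.Injective encode := by
  intro G G' h
  have h1 := encodeWords_injective h
  obtain ⟨n, E, s, t, hd⟩ := G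
  obtain ⟨n', E', s', t', hd'⟩ := G'
  dsimp only at h1
  have e1 : n = n' := by simpa using congrArg List.length h1
  subst e1
  obtain ⟨h2, h3⟩ := List.append_inj h1 (by simp)
  simp only [List.cons.injEq, and_true] at h3
  have hs : s = s' := Fin.ext (natBits_injective h3.1)
  have ht : t = t' := Fin.ext (natBits_injective h3.2)
  have hE : E = E' := by
    ext ⟨u, v⟩
    have h4 := congrFun (List.ofFn_injective (congrFun (List.ofFn_injective h2) u)) v
    simpa using h4
  subst hs ht hE
  rfl

end ThreeDSTCON

/-- `3DSTCON` with the number of vertices as size parameter. -/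
def threeDSTCONVer : ParamProblem where
  Inst := ThreeDSTCON
  encode := ThreeDSTCON.encode
  encode_injective := ThreeDSTCON.encode_injective
  yes := ThreeDSTCON.Connected
  size := ThreeDSTCON.n

/-- `3DSTCON` with the number of edges as size parameter. -/
def threeDSTCONEdg : ParamProblem where
  Inst := ThreeDSTCON
  encode := ThreeDSTCON.encode
  encode_injective := ThreeDSTCON.encode_injective
  yes := ThreeDSTCON.Connected
  size := fun G => G.E.card

/-! Suppose that a logarithmic-space computation decides `P` with the help of answers to instances
of `Q` whose size parameter is at most a constant times that of `P`. Then a sublinear-space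
algorithm for `Q` yields one for `P`: a constant factor `C` in the size contributes at most a factor
`max 1 C` to the space, an encoding of polynomial length turns a polylogarithm into another
polylogarithm, and the computation itself adds logarithmic space and polynomial time. So `LSH P`
implies `LSH Q` (`LSH.of_reduction`), and it is enough to find size-linear reductions that link the
five problems in both directions.

Vertices to edges: the identity works, since a graph of degree at most three has at most `3 n`
edges. Edges to linear programs: give each vertex a value in `{0,1}`, fix the value `1` at `s` and
`0` at `t`, and demand for each edge that the value does not drop along it. This is possible iff `t`
is not reachable (`ThreeDSTCON.toLP_feasible`). An edge is a row with at most two nonzero entries,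
and the degree bound is the bound for columns. Isolated vertices get no column, so that both
dimensions are linear in the number of edges.

Linear programs to formulas: a row depends on at most two variables, so each of its at most four
violating assignments is excluded by one clause with at most two literals. Each such clause uses
private copies of its variables; the copies of one variable are forced to be equal by a cycle of
implications. A copy occurs twice in the cycle and at most once elsewhere, hence at most three times
(`LPTwoThree.formula_occurrences`, `LPTwoThree.toTwoSAT_satisfiable`). The number of copies is
linear in the rows and also in the columns.

Formulas to vertices: a 2CNF formula is unsatisfiable iff some variable and its negation reach each
other in the implication graph (`exists_assignment_iff`). The arcs at a literal correspond to the
occurrences of its variable, so the degree is at most three (`TwoSATThree.arc_degree_le`). The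
algorithm asks two connectivity questions for every candidate variable, so this reduction is not
many-one.

These arguments are carried out for Turing machines as follows. While programs with counters are
compiled into machines that keep each counter in binary on a tape (`exists_machine_of_prog`), so
polynomial running time gives logarithmic space. The predicate `LS` says that a function of
boundedly many counters is computed by such a program; it is closed under substitution and bounded
recursion (`LS.bind`, `LS.iterate`), from which arithmetic, quantifiers, access to words and
comparison of long binary numbers are derived. A question to `Q` is never written down: its symbols
are recomputed on demand (`LSL`) while the algorithm for `Q` is simulated on its own work tapes,
which are cleared afterwards for the next question (`LSP.of_machine`). For this reason `LS` is
relative to a base machine whose configuration must be restored. -/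

/-! ## While programs with counters over a base machine -/

namespace MultiTapeTM

/-- The effect of an action on a configuration. -/
def apply {α : Type} (M : MultiTapeTM α) (x : List α) (a : TMAction M.k M.Q M.Γ) (c : M.Cfg) :
    M.Cfg where
  state := a.next
  inHead := moveIn x a.inMove c.inHead
  tape := fun j => Function.update (c.tape j) (c.head j) (a.write j)
  head := fun j => moveWork (a.move j) (c.head j)

theorem step_of_action_some {α : Type} {M : MultiTapeTM α} {x : List α} {c : M.Cfg}
    {a : TMAction M.k M.Q M.Γ} (h : M.action x c = some a) : M.step x c = M.apply x a c := by
  unfold step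
  rw [h]
  rfl

theorem step_of_action_none {α : Type} {M : MultiTapeTM α} {x : List α} {c : M.Cfg}
    (h : M.action x c = none) : M.step x c = c := by
  unfold step
  rw [h]

theorem Cfg.ext_of {α : Type} {M : MultiTapeTM α} {c c' : M.Cfg} (h₁ : c.state = c'.state)
    (h₂ : c.inHead = c'.inHead) (h₃ : c.tape = c'.tape) (h₄ : c.head = c'.head) : c = c' := by
  cases c
  cases c'
  simp_all

/-- `M` gets from `c` to `c'` in `n` steps, with all work heads in the cells `0, …, S`. -/
def Steps {α : Type} (M : MultiTapeTM α) (x : List α) (S : ℕ) (c : M.Cfg) (n : ℕ) (c' : M.Cfg) :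
    Prop :=
  (M.step x)^[n] c = c' ∧ ∀ i ≤ n, ∀ j, ((M.step x)^[i] c).head j ≤ S

namespace Steps

variable {α : Type} {M : MultiTapeTM α} {x : List α} {S : ℕ}

theorem refl {c : M.Cfg} (h : ∀ j, c.head j ≤ S) : M.Steps x S c 0 c := by
  refine ⟨rfl, fun i hi => ?_⟩
  obtain rfl : i = 0 := by omega
  simpa using h

theorem trans {c c' c'' : M.Cfg} {m n : ℕ} (h : M.Steps x S c m c') (h' : M.Steps x S c' n c'') :
    M.Steps x S c (m + n) c'' := by
  refine ⟨by rw [add_comm, Function.iterate_add_apply, h.1, h'.1], fun i hi j => ?_⟩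
  rcases le_total i m with him | him
  · exact h.2 i him j
  · obtain ⟨k, rfl⟩ := Nat.exists_eq_add_of_le him
    rw [add_comm, Function.iterate_add_apply, h.1]
    exact h'.2 k (by omega) j

theorem head {c c' c'' : M.Cfg} {n : ℕ} (hc : ∀ j, c.head j ≤ S) (h : M.step x c = c')
    (h' : M.Steps x S c' n c'') : M.Steps x S c (n + 1) c'' := by
  refine ⟨by rw [Function.iterate_succ_apply, h, h'.1], fun i hi j => ?_⟩
  cases i with
  | zero => exact hc j
  | succ i =>
    rw [Function.iterate_succ_apply, h]
    exact h'.2 i (by omega) j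

end Steps

end MultiTapeTM

open MultiTapeTM

/-- Tests of a program: whether a counter is nonzero, or a property of what the base machine
scans. -/
inductive Cond (B : MultiTapeTM InSym) where
  | pos (r : ℕ)
  | test (S : B.Q → InCell InSym → (Fin B.k → B.Γ) → Bool)

/-- While programs that act on the configuration of a base machine and on counters. -/
inductive Prog (B : MultiTapeTM InSym) where
  | skip
  | inc (r : ℕ)
  | dec (r : ℕ)
  | act (f : B.Q → InCell InSym → (Fin B.k → B.Γ) → TMAction B.k B.Q B.Γ)
  | seq (p q : Prog B)
  | ite (b : Cond B) (p q : Prog B)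
  | whl (b : Cond B) (p : Prog B)

variable {B : MultiTapeTM InSym}

def Cond.Holds (x : List InSym) (ρ : ℕ → ℕ) (c : B.Cfg) : Cond B → Prop
  | .pos r => ρ r ≠ 0
  | .test S => S c.state (inputCell x c.inHead) (fun j => c.tape j (c.head j)) = true

/-- The program gets from counter values `ρ` and base configuration `c` to `ρ'` and `c'` in time
`t`, with the work heads of the base machine in the cells `0, …, H`. -/
inductive Exec (x : List InSym) (H : ℕ) :
    Prog B → (ℕ → ℕ) → B.Cfg → (ℕ → ℕ) → B.Cfg → ℕ → Prop
  | skip (ρ c) : Exec x H .skip ρ c ρ c 1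
  | inc (r ρ c) : Exec x H (.inc r) ρ c (Function.update ρ r (ρ r + 1)) c 1
  | dec (r ρ c) (h : ρ r ≠ 0) : Exec x H (.dec r) ρ c (Function.update ρ r (ρ r - 1)) c 1
  | act (f ρ c c') (h : c' = B.apply x (f c.state (inputCell x c.inHead)
      (fun j => c.tape j (c.head j))) c) (hH : ∀ j, c'.head j ≤ H) : Exec x H (.act f) ρ c ρ c' 1
  | seq {p q ρ c ρ₁ c₁ ρ₂ c₂ t₁ t₂} (h₁ : Exec x H p ρ c ρ₁ c₁ t₁)
      (h₂ : Exec x H q ρ₁ c₁ ρ₂ c₂ t₂) : Exec x H (.seq p q) ρ c ρ₂ c₂ (t₁ + t₂ + 1)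
  | ite_pos {b p q ρ c ρ' c' t} (hb : Cond.Holds x ρ c b) (h : Exec x H p ρ c ρ' c' t) :
      Exec x H (.ite b p q) ρ c ρ' c' (t + 1)
  | ite_neg {b p q ρ c ρ' c' t} (hb : ¬ Cond.Holds x ρ c b) (h : Exec x H q ρ c ρ' c' t) :
      Exec x H (.ite b p q) ρ c ρ' c' (t + 1)
  | whl_pos {b p ρ c ρ₁ c₁ ρ₂ c₂ t₁ t₂} (hb : Cond.Holds x ρ c b) (h₁ : Exec x H p ρ c ρ₁ c₁ t₁)
      (h₂ : Exec x H (.whl b p) ρ₁ c₁ ρ₂ c₂ t₂) : Exec x H (.whl b p) ρ c ρ₂ c₂ (t₁ + t₂ + 1)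
  | whl_neg {b p ρ c} (hb : ¬ Cond.Holds x ρ c b) : Exec x H (.whl b p) ρ c ρ c 1

/-- One unit of time changes a counter by at most one. This is the only source of bounds for
counters: running time bounds values, and the logarithm of the values bounds the tapes. -/
theorem Exec.counter_le {x : List InSym} {H : ℕ} {p : Prog B} {ρ ρ' : ℕ → ℕ} {c c' : B.Cfg}
    {t : ℕ} (h : Exec x H p ρ c ρ' c' t) (r : ℕ) : ρ' r ≤ ρ r + t := by
  induction h with
  | skip => omega
  | inc s ρ c => by_cases hr : r = s <;> simp [hr]
  | dec s ρ c => by_cases hr : r = s <;> simp [hr] ; omega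
  | act => omega
  | seq _ _ h₁ h₂ => omega
  | ite_pos _ _ h => omega
  | ite_neg _ _ h => omega
  | whl_pos _ _ _ h₁ h₂ => omega
  | whl_neg => omega

theorem Exec.head_le {x : List InSym} {H : ℕ} {p : Prog B} {ρ ρ' : ℕ → ℕ} {c c' : B.Cfg}
    {t : ℕ} (h : Exec x H p ρ c ρ' c' t) (hc : ∀ j, c.head j ≤ H) : ∀ j, c'.head j ≤ H := by
  induction h with
  | skip => exact hc
  | inc => exact hc
  | dec => exact hc
  | act _ _ _ _ _ hH => exact hH
  | seq _ _ h₁ h₂ => exact h₂ (h₁ hc)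
  | ite_pos _ _ h => exact h hc
  | ite_neg _ _ h => exact h hc
  | whl_pos _ _ _ h₁ h₂ => exact h₂ (h₁ hc)
  | whl_neg => exact hc

/-! ## Binary counters -/

/-- The symbol `mark` stands in cell `0` of a counter tape. A machine does not notice when its head
is in the leftmost cell, so the return after a pass needs a visible end. -/
inductive CSym where
  | empty
  | mark
  | digit (b : Bool)

instance : Finite CSym :=
  Finite.of_injective (β := Option (Option Bool))
    (fun | .empty => none | .mark => some none | .digit b => some (some b))
    (by rintro (_ | _ | a) (_ | _ | b) h <;> simp_all)

/-- Passes over a binary counter: increment, decrement, test for zero. -/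
inductive SweepOp where
  | inc
  | dec
  | test

instance : Finite SweepOp :=
  Finite.of_injective (β := Option Bool)
    (fun | .inc => none | .dec => some true | .test => some false)
    (by rintro (_ | _ | _) (_ | _ | _) h <;> simp_all)

namespace SweepOp

/-- The flag is the carry of an increment, the borrow of a decrement, and for the test the
information that a digit `1` has been met. -/
def out : SweepOp → Bool → Bool → Bool
  | inc, fl, b => xor b fl
  | dec, fl, b => xor b fl
  | test, _, b => b

def next : SweepOp → Bool → Bool → Bool
  | inc, fl, b => b && fl
  | dec, fl, b => !b && fl
  | test, fl, b => b || fl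

def extends' : SweepOp → Bool → Bool
  | inc, fl => fl
  | _, _ => false

/-- The digits after a pass over `L` that starts with the flag `fl`. -/
def digits (op : SweepOp) : Bool → List Bool → List Bool
  | fl, [] => if op.extends' fl then [true] else []
  | fl, b :: L => op.out fl b :: digits op (op.next fl b) L

/-- The flag after a pass over `L` that starts with the flag `fl`. -/
def flag (op : SweepOp) : Bool → List Bool → Bool
  | fl, [] => fl
  | fl, b :: L => flag op (op.next fl b) L

end SweepOp

/-- The value of a binary counter, least significant digit first. -/
def digitsValue : List Bool → ℕ
  | [] => 0
  | b :: L => b.toNat + 2 * digitsValue L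

theorem digitsValue_inc (L : List Bool) (fl : Bool) :
    digitsValue (SweepOp.inc.digits fl L) = digitsValue L + fl.toNat := by
  induction L generalizing fl with
  | nil => cases fl <;> simp [SweepOp.digits, SweepOp.extends', digitsValue]
  | cons b L ih =>
    simp only [SweepOp.digits, digitsValue, ih]
    cases b <;> cases fl <;> simp [SweepOp.out, SweepOp.next] <;> omega

theorem digitsValue_dec (L : List Bool) (fl : Bool) (h : fl.toNat ≤ digitsValue L) :
    digitsValue (SweepOp.dec.digits fl L) + fl.toNat = digitsValue L := by
  induction L generalizing fl with
  | nil => cases fl <;> simp_all [SweepOp.digits, SweepOp.extends', digitsValue]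
  | cons b L ih =>
    simp only [SweepOp.digits, digitsValue]
    have := ih (SweepOp.dec.next fl b) (by
      simp only [digitsValue] at h
      cases b <;> cases fl <;> simp [SweepOp.next] at h ⊢ <;> omega)
    cases b <;> cases fl <;> simp [SweepOp.out, SweepOp.next] at this ⊢ <;> omega

theorem digits_test (L : List Bool) (fl : Bool) : SweepOp.test.digits fl L = L := by
  induction L generalizing fl with
  | nil => simp [SweepOp.digits, SweepOp.extends']
  | cons b L ih => simp [SweepOp.digits, ih, SweepOp.out]

theorem flag_test (L : List Bool) (fl : Bool) :
    SweepOp.test.flag fl L = true ↔ fl = true ∨ digitsValue L ≠ 0 := by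
  induction L generalizing fl with
  | nil => simp [SweepOp.flag, digitsValue]
  | cons b L ih =>
    simp only [SweepOp.flag, digitsValue, ih]
    cases b <;> cases fl <;> simp [SweepOp.next]

theorem length_digits_dec (L : List Bool) (fl : Bool) :
    (SweepOp.dec.digits fl L).length = L.length := by
  induction L generalizing fl with
  | nil => simp [SweepOp.digits, SweepOp.extends']
  | cons b L ih => simp [SweepOp.digits, ih]

theorem le_length_digits (op : SweepOp) (L : List Bool) (fl : Bool) :
    L.length ≤ (op.digits fl L).length := by
  induction L generalizing fl with
  | nil => simp
  | cons b L ih => simpa [SweepOp.digits] using ih _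

/-- A new digit is appended only when the carry leaves the top digit, and then the value is at least
`2 ^ L.length`. Decrements do not remove digits, so the length is controlled by the largest value
ever reached and not by the current one. -/
theorem length_digits_inc (L : List Bool) (fl : Bool) :
    (SweepOp.inc.digits fl L).length = L.length ∨
      ((SweepOp.inc.digits fl L).length = L.length + 1 ∧
        2 ^ L.length ≤ digitsValue (SweepOp.inc.digits fl L)) := by
  induction L generalizing fl with
  | nil => cases fl <;> simp [SweepOp.digits, SweepOp.extends', digitsValue]
  | cons b L ih =>
    rcases ih (SweepOp.inc.next fl b) with h | ⟨h, h'⟩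
    · left; simp [SweepOp.digits, h]
    · right
      simp only [SweepOp.digits, List.length_cons, h, true_and, digitsValue, pow_succ]
      omega

/-- The contents of the tape of a counter with the digits `L`. -/
def counterTape (L : List Bool) : ℕ → CSym
  | 0 => .mark
  | i + 1 =>
    match L[i]? with
    | some b => .digit b
    | none => .empty

theorem counterTape_update (P L : List Bool) (b b' : Bool) :
    Function.update (counterTape (P ++ b :: L)) (P.length + 1) (.digit b') =
      counterTape (P ++ b' :: L) := by
  funext i
  cases i with
  | zero => simp [counterTape]
  | succ i =>
    simp only [Function.update_apply, counterTape, add_left_inj]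
    rcases lt_trichotomy i P.length with h | h | h
    · simp [List.getElem?_append_left h, h.ne]
    · simp [h]
    · obtain ⟨k, rfl⟩ := Nat.exists_eq_add_of_lt h
      rw [List.getElem?_append_right (by omega), List.getElem?_append_right (by omega)]
      simp [show P.length + k + 1 - P.length = k + 1 by omega]
      omega

theorem counterTape_extend (P : List Bool) (b : Bool) :
    Function.update (counterTape P) (P.length + 1) (.digit b) = counterTape (P ++ [b]) := by
  funext i
  cases i with
  | zero => simp [counterTape]
  | succ i =>
    simp only [Function.update_apply, counterTape, add_left_inj]
    rcases lt_trichotomy i P.length with h | h | h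
    · simp [List.getElem?_append_left h, h.ne]
    · simp [h]
    · rw [List.getElem?_eq_none (by omega), List.getElem?_eq_none (by simp; omega)]
      simp [h.ne']

/-- The tape of a counter with the value `v`, where no value above `N` has been reached. -/
def CounterRep (N v : ℕ) (T : ℕ → CSym) : Prop :=
  ∃ L, T = counterTape L ∧ digitsValue L = v ∧ 2 ^ L.length ≤ 2 * N

/-! ## Compilation into a Turing machine -/

/-- Control states: initial state, about to run a stack of programs, passing over a counter,
returning to the first cell of a counter tape. -/
inductive Ctl (S : Type) (R : ℕ) where
  | boot
  | run (s : S)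
  | sweep (r : Fin R) (op : SweepOp) (fl : Bool) (s₁ s₂ : S)
  | ret (r : Fin R) (s : S)

instance (S : Type) (R : ℕ) [Finite S] : Finite (Ctl S R) :=
  Finite.of_injective
    (β := Unit ⊕ S ⊕ (Fin R × SweepOp × Bool × S × S) ⊕ (Fin R × S))
    (fun
      | .boot => .inl ()
      | .run s => .inr (.inl s)
      | .sweep r op fl s₁ s₂ => .inr (.inr (.inl (r, op, fl, s₁, s₂)))
      | .ret r s => .inr (.inr (.inr (r, s))))
    (by rintro (_ | _ | _ | _) (_ | _ | _ | _) h <;> simp_all)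

namespace Prog

/-- The stacks that occur while `p` is run on top of the stack `s`. -/
def stackSet : Prog B → List (Prog B) → Set (List (Prog B))
  | seq p q, s => {seq p q :: s} ∪ stackSet p (q :: s) ∪ stackSet q s
  | ite b p q, s => {ite b p q :: s} ∪ stackSet p s ∪ stackSet q s
  | whl b p, s => {whl b p :: s} ∪ stackSet p (whl b p :: s)
  | p, s => {p :: s}

/-- The body of a loop runs on top of the loop itself and returns to the same stack, so repetition
creates no new stacks. This makes the control of the compiled machine finite. -/
theorem finite_stackSet (p : Prog B) (s : List (Prog B)) : (p.stackSet s).Finite := by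
  induction p generalizing s with
  | seq p q hp hq => exact ((Set.finite_singleton _).union (hp _)).union (hq _)
  | ite b p q hp hq => exact ((Set.finite_singleton _).union (hp _)).union (hq _)
  | whl b p hp => exact (Set.finite_singleton _).union (hp _)
  | _ => exact Set.finite_singleton _

theorem mem_stackSet (p : Prog B) (s : List (Prog B)) : p :: s ∈ p.stackSet s := by
  cases p <;> simp [stackSet]

/-- A bound for the counters used by a test. -/
def _root_.Cond.regs : Cond B → ℕ
  | .pos r => r + 1
  | .test _ => 0

/-- A strict bound for the counters used by a program. -/
def regs : Prog B → ℕ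
  | inc r => r + 1
  | dec r => r + 1
  | seq p q => max p.regs q.regs
  | ite b p q => max b.regs (max p.regs q.regs)
  | whl b p => max b.regs p.regs
  | _ => 0

end Prog

namespace Compile

variable (B : MultiTapeTM InSym) (K : Set (List (Prog B))) (R : ℕ)

/-- Stacks in a given set, and the empty stack. -/
abbrev Stk := ↥(insert [] K)

-- The empty stack is a default for stacks outside `K`; it is never used as such, because all stacks
-- that occur lie in the `stackSet` of the compiled program.
open Classical in
noncomputable def toStk (s : List (Prog B)) : Stk B K :=
  if h : s ∈ insert [] K then ⟨s, h⟩ else ⟨[], Set.mem_insert _ _⟩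

variable {B K R}

theorem val_toStk {s : List (Prog B)} (h : s ∈ insert [] K) : (toStk B K s).val = s := by
  unfold toStk
  rw [dif_pos h]

abbrev State (B : MultiTapeTM InSym) (K : Set (List (Prog B))) (R : ℕ) := Ctl (Stk B K) R × B.Q

abbrev Action (B : MultiTapeTM InSym) (K : Set (List (Prog B))) (R : ℕ) :=
  TMAction (B.k + R) (State B K R) (B.Γ × CSym)

/-- The action that combines an action of the base machine with actions on the counter tapes. -/
def glueAction (ctl : Ctl (Stk B K) R) (a : TMAction B.k B.Q B.Γ) (w : Fin R → CSym)
    (m : Fin R → HeadMove) : Action B K R where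
  next := (ctl, a.next)
  inMove := a.inMove
  write := Fin.append (fun j => (a.write j, .empty)) (fun r => (B.blank, w r))
  move := Fin.append a.move m

/-- The action of the base machine that changes nothing. -/
def idle (q : B.Q) (σ : Fin B.k → B.Γ) : TMAction B.k B.Q B.Γ where
  next := q
  inMove := .stay
  write := σ
  move := fun _ => .stay

/-- The action that changes only the control state and the tape of one counter. -/
def counterAction (ctl : Ctl (Stk B K) R) (q : B.Q) (σ : Fin B.k → B.Γ) (τ : Fin R → CSym)
    (r : Fin R) (w : CSym) (m : HeadMove) : Action B K R :=
  glueAction ctl (idle q σ) (Function.update τ r w) (Function.update (fun _ => .stay) r m)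

-- The scanned symbol is written back and the head moves right: this step leaves the mark in cell
-- `0`, and the pass proper starts at the least significant digit. The value `none` is excluded by
-- the bound `R` for the counters of the program.
open Classical in
noncomputable def startSweep (q : B.Q) (σ : Fin B.k → B.Γ) (τ : Fin R → CSym) (r : ℕ)
    (op : SweepOp) (fl : Bool) (s₁ s₂ : List (Prog B)) : Option (Action B K R) :=
  if h : r < R then
    some (counterAction (.sweep ⟨r, h⟩ op fl (toStk B K s₁) (toStk B K s₂)) q σ τ ⟨r, h⟩
      (τ ⟨r, h⟩) .right)
  else none

noncomputable def goto (q : B.Q) (σ : Fin B.k → B.Γ) (τ : Fin R → CSym) (s : List (Prog B)) :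
    Option (Action B K R) :=
  some (glueAction (.run (toStk B K s)) (idle q σ) τ (fun _ => .stay))

noncomputable def branch (q : B.Q) (i : InCell InSym) (σ : Fin B.k → B.Γ) (τ : Fin R → CSym)
    (b : Cond B) (s₁ s₂ : List (Prog B)) : Option (Action B K R) :=
  match b with
  | .pos r => startSweep q σ τ r .test false s₁ s₂
  | .test S => if S q i σ then goto q σ τ s₁ else goto q σ τ s₂

/-- One step in the execution of a stack of programs. -/
noncomputable def runStack (q : B.Q) (i : InCell InSym) (σ : Fin B.k → B.Γ) (τ : Fin R → CSym) :
    List (Prog B) → Option (Action B K R)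
  | [] => none
  | .skip :: s => goto q σ τ s
  | .inc r :: s => startSweep q σ τ r .inc true s s
  | .dec r :: s => startSweep q σ τ r .dec true s s
  | .act f :: s => some (glueAction (.run (toStk B K s)) (f q i σ) τ (fun _ => .stay))
  | .seq p p' :: s => goto q σ τ (p :: p' :: s)
  | .ite b p p' :: s => branch q i σ τ b (p :: s) (p' :: s)
  | .whl b p :: s => branch q i σ τ b (p :: .whl b p :: s) s

/-- Outside the passes all heads on counter tapes stand in cell `0`. A pass ends at the first cell
without a digit, where a surviving carry becomes a new top digit; the flag then selects the stack to
continue with. -/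
noncomputable def transition (ctl : Ctl (Stk B K) R) (q : B.Q) (i : InCell InSym)
    (σ : Fin B.k → B.Γ) (τ : Fin R → CSym) (p : Prog B) : Option (Action B K R) :=
  match ctl with
  | .boot => some (glueAction (.run (toStk B K [p])) (idle q σ) (fun _ => .mark) (fun _ => .stay))
  | .run s => runStack q i σ τ s.val
  | .sweep r op fl s₁ s₂ =>
    match τ r with
    | .digit b => some (counterAction (.sweep r op (op.next fl b) s₁ s₂) q σ τ r
        (.digit (op.out fl b)) .right)
    | _ => some (counterAction (.ret r (if fl then s₁ else s₂)) q σ τ r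
        (if op.extends' fl then .digit true else τ r) .left)
  | .ret r s =>
    match τ r with
    | .mark => some (counterAction (.run s) q σ τ r .mark .stay)
    | _ => some (counterAction (.ret r s) q σ τ r (τ r) .left)

variable (B K R) in
/-- The compiled machine. -/
noncomputable def machine (hK : K.Finite) (p : Prog B) : MultiTapeTM InSym where
  k := B.k + R
  Q := State B K R
  Γ := B.Γ × CSym
  finite_Q :=
    have := B.finite_Q
    have : Finite (Stk B K) := (hK.insert []).to_subtype
    inferInstance
  finite_Γ :=
    have := B.finite_Γ
    inferInstance
  blank := (B.blank, .empty)
  start := (.boot, B.start)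
  accepting := {s | s.2 ∈ B.accepting}
  δ := fun s i σ => transition s.1 s.2 i (fun j => (σ (Fin.castAdd R j)).1)
    (fun r => (σ (Fin.natAdd B.k r)).2) p

variable {hK : K.Finite} {p : Prog B}

/-- The configuration of the compiled machine with given control state, base configuration,
counter tapes and heads on the counter tapes. -/
def glue (ctl : Ctl (Stk B K) R) (c : B.Cfg) (T : Fin R → ℕ → CSym) (hd : Fin R → ℕ) :
    (machine B K R hK p).Cfg where
  state := (ctl, c.state)
  inHead := c.inHead
  tape := Fin.append (fun j i => (c.tape j i, CSym.empty)) (fun r i => (B.blank, T r i))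
  head := Fin.append c.head hd

theorem action_glue (x : List InSym) (ctl : Ctl (Stk B K) R) (c : B.Cfg)
    (T : Fin R → ℕ → CSym) (hd : Fin R → ℕ) :
    (machine B K R hK p).action x (glue ctl c T hd) =
      transition ctl c.state (inputCell x c.inHead) (fun j => c.tape j (c.head j))
        (fun r => T r (hd r)) p := by
  simp [MultiTapeTM.action, machine, glue]

theorem apply_glue (x : List InSym) (ctl ctl' : Ctl (Stk B K) R) (c : B.Cfg)
    (T : Fin R → ℕ → CSym) (hd : Fin R → ℕ) (a : TMAction B.k B.Q B.Γ) (w : Fin R → CSym)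
    (m : Fin R → HeadMove) :
    (machine B K R hK p).apply x (glueAction ctl' a w m) (glue ctl c T hd) =
      glue ctl' (B.apply x a c) (fun r => Function.update (T r) (hd r) (w r))
        (fun r => moveWork (m r) (hd r)) := by
  refine Cfg.ext_of rfl rfl ?_ ?_
  · have key : ∀ j : Fin (B.k + R), Function.update
        (Fin.append (fun j i => (c.tape j i, CSym.empty)) (fun r i => (B.blank, T r i)) j)
        (Fin.append c.head hd j)
        (Fin.append (fun j => (a.write j, CSym.empty)) (fun r => (B.blank, w r)) j) =
        Fin.append (fun j i => ((B.apply x a c).tape j i, CSym.empty))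
          (fun r i => (B.blank, Function.update (T r) (hd r) (w r) i)) j := by
      refine Fin.addCases (fun j => ?_) (fun r => ?_)
      · funext i
        simp only [Fin.append_left, Function.update_apply, MultiTapeTM.apply]
        split <;> rfl
      · funext i
        simp only [Fin.append_right, Function.update_apply]
        split <;> rfl
    exact funext key
  · have key : ∀ j : Fin (B.k + R), moveWork (Fin.append a.move m j) (Fin.append c.head hd j) =
        Fin.append (B.apply x a c).head (fun r => moveWork (m r) (hd r)) j := by
      refine Fin.addCases (fun j => ?_) (fun r => ?_) <;> simp [MultiTapeTM.apply]
    exact funext key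

theorem apply_idle (x : List InSym) (c : B.Cfg) :
    B.apply x (idle c.state (fun j => c.tape j (c.head j))) c = c := by
  simp [MultiTapeTM.apply, idle, moveIn, moveWork]

theorem apply_counterAction (x : List InSym) (ctl ctl' : Ctl (Stk B K) R) (c : B.Cfg)
    (T : Fin R → ℕ → CSym) (hd : Fin R → ℕ) (r : Fin R) (w : CSym) (m : HeadMove) :
    (machine B K R hK p).apply x (counterAction ctl' c.state (fun j => c.tape j (c.head j))
        (fun r => T r (hd r)) r w m) (glue ctl c T hd) =
      glue ctl' c (Function.update T r (Function.update (T r) (hd r) w))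
        (Function.update hd r (moveWork m (hd r))) := by
  unfold counterAction
  rw [apply_glue, apply_idle]
  congr 1
  · funext r'
    by_cases h : r' = r
    · subst h; simp
    · simp [Function.update_of_ne h]
  · funext r'
    by_cases h : r' = r
    · subst h; simp
    · simp [Function.update_of_ne h, moveWork]

theorem head_glue_le {S : ℕ} {ctl : Ctl (Stk B K) R} {c : B.Cfg} {T : Fin R → ℕ → CSym}
    {hd : Fin R → ℕ} (hc : ∀ j, c.head j ≤ S) (hh : ∀ r, hd r ≤ S) :
    ∀ j, (glue (hK := hK) (p := p) ctl c T hd).head j ≤ S := by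
  intro j
  refine Fin.addCases (fun j => ?_) (fun r => ?_) j
  · simpa [glue] using hc j
  · simpa [glue] using hh r

/-- Return to the first cell of a counter tape. -/
theorem steps_ret (x : List InSym) {S : ℕ} {c : B.Cfg} (hc : ∀ j, c.head j ≤ S)
    (T : Fin R → ℕ → CSym) (L : List Bool) (r : Fin R) (s : Stk B K) (hT : T r = counterTape L) :
    ∀ (n : ℕ) (hd : Fin R → ℕ), (∀ r, hd r ≤ S) → hd r = n → n ≤ L.length →
    (machine B K R hK p).Steps x S (glue (.ret r s) c T hd) (n + 1)
      (glue (.run s) c T (Function.update hd r 0)) := by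
  intro n
  induction n with
  | zero =>
    intro hd hh hr hn
    refine Steps.head (head_glue_le hc hh) (c' := glue (.run s) c T (Function.update hd r 0)) ?_
      (Steps.refl (head_glue_le hc fun r' => ?_))
    · rw [step_of_action_some (a := counterAction (.run s) c.state
        (fun j => c.tape j (c.head j)) (fun r => T r (hd r)) r .mark .stay)]
      · rw [apply_counterAction]
        congr 1
        · rw [Function.update_eq_self_iff, Function.update_eq_self_iff, hT, hr]; rfl
        · rw [hr]; rfl
      · rw [action_glue]
        simp only [transition, hT, hr, counterTape]
        rfl
    · by_cases h : r' = r
      · subst h; simp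
      · simpa [Function.update_of_ne h] using hh r'
  | succ n ih =>
    intro hd hh hr hn
    have hh' : ∀ r', Function.update hd r n r' ≤ S := by
      intro r'
      by_cases h : r' = r
      · subst h; have := hh r'; simp; omega
      · simpa [Function.update_of_ne h] using hh r'
    have := ih (Function.update hd r n) hh' (by simp) (by omega)
    rw [Function.update_idem] at this
    refine Steps.head (head_glue_le hc hh) ?_ this
    rw [step_of_action_some (a := counterAction (.ret r s) c.state
        (fun j => c.tape j (c.head j)) (fun r => T r (hd r)) r (T r (hd r)) .left)]
    · rw [apply_counterAction]
      congr 1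
      · simp
      · rw [hr]; rfl
    · rw [action_glue]
      simp only [transition, hT, hr, counterTape]
      rw [List.getElem?_eq_getElem (by omega)]
      rfl

/-- A pass over a counter tape from a digit to the end. -/
theorem steps_sweep (x : List InSym) {S : ℕ} {c : B.Cfg} (hc : ∀ j, c.head j ≤ S) (r : Fin R)
    (s₁ s₂ : Stk B K) (op : SweepOp) :
    ∀ (L P : List Bool) (fl : Bool) (T : Fin R → ℕ → CSym) (hd : Fin R → ℕ), (∀ r, hd r ≤ S) →
    T r = counterTape (P ++ L) → hd r = P.length + 1 → P.length + L.length + 1 ≤ S →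
    (machine B K R hK p).Steps x S (glue (.sweep r op fl s₁ s₂) c T hd) (L.length + 1)
      (glue (.ret r (if op.flag fl L then s₁ else s₂)) c
        (Function.update T r (counterTape (P ++ op.digits fl L)))
        (Function.update hd r (P.length + L.length))) := by
  intro L
  induction L with
  | nil =>
    intro P fl T hd hh hT hr hS
    refine Steps.head (head_glue_le hc hh) (c' := glue (.ret r (if op.flag fl [] then s₁ else s₂)) c
        (Function.update T r (counterTape (P ++ op.digits fl [])))
        (Function.update hd r (P.length + 0))) ?_
      (Steps.refl (head_glue_le hc fun r' => ?_))
    · have hblank : T r (hd r) = .empty := by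
        rw [hT, hr]; simp [counterTape]
      rw [step_of_action_some (a := counterAction (.ret r (if fl then s₁ else s₂)) c.state
        (fun j => c.tape j (c.head j)) (fun r => T r (hd r)) r
        (if op.extends' fl then .digit true else T r (hd r)) .left)]
      · rw [apply_counterAction]
        congr 1
        · congr 1
          simp only [SweepOp.digits]
          split
          · rw [hT, hr, List.append_nil, counterTape_extend]
          · rw [Function.update_eq_self, hT]
        · rw [hr]; rfl
      · rw [action_glue]
        simp only [transition, hblank]
        rfl
    · by_cases h : r' = r
      · subst h; simp; omega
      · simpa [Function.update_of_ne h] using hh r'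
  | cons b L ih =>
    intro P fl T hd hh hT hr hS
    simp only [List.length_cons] at hS
    have hh' : ∀ r', Function.update hd r (P.length + 2) r' ≤ S := by
      intro r'
      by_cases h : r' = r
      · subst h; simp; omega
      · simpa [Function.update_of_ne h] using hh r'
    have := ih (P ++ [op.out fl b]) (op.next fl b)
      (Function.update T r (counterTape (P ++ [op.out fl b] ++ L)))
      (Function.update hd r (P.length + 2)) hh' (by simp) (by simp) (by simp; omega)
    rw [Function.update_idem, Function.update_idem] at this
    simp only [List.length_cons, SweepOp.flag, SweepOp.digits]
    have e1 : (P ++ [op.out fl b]).length + L.length = P.length + (L.length + 1) := by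
      simp; omega
    rw [e1] at this
    have e2 : P ++ [op.out fl b] ++ op.digits (op.next fl b) L =
      P ++ op.out fl b :: op.digits (op.next fl b) L := by simp
    rw [e2] at this
    refine Steps.head (head_glue_le hc hh) ?_ this
    have hsym : T r (hd r) = .digit b := by
      rw [hT, hr]; simp [counterTape]
    rw [step_of_action_some (a := counterAction (.sweep r op (op.next fl b) s₁ s₂) c.state
        (fun j => c.tape j (c.head j)) (fun r => T r (hd r)) r (.digit (op.out fl b)) .right)]
    · rw [apply_counterAction]
      congr 1
      · rw [hT, hr, counterTape_update]
        simp
      · rw [hr]; rfl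
    · rw [action_glue]
      simp only [transition, hsym]
      rfl

/-- A complete pass over a counter. -/
theorem steps_counter (x : List InSym) {S : ℕ} {c : B.Cfg} (hc : ∀ j, c.head j ≤ S) (r : Fin R)
    (s : Stk B K) (s₁ s₂ : List (Prog B)) (op : SweepOp) (fl : Bool) (L : List Bool)
    (T : Fin R → ℕ → CSym)
    (hT : T r = counterTape L) (hS : L.length + 1 ≤ S)
    (hs : ∀ i σ τ, runStack c.state i σ τ s.val =
      startSweep (K := K) (R := R) c.state σ τ r op fl s₁ s₂) :
    (machine B K R hK p).Steps x S (glue (.run s) c T (fun _ => 0)) (2 * L.length + 3)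
      (glue (.run (toStk B K (if op.flag fl L then s₁ else s₂))) c
        (Function.update T r (counterTape (op.digits fl L))) (fun _ => 0)) := by
  have h1 := steps_sweep (hK := hK) (p := p) x hc r (toStk B K s₁) (toStk B K s₂) op L [] fl T
    (Function.update (fun _ => 0) r 1)
    (fun r' => by by_cases h : r' = r <;> simp [h]; omega)
    (by simpa using hT) (by simp) (by simp; omega)
  have h2 := steps_ret (hK := hK) (p := p) x hc
    (Function.update T r (counterTape (op.digits fl L))) (op.digits fl L) r
    (if op.flag fl L then toStk B K s₁ else toStk B K s₂) (by simp) L.length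
    (Function.update (fun _ => 0) r L.length)
    (fun r' => by by_cases h : r' = r <;> simp [h]; omega)
    (by simp) (le_length_digits _ _ _)
  simp only [Function.update_idem, List.nil_append, List.length_nil, zero_add] at h1 h2
  have h3 := h1.trans h2
  have e : Function.update (fun _ : Fin R => 0) r 0 = fun _ => 0 := by
    rw [Function.update_eq_self_iff]
  rw [e] at h3
  have e2 : (if op.flag fl L then toStk B K s₁ else toStk B K s₂) =
      toStk B K (if op.flag fl L then s₁ else s₂) := by split <;> rfl
  rw [e2] at h3
  have h4 := Steps.head (c := glue (hK := hK) (p := p) (.run s) c T (fun _ => 0))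
    (head_glue_le hc fun _ => Nat.zero_le _) (x := x) ?_ h3
  · convert h4 using 1; omega
  · rw [step_of_action_some (a := counterAction (.sweep r op fl (toStk B K s₁) (toStk B K s₂))
        c.state (fun j => c.tape j (c.head j)) (fun r => T r 0) r (T r 0) .right)]
    · rw [apply_counterAction (hd := fun _ => 0)]
      congr 1
      simp
    · rw [action_glue]
      simp only [transition, hs, startSweep, r.isLt, dif_pos]
      rfl

/-- The counter tapes hold the values `ρ`. -/
def Reps (N : ℕ) (ρ : ℕ → ℕ) (T : Fin R → ℕ → CSym) : Prop :=
  ∀ r : Fin R, CounterRep N (ρ r) (T r)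

theorem reps_update {N : ℕ} {ρ : ℕ → ℕ} {T : Fin R → ℕ → CSym} (h : Reps N ρ T) (r : Fin R)
    {v : ℕ} {t : ℕ → CSym} (ht : CounterRep N v t) :
    Reps N (Function.update ρ r v) (Function.update T r t) := by
  intro r'
  by_cases hr : r' = r
  · subst hr; simpa using ht
  · simpa [Function.update_of_ne hr, Function.update_of_ne (Fin.val_ne_of_ne hr)] using h r'

theorem steps_goto (x : List InSym) {S : ℕ} {c : B.Cfg} (hc : ∀ j, c.head j ≤ S)
    (s : Stk B K) (s' : List (Prog B)) (T : Fin R → ℕ → CSym)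
    (hs : ∀ σ τ, σ = (fun j => c.tape j (c.head j)) → runStack c.state (inputCell x c.inHead) σ τ s.val =
      goto (K := K) (R := R) c.state σ τ s') :
    (machine B K R hK p).Steps x S (glue (.run s) c T (fun _ => 0)) 1
      (glue (.run (toStk B K s')) c T (fun _ => 0)) := by
  refine Steps.head (head_glue_le hc fun _ => Nat.zero_le _) ?_
    (Steps.refl (head_glue_le hc fun _ => Nat.zero_le _))
  rw [step_of_action_some (a := glueAction (.run (toStk B K s'))
    (idle c.state (fun j => c.tape j (c.head j))) (fun r => T r 0) (fun _ => .stay))]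
  · rw [apply_glue (hd := fun _ => 0), apply_idle]
    congr 1
    funext r
    simp
  · rw [action_glue]
    simp only [transition]
    rw [hs _ _ rfl]
    rfl

theorem steps_branch (x : List InSym) {S N : ℕ} {c : B.Cfg} (hc : ∀ j, c.head j ≤ S)
    (hN : Nat.log 2 N + 2 ≤ S)
    (s : Stk B K) (b : Cond B) (s₁ s₂ : List (Prog B)) {ρ : ℕ → ℕ} {T : Fin R → ℕ → CSym}
    (hT : Reps N ρ T) (hb : b.regs ≤ R)
    (hs : ∀ i σ τ, runStack c.state i σ τ s.val =
      branch (K := K) (R := R) c.state i σ τ b s₁ s₂) :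
    (Cond.Holds x ρ c b → ∃ n ≤ 2 * S + 3,
      (machine B K R hK p).Steps x S (glue (.run s) c T (fun _ => 0)) n
      (glue (.run (toStk B K s₁)) c T (fun _ => 0))) ∧
    (¬ Cond.Holds x ρ c b → ∃ n ≤ 2 * S + 3,
      (machine B K R hK p).Steps x S (glue (.run s) c T (fun _ => 0)) n
      (glue (.run (toStk B K s₂)) c T (fun _ => 0))) := by
  cases b with
  | pos r =>
    obtain ⟨L, hL, hv, hl⟩ := hT ⟨r, hb⟩
    -- `2 ^ L.length ≤ 2 * N` gives `L.length ≤ Nat.log 2 N + 1`, and a pass reaches one cell beyond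
    -- the last digit, that is, cell `L.length + 1`.
    have hlen : L.length + 1 ≤ S := by
      have h1 : N ≠ 0 := by rintro rfl; simp at hl
      have h2 : L.length ≤ Nat.log 2 (2 * N) := Nat.le_log_of_pow_le (by norm_num) hl
      rw [mul_comm, Nat.log_mul_base (by norm_num) h1] at h2
      omega
    have := steps_counter (hK := hK) (p := p) x hc ⟨r, hb⟩ s s₁ s₂ .test false L T hL hlen
      (fun i σ τ => by rw [hs]; rfl)
    rw [digits_test, ← hL, Function.update_eq_self] at this
    have hf := flag_test L false
    simp only [Bool.false_eq_true, false_or, hv] at hf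
    constructor
    · intro h
      rw [if_pos (hf.2 h)] at this
      exact ⟨_, by omega, this⟩
    · intro h
      rw [if_neg (fun h' => h (hf.1 h'))] at this
      exact ⟨_, by omega, this⟩
  | test A =>
    constructor
    · intro h
      refine ⟨1, by omega, steps_goto x hc s s₁ T fun σ τ hσ => ?_⟩
      subst hσ
      rw [hs]
      exact if_pos h
    · intro h
      refine ⟨1, by omega, steps_goto x hc s s₂ T fun σ τ hσ => ?_⟩
      subst hσ
      rw [hs]
      exact if_neg h

/-- The compiled machine simulates the execution of a program. -/
theorem steps_exec {x : List InSym} {H S N : ℕ} (hHS : H ≤ S) (hN : Nat.log 2 N + 2 ≤ S)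
    {pm p₀ : Prog B} {ρ ρ' : ℕ → ℕ} {c c' : B.Cfg} {t : ℕ} (h : Exec x H p₀ ρ c ρ' c' t) :
    ∀ (s : List (Prog B)) (T : Fin R → ℕ → CSym), p₀.stackSet s ⊆ insert [] K →
    p₀.regs ≤ R → Reps N ρ T → (∀ r, ρ r + t ≤ N) → (∀ j, c.head j ≤ H) →
    ∃ n ≤ t * (2 * S + 3), ∃ T', Reps N ρ' T' ∧
      (machine B K R hK pm).Steps x S (glue (.run (toStk B K (p₀ :: s))) c T (fun _ => 0)) n
        (glue (.run (toStk B K s)) c' T' (fun _ => 0)) := by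
  have hlen : ∀ L : List Bool, 2 ^ L.length ≤ 2 * N → L.length + 1 ≤ S := by
    intro L hl
    have h1 : N ≠ 0 := by rintro rfl; simp at hl
    have h2 : L.length ≤ Nat.log 2 (2 * N) := Nat.le_log_of_pow_le (by norm_num) hl
    rw [mul_comm, Nat.log_mul_base (by norm_num) h1] at h2
    omega
  induction h with
  | skip ρ c =>
    intro s T hs hr hT hN' hc
    refine ⟨1, by omega, T, hT, steps_goto (p := pm) x (fun j => (hc j).trans hHS) _ _ T fun σ τ _ => ?_⟩
    rw [val_toStk (hs (Prog.mem_stackSet _ _))]; rfl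
  | inc r ρ c =>
    intro s T hs hr hT hN' hc
    obtain ⟨L, hL, hv, hl⟩ := hT ⟨r, hr⟩
    have := steps_counter (hK := hK) (p := pm) x (fun j => (hc j).trans hHS) ⟨r, hr⟩
      (toStk B K (.inc r :: s)) s s .inc true L T hL (hlen L hl)
      (fun i σ τ => by rw [val_toStk (hs (Prog.mem_stackSet _ _))]; rfl)
    rw [ite_self] at this
    have hlS := hlen L hl
    refine ⟨_, by omega, _, reps_update hT ⟨r, hr⟩ ⟨_, rfl, ?_, ?_⟩, this⟩
    · rw [digitsValue_inc, hv]; rfl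
    · rcases length_digits_inc L true with h | ⟨h, h'⟩
      · rwa [h]
      -- If the counter has grown, `2 ^ L.length` is at most the new value `ρ r + 1`, which is at
      -- most `N`.
      · rw [h, pow_succ]
        rw [digitsValue_inc, hv] at h'
        have := hN' r
        simp at h'
        omega
  | dec r ρ c hpos =>
    intro s T hs hr hT hN' hc
    obtain ⟨L, hL, hv, hl⟩ := hT ⟨r, hr⟩
    have := steps_counter (hK := hK) (p := pm) x (fun j => (hc j).trans hHS) ⟨r, hr⟩
      (toStk B K (.dec r :: s)) s s .dec true L T hL (hlen L hl)
      (fun i σ τ => by rw [val_toStk (hs (Prog.mem_stackSet _ _))]; rfl)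
    rw [ite_self] at this
    have hlS := hlen L hl
    refine ⟨_, by omega, _, reps_update hT ⟨r, hr⟩ ⟨_, rfl, ?_, ?_⟩, this⟩
    · have h := digitsValue_dec L true (by rw [hv]; simp; omega)
      rw [hv] at h
      simp at h ⊢
      omega
    · rwa [length_digits_dec]
  | act f ρ c c' hc' hH =>
    intro s T hs hr hT hN' hc
    refine ⟨1, by omega, T, hT, ?_⟩
    refine Steps.head (head_glue_le (fun j => (hc j).trans hHS) fun _ => Nat.zero_le _) ?_
      (Steps.refl (head_glue_le (fun j => (hH j).trans hHS) fun _ => Nat.zero_le _))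
    rw [step_of_action_some (a := glueAction (.run (toStk B K s)) (f c.state (inputCell x c.inHead)
      (fun j => c.tape j (c.head j))) (fun r => T r 0) (fun _ => .stay))]
    · rw [apply_glue (hd := fun _ => 0), hc']
      congr 1
      funext r
      simp
    · rw [action_glue]
      simp only [transition]
      rw [val_toStk (hs (Prog.mem_stackSet _ _))]
      rfl
  | @seq p q ρ c ρ₁ c₁ ρ₂ c₂ t₁ t₂ h₁ h₂ ih₁ ih₂ =>
    intro s T hs hr hT hN' hc
    simp only [Prog.regs, max_le_iff] at hr
    simp only [Prog.stackSet, Set.union_subset_iff] at hs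
    obtain ⟨n₁, hn₁, T₁, hT₁, hs₁⟩ := ih₁ (q :: s) T hs.1.2 hr.1 hT
      (fun r => by have := hN' r; omega) hc
    obtain ⟨n₂, hn₂, T₂, hT₂, hs₂⟩ := ih₂ s T₁ hs.2 hr.2 hT₁
      -- The first part may have raised a counter by `t₁`, but it has also used up `t₁` of the time,
      -- so value plus remaining time is still at most `N`.
      (fun r => by have := hN' r; have := h₁.counter_le r; omega) (h₁.head_le hc)
    have h0 := steps_goto (hK := hK) (p := pm) (s := toStk B K (p.seq q :: s)) x
      (fun j => (hc j).trans hHS) (p :: q :: s) T fun σ τ _ => by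
        rw [val_toStk (hs.1.1 rfl)]; rfl
    refine ⟨_, ?_, T₂, hT₂, h0.trans (hs₁.trans hs₂)⟩
    nlinarith
  | @ite_pos b p q ρ c ρ' c' t hb h ih =>
    intro s T hs hr hT hN' hc
    simp only [Prog.regs, max_le_iff] at hr
    simp only [Prog.stackSet, Set.union_subset_iff] at hs
    obtain ⟨n₁, hn₁, T₁, hT₁, hs₁⟩ := ih s T hs.1.2 hr.2.1 hT
      (fun r => by have := hN' r; omega) hc
    obtain ⟨n, hn, h0⟩ := (steps_branch (hK := hK) (p := pm) (s := toStk B K (.ite b p q :: s)) x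
      (fun j => (hc j).trans hHS) hN b (p :: s) (q :: s) hT hr.1 fun i σ τ => by
        rw [val_toStk (hs.1.1 rfl)]; rfl).1 hb
    refine ⟨_, ?_, T₁, hT₁, h0.trans hs₁⟩
    nlinarith
  | @ite_neg b p q ρ c ρ' c' t hb h ih =>
    intro s T hs hr hT hN' hc
    simp only [Prog.regs, max_le_iff] at hr
    simp only [Prog.stackSet, Set.union_subset_iff] at hs
    obtain ⟨n₁, hn₁, T₁, hT₁, hs₁⟩ := ih s T hs.2 hr.2.2 hT
      (fun r => by have := hN' r; omega) hc
    obtain ⟨n, hn, h0⟩ := (steps_branch (hK := hK) (p := pm) (s := toStk B K (.ite b p q :: s)) x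
      (fun j => (hc j).trans hHS) hN b (p :: s) (q :: s) hT hr.1 fun i σ τ => by
        rw [val_toStk (hs.1.1 rfl)]; rfl).2 hb
    refine ⟨_, ?_, T₁, hT₁, h0.trans hs₁⟩
    nlinarith
  | @whl_pos b p ρ c ρ₁ c₁ ρ₂ c₂ t₁ t₂ hb h₁ h₂ ih₁ ih₂ =>
    intro s T hs hr hT hN' hc
    have hr' := hr
    have hs' := hs
    simp only [Prog.regs, max_le_iff] at hr
    simp only [Prog.stackSet, Set.union_subset_iff] at hs
    obtain ⟨n₁, hn₁, T₁, hT₁, hs₁⟩ := ih₁ (.whl b p :: s) T hs.2 hr.2 hT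
      (fun r => by have := hN' r; omega) hc
    obtain ⟨n₂, hn₂, T₂, hT₂, hs₂⟩ := ih₂ s T₁ hs' hr' hT₁
      (fun r => by have := hN' r; have := h₁.counter_le r; omega) (h₁.head_le hc)
    obtain ⟨n, hn, h0⟩ := (steps_branch (hK := hK) (p := pm) (s := toStk B K (.whl b p :: s)) x
      (fun j => (hc j).trans hHS) hN b (p :: .whl b p :: s) s hT hr.1 fun i σ τ => by
        rw [val_toStk (hs.1 rfl)]; rfl).1 hb
    refine ⟨_, ?_, T₂, hT₂, h0.trans (hs₁.trans hs₂)⟩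
    nlinarith
  | @whl_neg b p ρ c hb =>
    intro s T hs hr hT hN' hc
    simp only [Prog.regs, max_le_iff] at hr
    simp only [Prog.stackSet, Set.union_subset_iff] at hs
    obtain ⟨n, hn, h0⟩ := (steps_branch (hK := hK) (p := pm) (s := toStk B K (.whl b p :: s)) x
      (fun j => (hc j).trans hHS) hN b (p :: .whl b p :: s) s hT hr.1 fun i σ τ => by
        rw [val_toStk (hs.1 rfl)]; rfl).2 hb
    exact ⟨n, by omega, T, hT, h0⟩

end Compile

/-- Every program is simulated by a Turing machine whose space on the additional tapes is
logarithmic in the running time of the program. -/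
theorem exists_machine_of_prog (p : Prog B) : ∃ M : MultiTapeTM InSym,
    ∀ (x : List InSym) (H : ℕ) (ρ' : ℕ → ℕ) (c' : B.Cfg) (t S : ℕ),
      Exec x H p (fun _ => 0) B.init ρ' c' t → H ≤ S → Nat.log 2 (t + 1) + 2 ≤ S →
      (∃ n ≤ t * (2 * S + 3) + 1, M.action x (M.run x n) = none ∧
        ((M.run x n).state ∈ M.accepting ↔ c'.state ∈ B.accepting)) ∧
      ∀ n j, (M.run x n).head j ≤ S := by
  refine ⟨Compile.machine B (p.stackSet []) p.regs (p.finite_stackSet []) p, ?_⟩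
  intro x H ρ' c' t S h hHS hS
  set M := Compile.machine B (p.stackSet []) p.regs (p.finite_stackSet []) p with hM
  have hinit : M.init = Compile.glue .boot B.init (fun _ _ => .empty) (fun _ => 0) := by
    refine Cfg.ext_of rfl rfl ?_ ?_
    · have key : ∀ j : Fin (B.k + p.regs), (fun _ : ℕ => (B.blank, CSym.empty)) =
          Fin.append (fun j i => (B.init.tape j i, CSym.empty))
            (fun _ _ => (B.blank, CSym.empty)) j := by
        refine Fin.addCases (fun j => ?_) (fun r => ?_) <;> simp [MultiTapeTM.init]
      exact funext key
    · have key : ∀ j : Fin (B.k + p.regs), 0 = Fin.append B.init.head (fun _ => 0) j := by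
        refine Fin.addCases (fun j => ?_) (fun r => ?_) <;> simp [MultiTapeTM.init]
      exact funext key
  -- The bound is `t + 1` instead of `t`, because even the empty counter needs a positive `N`.
  have hrep : Compile.Reps (R := p.regs) (t + 1) (fun _ => 0) (fun _ => counterTape []) :=
    fun r => ⟨[], rfl, rfl, by simp; omega⟩
  obtain ⟨n, hn, T', hT', hsteps⟩ := Compile.steps_exec (hK := p.finite_stackSet []) (pm := p)
    hHS hS h [] (fun _ => counterTape []) (Set.subset_insert _ _) le_rfl hrep (fun r => by simp)
    (fun j => Nat.zero_le _)
  have hboot : M.step x M.init = Compile.glue (.run (Compile.toStk B (p.stackSet []) [p])) B.init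
      (fun _ => counterTape []) (fun _ => 0) := by
    rw [hinit, step_of_action_some (a := Compile.glueAction
      (.run (Compile.toStk B (p.stackSet []) [p]))
      (Compile.idle B.init.state (fun j => B.init.tape j (B.init.head j))) (fun _ => .mark)
      (fun _ => .stay))]
    · rw [Compile.apply_glue (hd := fun _ => 0), Compile.apply_idle]
      congr 1
      funext r i
      cases i <;> simp [counterTape]
    · rw [Compile.action_glue]
      rfl
  have hall := Steps.head (c := M.init) (fun j => Nat.zero_le _) hboot hsteps
  have hnone : M.action x (M.run x (n + 1)) = none := by
    unfold MultiTapeTM.run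
    rw [hall.1, Compile.action_glue]
    simp only [Compile.transition]
    rw [Compile.val_toStk (Set.mem_insert _ _)]
    rfl
  refine ⟨⟨n + 1, by omega, hnone, ?_⟩, fun m j => ?_⟩
  · unfold MultiTapeTM.run
    rw [hall.1]
    rfl
  · rcases le_total m (n + 1) with hm | hm
    · exact hall.2 m hm j
    · obtain ⟨d, rfl⟩ := Nat.exists_eq_add_of_le hm
      have : M.run x (n + 1 + d) = M.run x (n + 1) := by
        unfold MultiTapeTM.run at hnone ⊢
        rw [add_comm, Function.iterate_add_apply]
        exact Function.iterate_fixed (step_of_action_none hnone) d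
      rw [this]
      exact hall.2 (n + 1) le_rfl j

/-! ## Polynomial bounds -/

/-- Functions bounded by a power of `n + 2`. -/
def PolyBdd (f : ℕ → ℕ) : Prop := ∃ c, ∀ n, f n ≤ (n + 2) ^ c

namespace PolyBdd

theorem pow (c : ℕ) : PolyBdd (fun n => (n + 2) ^ c) := ⟨c, fun _ => le_rfl⟩

theorem const (k : ℕ) : PolyBdd (fun _ => k) :=
  ⟨k, fun n => (Nat.lt_two_pow_self (n := k)).le.trans (Nat.pow_le_pow_left (by omega) k)⟩

theorem id : PolyBdd (fun n => n) := ⟨1, fun n => by simp⟩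

theorem mul {f g : ℕ → ℕ} (hf : PolyBdd f) (hg : PolyBdd g) : PolyBdd (fun n => f n * g n) := by
  obtain ⟨a, ha⟩ := hf
  obtain ⟨b, hb⟩ := hg
  exact ⟨a + b, fun n => by rw [pow_add]; exact Nat.mul_le_mul (ha n) (hb n)⟩

theorem add {f g : ℕ → ℕ} (hf : PolyBdd f) (hg : PolyBdd g) : PolyBdd (fun n => f n + g n) := by
  obtain ⟨a, ha⟩ := hf
  obtain ⟨b, hb⟩ := hg
  refine ⟨max a b + 1, fun n => ?_⟩
  have h1 : (n + 2) ^ a ≤ (n + 2) ^ max a b := Nat.pow_le_pow_right (by omega) (le_max_left _ _)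
  have h2 : (n + 2) ^ b ≤ (n + 2) ^ max a b := Nat.pow_le_pow_right (by omega) (le_max_right _ _)
  have := ha n
  have := hb n
  rw [pow_succ]
  nlinarith

theorem mono {f g : ℕ → ℕ} (hf : PolyBdd f) (h : ∀ n, g n ≤ f n) : PolyBdd g := by
  obtain ⟨a, ha⟩ := hf
  exact ⟨a, fun n => (h n).trans (ha n)⟩

end PolyBdd

/-! ## Executions that start and end with the initial base configuration -/

/-- The program runs in time at most `N`. -/
def ExecLE (x : List InSym) (H : ℕ) (p : Prog B) (ρ : ℕ → ℕ) (c : B.Cfg) (ρ' : ℕ → ℕ)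
    (c' : B.Cfg) (N : ℕ) : Prop :=
  ∃ t ≤ N, Exec x H p ρ c ρ' c' t

namespace ExecLE

variable {x : List InSym} {H : ℕ} {p q : Prog B} {ρ ρ' ρ'' : ℕ → ℕ} {c c' c'' : B.Cfg}
  {N N' : ℕ}

theorem mono (h : ExecLE x H p ρ c ρ' c' N) (hN : N ≤ N') : ExecLE x H p ρ c ρ' c' N' := by
  obtain ⟨t, ht, h⟩ := h
  exact ⟨t, ht.trans hN, h⟩

theorem congr (h : ExecLE x H p ρ c ρ' c' N) (hρ : ρ' = ρ'') (hc : c' = c'') :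
    ExecLE x H p ρ c ρ'' c'' N := by
  rwa [← hρ, ← hc]

theorem seq (h : ExecLE x H p ρ c ρ' c' N) (h' : ExecLE x H q ρ' c' ρ'' c'' N') :
    ExecLE x H (.seq p q) ρ c ρ'' c'' (N + N' + 1) := by
  obtain ⟨t, ht, h⟩ := h
  obtain ⟨t', ht', h'⟩ := h'
  exact ⟨_, by omega, .seq h h'⟩

theorem ite_pos {b : Cond B} (hb : b.Holds x ρ c) (h : ExecLE x H p ρ c ρ' c' N) :
    ExecLE x H (.ite b p q) ρ c ρ' c' (N + 1) := by
  obtain ⟨t, ht, h⟩ := h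
  exact ⟨_, by omega, .ite_pos hb h⟩

theorem ite_neg {b : Cond B} (hb : ¬ b.Holds x ρ c) (h : ExecLE x H q ρ c ρ' c' N) :
    ExecLE x H (.ite b p q) ρ c ρ' c' (N + 1) := by
  obtain ⟨t, ht, h⟩ := h
  exact ⟨_, by omega, .ite_neg hb h⟩

theorem skip : ExecLE x H .skip ρ c ρ c 1 := ⟨1, le_rfl, .skip _ _⟩

theorem inc (r : ℕ) (h : ρ' = Function.update ρ r (ρ r + 1)) : ExecLE x H (.inc r) ρ c ρ' c 1 :=
  ⟨1, le_rfl, h ▸ .inc _ _ _⟩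

theorem dec (r : ℕ) (h : ρ r ≠ 0) (h' : ρ' = Function.update ρ r (ρ r - 1)) :
    ExecLE x H (.dec r) ρ c ρ' c 1 :=
  ⟨1, le_rfl, h' ▸ .dec _ _ _ h⟩

theorem act {f} (h : c' = B.apply x (f c.state (inputCell x c.inHead)
    (fun j => c.tape j (c.head j))) c) (hH : ∀ j, c'.head j ≤ H) :
    ExecLE x H (.act f) ρ c ρ c' 1 :=
  ⟨1, le_rfl, .act _ _ _ _ h hH⟩

/-- The states `s j`, `d j` before round `j` are prescribed in closed form, so that a loop is
verified by one obligation per round and no invariant has to be found. -/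
theorem whl {b : Cond B} (s : ℕ → ℕ → ℕ) (d : ℕ → B.Cfg) (k : ℕ)
    (h : ∀ j < k, b.Holds x (s j) (d j) ∧ ExecLE x H p (s j) (d j) (s (j + 1)) (d (j + 1)) N)
    (hk : ¬ b.Holds x (s k) (d k)) :
    ExecLE x H (.whl b p) (s 0) (d 0) (s k) (d k) (k * (N + 1) + 1) := by
  induction k generalizing s d with
  | zero => exact ⟨1, by omega, .whl_neg hk⟩
  | succ k ih =>
    obtain ⟨hb, t, ht, he⟩ := h 0 (by omega)
    obtain ⟨t', ht', he'⟩ := ih (fun j => s (j + 1)) (fun j => d (j + 1))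
      (fun j hj => h (j + 1) (by omega)) hk
    refine ⟨_, ?_, .whl_pos hb he he'⟩
    rw [add_mul]
    omega

end ExecLE

/-- Loop that counts a counter down. -/
theorem ExecLE.loop {x : List InSym} {H N : ℕ} {p : Prog B} {r : ℕ} (s : ℕ → ℕ → ℕ)
    (d : ℕ → B.Cfg) (k : ℕ) (hr : ∀ j ≤ k, s j r = k - j)
    (h : ∀ j < k, ExecLE x H p (Function.update (s j) r (k - j - 1)) (d j) (s (j + 1)) (d (j + 1))
      N) :
    ExecLE x H (.whl (.pos r) (.seq (.dec r) p)) (s 0) (d 0) (s k) (d k)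
      (k * (N + 3) + 1) := by
  refine ExecLE.mono (ExecLE.whl (N := 1 + N + 1) s d k (fun j hj => ⟨?_, ?_⟩) ?_)
    (by ring_nf; omega)
  · have := hr j hj.le
    simp only [Cond.Holds]
    omega
  · refine ExecLE.seq (ExecLE.dec r ?_ ?_) (h j hj)
    · have := hr j hj.le
      omega
    · rw [hr j hj.le]
  · have := hr k le_rfl
    simp only [Cond.Holds]
    omega

/-- Set a counter to zero. -/
def Prog.zero (r : ℕ) : Prog B := .whl (.pos r) (.seq (.dec r) .skip)

theorem ExecLE.zero {x : List InSym} {H : ℕ} {ρ ρ' : ℕ → ℕ} {c : B.Cfg} (r : ℕ)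
    (h : ρ' = Function.update ρ r 0) : ExecLE x H (.zero r) ρ c ρ' c (ρ r * 4 + 1) := by
  have := ExecLE.loop (x := x) (H := H) (p := .skip) (N := 1) (r := r)
    (fun j => Function.update ρ r (ρ r - j)) (fun _ => c) (ρ r) (fun j hj => by simp)
    (fun j hj => by
      have e : Function.update (Function.update ρ r (ρ r - j)) r (ρ r - j - 1) =
        Function.update ρ r (ρ r - (j + 1)) := by rw [Function.update_idem, Nat.sub_sub]
      rw [e]; exact ExecLE.skip)
  simpa [h, Prog.zero] using this

/-- Add a counter to another one and set it to zero. -/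
def Prog.move (r q : ℕ) : Prog B := .whl (.pos r) (.seq (.dec r) (.inc q))

theorem ExecLE.move {x : List InSym} {H : ℕ} {ρ ρ' : ℕ → ℕ} {c : B.Cfg} (r q : ℕ) (hrq : r ≠ q)
    (h : ρ' = Function.update (Function.update ρ q (ρ q + ρ r)) r 0) :
    ExecLE x H (.move r q) ρ c ρ' c (ρ r * 4 + 1) := by
  have := ExecLE.loop (x := x) (H := H) (p := .inc q) (N := 1) (r := r)
    (fun j => Function.update (Function.update ρ q (ρ q + j)) r (ρ r - j)) (fun _ => c) (ρ r)
    (fun j hj => by simp)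
    (fun j hj => ExecLE.inc _ (by
      funext i
      simp only [Function.update_apply]
      split_ifs <;> omega))
  simpa [h, Prog.move] using this

/-- Add a counter to another one, with the help of a third one that is zero. -/
def Prog.copy (r q s : ℕ) : Prog B :=
  .seq (.whl (.pos r) (.seq (.dec r) (.seq (.inc q) (.inc s)))) (.move s r)

theorem ExecLE.copy {x : List InSym} {H : ℕ} {ρ ρ' : ℕ → ℕ} {c : B.Cfg} (r q s : ℕ) (hrq : r ≠ q)
    (hrs : r ≠ s) (hqs : q ≠ s) (hs : ρ s = 0) (h : ρ' = Function.update ρ q (ρ q + ρ r)) :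
    ExecLE x H (.copy r q s) ρ c ρ' c (ρ r * 10 + 3) := by
  have h1 := ExecLE.loop (x := x) (H := H) (p := .seq (.inc q) (.inc s)) (N := 3) (r := r)
    (fun j => Function.update (Function.update (Function.update ρ q (ρ q + j)) s j) r (ρ r - j))
    (fun _ => c) (ρ r)
    (fun j hj => by simp)
    (fun j hj => ExecLE.seq (ExecLE.inc _ rfl) (ExecLE.inc _ (by
      funext i
      simp only [Function.update_apply]
      split_ifs <;> omega)))
  have e : Function.update (Function.update (Function.update ρ q (ρ q + 0)) s 0) r (ρ r - 0) = ρ := by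
    funext i
    simp only [Function.update_apply]
    split_ifs with h1 h2 h3
    · rw [h1]; rfl
    · rw [h2, hs]
    · rw [h3]; rfl
    · rfl
  simp only [e] at h1
  refine (h1.seq (ExecLE.move s r hrs.symm (ρ' := ρ') ?_)).mono ?_
  · rw [h]
    funext i
    simp only [Function.update_apply]
    split_ifs <;> simp_all
  · simp [hrs.symm]
    omega

/-! ## Computability in logarithmic space relative to a base machine -/

/-- Types of tuples of natural numbers that are kept in counters. A layout assigns counters to the
components. -/
class Ctx (γ : Type) where
  Lay : Type
  get : Lay → (ℕ → ℕ) → γ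
  below : Lay → ℕ → Prop
  bdd : γ → ℕ → Prop
  below_mono : ∀ {l D D'}, below l D → D ≤ D' → below l D'
  get_congr : ∀ {l D ρ ρ'}, below l D → (∀ i < D, ρ i = ρ' i) → get l ρ = get l ρ'
  bdd_mono : ∀ {g N N'}, bdd g N → N ≤ N' → bdd g N'
  exists_lay : ∃ l D, below l D ∧ ∀ g, ∃ ρ, get l ρ = g ∧ ∀ i ≥ D, ρ i = 0

instance : Ctx Unit where
  Lay := Unit
  get _ _ := ()
  below _ _ := True
  bdd _ _ := True
  below_mono _ _ := trivial
  get_congr _ _ := rfl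
  bdd_mono _ _ := trivial
  exists_lay := ⟨(), 0, trivial, fun _ => ⟨fun _ => 0, rfl, fun _ _ => rfl⟩⟩

instance {γ : Type} [Ctx γ] : Ctx (γ × ℕ) where
  Lay := Ctx.Lay γ × ℕ
  get l ρ := (Ctx.get l.1 ρ, ρ l.2)
  below l D := Ctx.below l.1 D ∧ l.2 < D
  bdd g N := Ctx.bdd g.1 N ∧ g.2 ≤ N
  below_mono h h' := ⟨Ctx.below_mono h.1 h', h.2.trans_le h'⟩
  get_congr h h' := by rw [Ctx.get_congr h.1 h', h' _ h.2]
  bdd_mono h h' := ⟨Ctx.bdd_mono h.1 h', h.2.trans h'⟩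
  exists_lay := by
    obtain ⟨l, D, hl, h⟩ := Ctx.exists_lay (γ := γ)
    refine ⟨(l, D), D + 1, ⟨Ctx.below_mono hl (by omega), by simp⟩, fun g => ?_⟩
    obtain ⟨ρ, hρ, h0⟩ := h g.1
    refine ⟨Function.update ρ D g.2, ?_, fun i hi => ?_⟩
    · simp only [Function.update_self]
      rw [Ctx.get_congr (ρ' := ρ) hl, hρ]
      intro i hi
      rw [Function.update_of_ne hi.ne]
    · rw [Function.update_of_ne (by omega)]
      exact h0 i (by omega)

variable {ι γ : Type} [Ctx γ]

/-- A class of configurations of the base machine in which programs are to be run, with a bound for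
the head positions. -/
structure Scope (B : MultiTapeTM InSym) where
  bound : ℕ
  ok : B.Cfg → Prop
  ok_spec : ∀ c, ok c → c.inHead = 0 ∧ ∀ j, c.head j ≤ bound
  init_ok : ok B.init

/-- The class that consists of the initial configuration. -/
def Scope.init (B : MultiTapeTM InSym) (h : ℕ) : Scope B where
  bound := h
  ok c := c = B.init
  ok_spec := by
    rintro c rfl
    exact ⟨rfl, fun _ => Nat.zero_le _⟩
  init_ok := rfl

/-- All configurations with heads in the cells `0, …, h`. -/
def Scope.full (B : MultiTapeTM InSym) (h : ℕ) : Scope B where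
  bound := h
  ok c := c.inHead = 0 ∧ ∀ j, c.head j ≤ h
  ok_spec _ hc := hc
  init_ok := ⟨rfl, fun _ => Nat.zero_le _⟩

/-- `F` is computed by a program of the base machine that can be run from every configuration of a
class and restores the configuration; the running time is polynomially bounded, and the heads of the
base machine obey the bound of the class. -/
def LS (B : MultiTapeTM InSym) (str : ι → List InSym) (H : ι → Scope B) (F : ι → γ → ℕ) : Prop :=
  ∀ (l : Ctx.Lay γ) (D : ℕ), Ctx.below l D → ∃ p : Prog B, ∀ a, ∃ e, ∀ x ρ, (∀ i ≥ D, ρ i = 0) →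
    Ctx.bdd (Ctx.get l ρ) (((str x).length + 2) ^ a) → ∀ c, (H x).ok c →
    ExecLE (str x) (H x).bound p ρ c (Function.update ρ D (F x (Ctx.get l ρ))) c
      (((str x).length + 2) ^ e)

/-- Polynomially bounded functions. -/
def PB (str : ι → List InSym) (F : ι → γ → ℕ) : Prop :=
  ∀ a, ∃ c, ∀ x g, Ctx.bdd g (((str x).length + 2) ^ a) → F x g ≤ ((str x).length + 2) ^ c

variable {str : ι → List InSym} {H : ι → Scope B}

namespace PB

theorem const (k : ℕ) : PB str (fun _ (_ : γ) => k) := fun _ => by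
  obtain ⟨c, hc⟩ := PolyBdd.const k
  exact ⟨c, fun x g _ => hc _⟩

theorem mono {F G : ι → γ → ℕ} (hF : PB str F) (h : ∀ x g, G x g ≤ F x g) : PB str G := fun a => by
  obtain ⟨c, hc⟩ := hF a
  exact ⟨c, fun x g hg => (h x g).trans (hc x g hg)⟩

theorem add {F G : ι → γ → ℕ} (hF : PB str F) (hG : PB str G) :
    PB str (fun x g => F x g + G x g) := fun a => by
  obtain ⟨c, hc⟩ := hF a
  obtain ⟨d, hd⟩ := hG a
  obtain ⟨e, he⟩ := (PolyBdd.pow c).add (PolyBdd.pow d)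
  exact ⟨e, fun x g hg => (add_le_add (hc x g hg) (hd x g hg)).trans (he _)⟩

theorem mul {F G : ι → γ → ℕ} (hF : PB str F) (hG : PB str G) :
    PB str (fun x g => F x g * G x g) := fun a => by
  obtain ⟨c, hc⟩ := hF a
  obtain ⟨d, hd⟩ := hG a
  exact ⟨c + d, fun x g hg => by rw [pow_add]; exact Nat.mul_le_mul (hc x g hg) (hd x g hg)⟩

theorem length : PB str (fun x (_ : γ) => (str x).length) := fun _ =>
  ⟨1, fun x _ _ => by simp⟩

theorem sum {F : ι → γ → ℕ} {G : ι → γ → ℕ → ℕ} (hF : PB str F)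
    (hG : PB str (fun x (g : γ × ℕ) => G x g.1 g.2)) :
    PB str (fun x g => ∑ i ∈ Finset.range (F x g), G x g i) := fun a => by
  obtain ⟨c, hc⟩ := hF a
  obtain ⟨d, hd⟩ := hG (max a c)
  refine ⟨c + d, fun x g hg => ?_⟩
  have h : ∀ i ∈ Finset.range (F x g), G x g i ≤ ((str x).length + 2) ^ d := by
    intro i hi
    refine hd x (g, i) ⟨Ctx.bdd_mono hg (Nat.pow_le_pow_right (by omega) (le_max_left _ _)), ?_⟩
    exact ((Finset.mem_range.1 hi).le.trans (hc x g hg)).trans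
      (Nat.pow_le_pow_right (by omega) (le_max_right _ _))
  refine (Finset.sum_le_card_nsmul _ _ _ h).trans ?_
  rw [Finset.card_range, smul_eq_mul, pow_add]
  exact Nat.mul_le_mul_right _ (hc x g hg)

theorem last : PB str (fun _ (g : γ × ℕ) => g.2) := fun a => ⟨a, fun _ _ h => h.2⟩

theorem weaken {F : ι → γ → ℕ} (hF : PB str F) : PB str (fun x (g : γ × ℕ) => F x g.1) := fun a => by
  obtain ⟨c, hc⟩ := hF a
  exact ⟨c, fun x g hg => hc x g.1 hg.1⟩

end PB

/-! ### Substitution and bounded recursion in logarithmic space -/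

namespace LS

theorem congr {F G : ι → γ → ℕ} (hF : LS B str H F) (h : ∀ x g, G x g = F x g) : LS B str H G := by
  have : G = F := funext fun x => funext fun g => h x g
  rwa [this]

/-- The result is delivered in a counter that starts at zero, so it cannot exceed the running time.
-/
theorem pb {F : ι → γ → ℕ} (hF : LS B str H F) : PB str F := by
  obtain ⟨l, D, hl, hg⟩ := Ctx.exists_lay (γ := γ)
  obtain ⟨p, hp⟩ := hF l D hl
  intro a
  obtain ⟨c, hc⟩ := hp a
  refine ⟨c, fun x g hb => ?_⟩
  obtain ⟨ρ, rfl, h0⟩ := hg g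
  obtain ⟨t, ht, he⟩ := hc x ρ h0 hb _ (H x).init_ok
  have := he.counter_le D
  rw [Function.update_self, h0 D le_rfl] at this
  omega

theorem zero : LS B str H (fun _ (_ : γ) => 0) := by
  intro l D hl
  refine ⟨.skip, fun a => ⟨1, fun x ρ h0 hb m hm => ?_⟩⟩
  rw [Function.update_eq_self_iff.2 (h0 D le_rfl).symm]
  exact ExecLE.skip.mono (by simp)

theorem succ {F : ι → γ → ℕ} (hF : LS B str H F) : LS B str H (fun x g => F x g + 1) := by
  intro l D hl
  obtain ⟨p, hp⟩ := hF l D hl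
  refine ⟨.seq p (.inc D), fun a => ?_⟩
  obtain ⟨c, hc⟩ := hp a
  obtain ⟨e, he⟩ := (PolyBdd.pow c).add (PolyBdd.const 2)
  exact ⟨e, fun x ρ h0 hb m hm => ((hc x ρ h0 hb m hm).seq (ExecLE.inc D (by simp))).mono (he _)⟩

theorem pred {F : ι → γ → ℕ} (hF : LS B str H F) : LS B str H (fun x g => F x g - 1) := by
  intro l D hl
  obtain ⟨p, hp⟩ := hF l D hl
  refine ⟨.seq p (.ite (.pos D) (.dec D) .skip), fun a => ?_⟩
  obtain ⟨c, hc⟩ := hp a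
  obtain ⟨e, he⟩ := (PolyBdd.pow c).add (PolyBdd.const 3)
  refine ⟨e, fun x ρ h0 hb m hm => ((hc x ρ h0 hb m hm).seq (N' := 2) ?_).mono (he _)⟩
  by_cases h : F x (Ctx.get l ρ) = 0
  · refine ExecLE.ite_neg (by simp [Cond.Holds, h]) ?_
    simp only [h, Nat.zero_sub]
    exact ExecLE.skip
  · exact ExecLE.ite_pos (by simp [Cond.Holds, h]) (ExecLE.dec D (by simpa using h) (by simp))

theorem last : LS B str H (fun _ (g : γ × ℕ) => g.2) := by
  intro l D hl
  refine ⟨.copy l.2 D (D + 1), fun a => ?_⟩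
  obtain ⟨e, he⟩ := ((PolyBdd.pow a).mul (PolyBdd.const 10)).add (PolyBdd.const 3)
  have h2 : l.2 < D := hl.2
  refine ⟨e, fun x ρ h0 hb m hm => (ExecLE.copy l.2 D (D + 1) (by omega) (by omega) (by omega)
    (h0 _ (by omega)) ?_).mono (le_trans ?_ (he _))⟩
  · rw [h0 D le_rfl, zero_add]; rfl
  · have : ρ l.2 ≤ ((str x).length + 2) ^ a := hb.2
    dsimp only
    omega

/-- The program is unchanged; it is used with the layout that forgets the last component. All
rearrangements of arguments work in this way and cost nothing. -/
theorem weaken {F : ι → γ → ℕ} (hF : LS B str H F) :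
    LS B str H (fun x (g : γ × ℕ) => F x g.1) := by
  intro l D hl
  obtain ⟨p, hp⟩ := hF l.1 D hl.1
  refine ⟨p, fun a => ?_⟩
  obtain ⟨c, hc⟩ := hp a
  exact ⟨c, fun x ρ h0 hb => hc x ρ h0 hb.1⟩

theorem get_update {l : Ctx.Lay γ} {D : ℕ} (hl : Ctx.below l D) (ρ : ℕ → ℕ) {r : ℕ} (hr : D ≤ r)
    (v : ℕ) : Ctx.get l (Function.update ρ r v) = Ctx.get l ρ :=
  Ctx.get_congr hl fun i hi => Function.update_of_ne (by omega) _ _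

/-- The value of `F` is parked in counter `D` and serves as the last argument of `G`, which leaves
its result in `D + 1`. Then `D` is cleared and the result moved there. The polynomial bound for `F`
makes the extended tuple of arguments polynomially bounded. -/
theorem bind {F : ι → γ → ℕ} {G : ι → γ → ℕ → ℕ} (hF : LS B str H F)
    (hG : LS B str H (fun x (g : γ × ℕ) => G x g.1 g.2)) :
    LS B str H (fun x g => G x g (F x g)) := by
  intro l D hl
  obtain ⟨p, hp⟩ := hF l D hl
  obtain ⟨q, hq⟩ := hG (l, D) (D + 1) ⟨Ctx.below_mono hl (by omega), by simp⟩
  refine ⟨.seq p (.seq q (.seq (.zero D) (.move (D + 1) D))), fun a => ?_⟩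
  obtain ⟨c, hc⟩ := hp a
  obtain ⟨b, hb⟩ := hF.pb a
  obtain ⟨d, hd⟩ := hq (max a b)
  obtain ⟨f, hf⟩ := hG.pb (max a b)
  obtain ⟨e, he⟩ := (((PolyBdd.pow c).add (PolyBdd.pow d)).add
    (((PolyBdd.pow b).add (PolyBdd.pow f)).mul (PolyBdd.const 4))).add (PolyBdd.const 5)
  refine ⟨e, fun x ρ h0 hbd m hm => ?_⟩
  set g := Ctx.get l ρ with hg
  have hFb := hb x g hbd
  have e1 : Ctx.get (γ := γ × ℕ) (l, D) (Function.update ρ D (F x g)) = (g, F x g) :=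
    Prod.ext (get_update hl ρ le_rfl _) (Function.update_self _ _ _)
  have hbd' : Ctx.bdd (γ := γ × ℕ) (g, F x g) (((str x).length + 2) ^ max a b) :=
    ⟨Ctx.bdd_mono hbd (Nat.pow_le_pow_right (by omega) (le_max_left _ _)),
      hFb.trans (Nat.pow_le_pow_right (by omega) (le_max_right _ _))⟩
  have h2 := hd x (Function.update ρ D (F x g))
    (fun i hi => by rw [Function.update_of_ne (by omega)]; exact h0 i (by omega))
    (by rw [e1]; exact hbd') m hm
  have hGb := hf x _ hbd'
  rw [e1] at h2
  refine ((hc x ρ h0 hbd m hm).seq (h2.seq ((ExecLE.zero D rfl).seq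
    (ExecLE.move (D + 1) D (by omega) ?_)))).mono (le_trans ?_ (he _))
  · funext i
    have := h0 (D + 1) (by omega)
    simp only [Function.update_apply]
    split_ifs <;> first | omega | (subst_vars; simp_all)
  · simp only [Function.update_self, Function.update_of_ne (show D ≠ D + 1 by omega),
      Function.update_of_ne (show D + 1 ≠ D by omega)]
    dsimp only at hGb
    omega

/-- Counter `D` holds the current value, `D + 1` the number of remaining rounds, `D + 2` the index
of the round and `D + 3` the value that the round produces. Polynomial growth of the intermediate
values does not follow from that of a single round and is therefore a hypothesis, needed only for
indices up to `K x g`. -/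
theorem iterate {K I : ι → γ → ℕ} {S : ι → γ → ℕ → ℕ → ℕ} (hK : LS B str H K)
    (hI : LS B str H I) (hS : LS B str H (fun x (g : (γ × ℕ) × ℕ) => S x g.1.1 g.1.2 g.2))
    (hb : PB str (fun x (g : γ × ℕ) => if g.2 ≤ K x g.1 then
      Nat.rec (I x g.1) (fun j s => S x g.1 s j) g.2 else 0)) :
    LS B str H (fun x g => Nat.rec (I x g) (fun j s => S x g s j) (K x g)) := by
  intro l D hl
  obtain ⟨p, hp⟩ := hI l D hl
  obtain ⟨q, hq⟩ := hK l (D + 1) (Ctx.below_mono hl (by omega))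
  obtain ⟨w, hw⟩ := hS ((l, D), D + 2) (D + 3)
    ⟨⟨Ctx.below_mono hl (by omega), show D < D + 3 by omega⟩, show D + 2 < D + 3 by omega⟩
  refine ⟨.seq p (.seq q (.seq (.whl (.pos (D + 1)) (.seq (.dec (D + 1))
    (.seq w (.seq (.zero D) (.seq (.move (D + 3) D) (.inc (D + 2))))))) (.zero (D + 2)))),
    fun a => ?_⟩
  obtain ⟨c, hc⟩ := hp a
  obtain ⟨k, hk⟩ := hK.pb a
  obtain ⟨d, hd⟩ := hq a
  obtain ⟨b, hb⟩ := hb (max a k)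
  obtain ⟨f, hf⟩ := hw (max (max a k) b)
  obtain ⟨e, he⟩ := ((((PolyBdd.pow c).add (PolyBdd.pow d)).add ((PolyBdd.pow k).mul
    (((PolyBdd.pow f).add ((PolyBdd.pow b).mul (PolyBdd.const 8))).add (PolyBdd.const 9)))).add
    ((PolyBdd.pow k).mul (PolyBdd.const 4))).add (PolyBdd.const 10)
  refine ⟨e, fun x ρ h0 hbd m hm => ?_⟩
  set g := Ctx.get l ρ with hg
  have hKb := hk x g hbd
  set T : ℕ → ℕ := fun j => Nat.rec (I x g) (fun j s => S x g s j) j with hT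
  have hTb : ∀ j ≤ K x g, T j ≤ ((str x).length + 2) ^ b := by
    intro j hj
    have := hb x (g, j) ⟨Ctx.bdd_mono hbd (Nat.pow_le_pow_right (by omega) (le_max_left _ _)),
      (hj.trans hKb).trans (Nat.pow_le_pow_right (by omega) (le_max_right _ _))⟩
    simpa only [hj, if_true] using this
  have h1 := hc x ρ h0 hbd m hm
  have e1 : Ctx.get l (Function.update ρ D (I x g)) = g := get_update hl ρ le_rfl _
  have h2 := hd x (Function.update ρ D (I x g))
    (fun i hi => by rw [Function.update_of_ne (by omega)]; exact h0 i (by omega))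
    (by rw [e1]; exact hbd) m hm
  rw [e1] at h2
  let s : ℕ → ℕ → ℕ := fun j => Function.update (Function.update (Function.update ρ D (T j))
    (D + 1) (K x g - j)) (D + 2) j
  have h3 := ExecLE.loop (x := str x) (H := (H x).bound) (r := D + 1) (p := .seq w (.seq (.zero D)
    (.seq (.move (D + 3) D) (.inc (D + 2))))) (N := ((str x).length + 2) ^ f + ((str x).length + 2) ^ b * 8 + 6) s
    (fun _ => m) (K x g) (fun j hj => by simp [s]) (fun j hj => by
      have e2 : Function.update (s j) (D + 1) (K x g - j - 1) =
          Function.update (Function.update (Function.update ρ D (T j))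
            (D + 1) (K x g - (j + 1))) (D + 2) j := by
        funext i
        simp only [s, Function.update_apply]
        split_ifs <;> omega
      rw [e2]
      set σ := Function.update (Function.update (Function.update ρ D (T j))
            (D + 1) (K x g - (j + 1))) (D + 2) j with hσ
      have e3 : Ctx.get (γ := (γ × ℕ) × ℕ) ((l, D), D + 2) σ = ((g, T j), j) := by
        refine Prod.ext (Prod.ext ?_ ?_) ?_
        · exact Ctx.get_congr hl fun i hi => by
            simp only [σ, Function.update_apply]
            split_ifs <;> omega
        · show σ D = T j
          simp [σ]
        · show σ (D + 2) = j
          simp [σ]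
      have h4 := hf x σ
        (fun i hi => by
          simp only [σ, Function.update_apply]
          split_ifs <;> first | omega | exact h0 i (by omega))
        (by
          rw [e3]
          refine ⟨⟨Ctx.bdd_mono hbd (Nat.pow_le_pow_right (by omega) ?_),
            (hTb j hj.le).trans (Nat.pow_le_pow_right (by omega) ?_)⟩,
            (hj.le.trans hKb).trans (Nat.pow_le_pow_right (by omega) ?_)⟩ <;> simp) m hm
      rw [e3] at h4
      refine (h4.seq ((ExecLE.zero D rfl).seq ((ExecLE.move (D + 3) D (by omega) rfl).seq
        (ExecLE.inc (D + 2) ?_)))).mono ?_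
      · have h3 := h0 (D + 3) (by omega)
        have hTj : T (j + 1) = S x g (T j) j := rfl
        funext i
        simp only [σ, s, Function.update_apply, hTj]
        split_ifs <;> first | omega | (subst_vars; simp_all)
      · have h5 := hTb j hj.le
        have h6 := hTb (j + 1) hj
        have hTj : T (j + 1) = S x g (T j) j := rfl
        rw [hTj] at h6
        have e5 : σ D = T j := by simp [σ]
        simp only [Function.update_self, Function.update_of_ne (show D ≠ D + 3 by omega),
          Function.update_of_ne (show D + 3 ≠ D by omega), e5]
        omega)
  have e4 : Function.update (Function.update ρ D (I x g)) (D + 1) (K x g) = s 0 := by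
    have := h0 (D + 2) (by omega)
    funext i
    simp only [s, Function.update_apply]
    split_ifs <;> first | omega | rfl | (subst_vars; simp_all)
  rw [e4] at h2
  refine (h1.seq (h2.seq (h3.seq (ExecLE.zero (D + 2) ?_)))).mono (le_trans ?_ (he _))
  · have := h0 (D + 1) (by omega)
    have := h0 (D + 2) (by omega)
    funext i
    simp only [s, Function.update_apply, T]
    split_ifs <;> first | omega | (subst_vars; simp_all)
  · have e5 : s (K x g) (D + 2) = K x g := by simp [s]
    rw [e5]
    dsimp only
    have := Nat.mul_le_mul_right (((str x).length + 2) ^ f + ((str x).length + 2) ^ b * 8 + 6 + 3) hKb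
    have e6 : ((str x).length + 2) ^ k * (((str x).length + 2) ^ f +
        ((str x).length + 2) ^ b * 8 + 6 + 3) = ((str x).length + 2) ^ k *
        (((str x).length + 2) ^ f + ((str x).length + 2) ^ b * 8 + 9) := rfl
    omega

end LS

/-! ## Reading the input -/

/-- Codes of the symbols of a string; the code `3` stands for positions beyond the end. -/
def symCode : Option InSym → ℕ
  | some (.bit false) => 0
  | some (.bit true) => 1
  | some .sep => 2
  | none => 3

namespace MultiTapeTM

/-- A configuration with the input head moved to `i`. -/
def Cfg.at (c : B.Cfg) (i : ℕ) : B.Cfg := { c with inHead := i }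

/-- Move only the input head. -/
def moveInput (m : HeadMove) : Prog B := .act fun q _ σ => ⟨q, m, σ, fun _ => .stay⟩

theorem execLE_moveInput (x : List InSym) (H : ℕ) (m : HeadMove) (ρ : ℕ → ℕ) (i j : ℕ) {c : B.Cfg}
    (hc : ∀ j, c.head j ≤ H) (h : j = moveIn x m i) : ExecLE x H (moveInput m) ρ (c.at i) ρ (c.at j) 1 := by
  refine ExecLE.act ?_ hc
  refine Cfg.ext_of rfl h ?_ ?_
  · funext j
    simp [MultiTapeTM.apply, Cfg.at]
  · funext j
    simp [MultiTapeTM.apply, Cfg.at, moveWork]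

/-- Move the input head to its leftmost cell. -/
def rewind : Prog B :=
  .whl (.test fun _ i _ => match i with | .left => false | _ => true) (moveInput .left)

theorem inputCell_succ_ne_left (x : List InSym) (i : ℕ) : inputCell x (i + 1) ≠ .left := by
  unfold inputCell
  split <;> simp_all
  split <;> simp

theorem execLE_rewind (x : List InSym) (H : ℕ) (ρ : ℕ → ℕ) (i : ℕ) {c : B.Cfg}
    (hc : ∀ j, c.head j ≤ H) : ExecLE x H rewind ρ (c.at i) ρ (c.at 0) (i * 2 + 1) := by
  have := ExecLE.whl (B := B) (x := x) (H := H) (p := moveInput .left) (N := 1)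
    (b := .test fun _ i _ => match i with | .left => false | _ => true)
    (fun _ => ρ) (fun j => c.at (i - j)) i (fun j hj => ⟨?_, ?_⟩) ?_
  · rw [Nat.sub_self, Nat.sub_zero] at this
    exact this
  · simp only [Cond.Holds, Cfg.at]
    obtain ⟨k, hk⟩ : ∃ k, i - j = k + 1 := ⟨i - j - 1, by omega⟩
    rw [hk]
    have := inputCell_succ_ne_left x k
    split <;> simp_all
  · exact execLE_moveInput x H .left ρ _ _ hc (by simp only [moveIn]; omega)
  · simp [Cond.Holds, Cfg.at, inputCell]

/-- Test of the scanned input symbol. -/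
def isCode (k : ℕ) : Cond B :=
  .test fun _ i _ => match i with
    | .left => false
    | .sym a => symCode (some a) == k
    | .right => k == 3

theorem holds_isCode (x : List InSym) (ρ : ℕ → ℕ) (i k : ℕ) {c : B.Cfg} :
    (isCode k).Holds x ρ (c.at (min (i + 1) (x.length + 1))) ↔ symCode x[i]? = k := by
  simp only [isCode, Cond.Holds, Cfg.at, Nat.add_min_add_right, inputCell]
  by_cases h : i < x.length
  · rw [min_eq_left h.le]
    rw [List.getElem?_eq_getElem h]
    simp
  · rw [min_eq_right (by omega), List.getElem?_eq_none (by omega), List.getElem?_eq_none (by omega)]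
    simp only [symCode, beq_iff_eq]
    exact eq_comm

/-- Set a counter from zero to the code of the scanned symbol. -/
def recordSym (D : ℕ) : Prog B :=
  .ite (isCode 1) (.inc D) (.ite (isCode 2) (.seq (.inc D) (.inc D))
    (.ite (isCode 3) (.seq (.inc D) (.seq (.inc D) (.inc D))) .skip))

theorem execLE_recordSym (x : List InSym) (H : ℕ) (ρ : ℕ → ℕ) (i D : ℕ) (hD : ρ D = 0)
    {c : B.Cfg} :
    ExecLE x H (recordSym D) ρ (c.at (min (i + 1) (x.length + 1)))
      (Function.update ρ D (symCode x[i]?)) (c.at (min (i + 1) (x.length + 1))) 8 := by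
  have hlt : symCode x[i]? = 0 ∨ symCode x[i]? = 1 ∨ symCode x[i]? = 2 ∨ symCode x[i]? = 3 := by
    generalize x[i]? = a
    rcases a with _ | (_ | _) | _ <;> simp [symCode]
  have hn : ∀ k, symCode x[i]? ≠ k →
      ¬ (isCode k).Holds x ρ (c.at (min (i + 1) (x.length + 1))) := fun k hk h =>
    hk ((holds_isCode x ρ i k).1 h)
  rcases hlt with h | h | h | h
  · refine ((ExecLE.ite_neg (hn 1 (by omega)) (ExecLE.ite_neg (hn 2 (by omega))
      (ExecLE.ite_neg (hn 3 (by omega)) ?_))).mono (N := 4) (by omega))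
    rw [h, Function.update_eq_self_iff.2 hD.symm]
    exact ExecLE.skip
  · exact ((ExecLE.ite_pos ((holds_isCode x ρ i 1).2 h) (ExecLE.inc D (by rw [h, hD]))).mono
      (by omega))
  · exact ((ExecLE.ite_neg (hn 1 (by omega)) (ExecLE.ite_pos ((holds_isCode x ρ i 2).2 h)
      ((ExecLE.inc D rfl).seq (ExecLE.inc D (by simp [h, hD]))))).mono (by omega))
  · exact ((ExecLE.ite_neg (hn 1 (by omega)) (ExecLE.ite_neg (hn 2 (by omega))
      (ExecLE.ite_pos ((holds_isCode x ρ i 3).2 h)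
      ((ExecLE.inc D rfl).seq ((ExecLE.inc D rfl).seq
        (ExecLE.inc D (by simp [h, hD]))))))).mono (by omega))

end MultiTapeTM

namespace LS

theorem read_last : LS B str H (fun x (g : γ × ℕ) => symCode (str x)[g.2]?) := by
  intro l D hl
  have h2 : l.2 < D := hl.2
  refine ⟨.seq (.copy l.2 (D + 1) (D + 2)) (.seq (moveInput .right) (.seq
    (.whl (.pos (D + 1)) (.seq (.dec (D + 1)) (moveInput .right)))
    (.seq (recordSym D) rewind))), fun a => ?_⟩
  obtain ⟨e, he⟩ := ((PolyBdd.pow a).mul (PolyBdd.const 14)).add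
    ((PolyBdd.id.mul (PolyBdd.const 2)).add (PolyBdd.const 25))
  refine ⟨e, fun x ρ h0 hb c hc => ?_⟩
  obtain ⟨hin, hc⟩ := (H x).ok_spec c hc
  have hat : c = c.at 0 := Cfg.ext_of rfl hin rfl rfl
  have hr : ρ l.2 ≤ ((str x).length + 2) ^ a := hb.2
  have h1 := ExecLE.copy (x := str x) (H := (H x).bound) (ρ := ρ) (c := c) l.2 (D + 1) (D + 2)
    (by omega) (by omega) (by omega) (h0 (D + 2) (by omega)) rfl
  rw [h0 (D + 1) (by omega), zero_add] at h1
  have h3 := ExecLE.loop (B := B) (x := str x) (H := (H x).bound) (r := D + 1) (p := moveInput .right)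
    (N := 1) (fun j => Function.update ρ (D + 1) (ρ l.2 - j))
    -- The minimum accounts for positions beyond the end of the input: the head then waits on the
    -- right endmarker, whose code is `3`.
    (fun j => c.at (min (j + 1) ((str x).length + 1))) (ρ l.2) (fun j hj => by simp)
    (fun j hj => by
      rw [Function.update_idem, Nat.sub_sub]
      exact execLE_moveInput _ _ _ _ _ _ hc (by simp only [moveIn]; omega))
  have h4 := execLE_moveInput (B := B) (str x) (H x).bound .right
    (Function.update ρ (D + 1) (ρ l.2)) 0 (min (0 + 1) ((str x).length + 1)) hc rfl
  have h5 := execLE_recordSym (B := B) (str x) (H x).bound ρ (ρ l.2) D (h0 D le_rfl) (c := c)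
  simp only [Nat.sub_self, Nat.sub_zero] at h3
  have e0 : Function.update ρ (D + 1) 0 = ρ :=
    Function.update_eq_self_iff.2 (h0 (D + 1) (by omega)).symm
  rw [e0] at h3
  rw [← hat] at h4
  refine (h1.seq (h4.seq (h3.seq (h5.seq ((execLE_rewind _ _ _ _ hc).congr rfl hat.symm))))).mono (le_trans ?_ (he _))
  dsimp only
  have := min_le_right (ρ l.2 + 1) ((str x).length + 1)
  omega

theorem read {F : ι → γ → ℕ} (hF : LS B str H F) :
    LS B str H (fun x g => symCode (str x)[F x g]?) :=
  LS.bind (G := fun x _ i => symCode (str x)[i]?) hF read_last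

theorem length : LS B str H (fun x (_ : γ) => (str x).length) := by
  intro l D hl
  refine ⟨.seq (moveInput .right) (.seq (.whl
    (.test fun _ i _ => match i with | .sym _ => true | _ => false)
    (.seq (.inc D) (moveInput .right))) rewind), fun a => ?_⟩
  obtain ⟨e, he⟩ := (PolyBdd.id.mul (PolyBdd.const 10)).add (PolyBdd.const 20)
  refine ⟨e, fun x ρ h0 hb c hc => ?_⟩
  obtain ⟨hin, hc⟩ := (H x).ok_spec c hc
  have hat : c = c.at 0 := Cfg.ext_of rfl hin rfl rfl
  have h4 := execLE_moveInput (B := B) (str x) (H x).bound .right ρ 0 1 hc (by simp [moveIn])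
  have hbody : ∀ j < (str x).length, ExecLE (str x) (H x).bound
      (.seq (.inc D) (moveInput .right)) (Function.update ρ D j) (c.at (j + 1))
      (Function.update ρ D (j + 1)) (c.at (j + 1 + 1)) 3 := fun j hj =>
    (ExecLE.inc D (by simp)).seq
      (execLE_moveInput _ _ _ _ _ _ hc (by simp only [moveIn]; omega))
  have h3 := ExecLE.whl (B := B) (x := str x) (H := (H x).bound)
    (b := .test fun _ i _ => match i with | .sym _ => true | _ => false)
    (fun j => Function.update ρ D j) (fun j => c.at (j + 1)) (str x).length
    (fun j hj => ⟨by
        simp [Cond.Holds, Cfg.at, inputCell, List.getElem?_eq_getElem hj], hbody j hj⟩)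
    (by simp [Cond.Holds, Cfg.at, inputCell])
  rw [Function.update_eq_self_iff.2 (h0 D le_rfl).symm] at h3
  rw [← hat] at h4
  refine (h4.seq (h3.seq ((execLE_rewind _ _ _ _ hc).congr rfl hat.symm))).mono (le_trans ?_ (he _))
  dsimp only
  omega

/-! ## Arithmetic and logic -/

theorem const (k : ℕ) : LS B str H (fun _ (_ : γ) => k) := by
  induction k with
  | zero => exact zero
  | succ k ih => exact ih.succ

/-- Insert an unused variable below the last one. -/
theorem mid {F : ι → γ → ℕ → ℕ} (hF : LS B str H (fun x (g : γ × ℕ) => F x g.1 g.2)) :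
    LS B str H (fun x (g : (γ × ℕ) × ℕ) => F x g.1.1 g.2) := by
  intro l D hl
  obtain ⟨p, hp⟩ := hF (l.1.1, l.2) D ⟨hl.1.1, hl.2⟩
  refine ⟨p, fun a => ?_⟩
  obtain ⟨c, hc⟩ := hp a
  exact ⟨c, fun x ρ h0 hb => hc x ρ h0 ⟨hb.1.1, hb.2⟩⟩

theorem add {F G : ι → γ → ℕ} (hF : LS B str H F) (hG : LS B str H G) :
    LS B str H (fun x g => F x g + G x g) := by
  have e : ∀ a k : ℕ, (Nat.rec a (fun _ s => s + 1) k : ℕ) = a + k := by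
    intro a k
    induction k with
    | zero => rfl
    | succ k ih => simp only [ih]; omega
  refine (iterate (S := fun _ _ s _ => s + 1) hG hF (weaken last).succ ?_).congr
    (fun x g => (e _ _).symm)
  refine (hF.pb.weaken.add PB.last).mono fun x g => ?_
  split_ifs
  · rw [e]
  · omega

theorem sub {F G : ι → γ → ℕ} (hF : LS B str H F) (hG : LS B str H G) :
    LS B str H (fun x g => F x g - G x g) := by
  have e : ∀ a k : ℕ, (Nat.rec a (fun _ s => s - 1) k : ℕ) = a - k := by
    intro a k
    induction k with
    | zero => rfl
    | succ k ih => simp only [ih]; omega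
  refine (iterate (S := fun _ _ s _ => s - 1) hG hF (weaken last).pred ?_).congr
    (fun x g => (e _ _).symm)
  refine (hF.pb.weaken).mono fun x g => ?_
  split_ifs
  · rw [e]; omega
  · omega

theorem sum {F : ι → γ → ℕ} {G : ι → γ → ℕ → ℕ} (hF : LS B str H F)
    (hG : LS B str H (fun x (g : γ × ℕ) => G x g.1 g.2)) :
    LS B str H (fun x g => ∑ i ∈ Finset.range (F x g), G x g i) := by
  have e : ∀ x g k, (Nat.rec 0 (fun j s => s + G x g j) k : ℕ) = ∑ i ∈ Finset.range k, G x g i := by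
    intro x g k
    induction k with
    | zero => rfl
    | succ k ih => simp only [ih, Finset.sum_range_succ]
  refine (iterate (S := fun x g s j => s + G x g j) hF zero
    ((weaken last).add (mid hG)) ?_).congr (fun x g => (e _ _ _).symm)
  refine ((hF.pb.sum hG.pb).weaken).mono fun x g => ?_
  split_ifs with h
  · rw [e]
    exact Finset.sum_le_sum_of_subset (Finset.range_subset_range.2 h)
  · omega

theorem mul {F G : ι → γ → ℕ} (hF : LS B str H F) (hG : LS B str H G) :
    LS B str H (fun x g => F x g * G x g) :=
  (sum (G := fun x g _ => G x g) hF hG.weaken).congr fun x g => by simp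

end LS

/-! ### Predicates decided in logarithmic space -/

open Classical in
/-- The indicator of a proposition. -/
noncomputable def ind (p : Prop) : ℕ := if p then 1 else 0

theorem ind_of {p : Prop} (h : p) : ind p = 1 := if_pos h

theorem ind_of_not {p : Prop} (h : ¬ p) : ind p = 0 := if_neg h

theorem ind_eq_ite (p : Prop) [Decidable p] : ind p = if p then 1 else 0 := by
  by_cases h : p <;> simp [ind, h]

/-- Predicates decided in logarithmic space. -/
def LSP (B : MultiTapeTM InSym) (str : ι → List InSym) (H : ι → Scope B) (P : ι → γ → Prop) : Prop :=
  LS B str H (fun x g => ind (P x g))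

namespace LSP

variable {P Q : ι → γ → Prop} {F G : ι → γ → ℕ}

theorem congr (hP : LSP B str H P) (h : ∀ x g, Q x g ↔ P x g) : LSP B str H Q :=
  LS.congr hP fun x g => by rw [h]

theorem weaken (hP : LSP B str H P) : LSP B str H (fun x (g : γ × ℕ) => P x g.1) :=
  LS.weaken hP

theorem mid {P : ι → γ → ℕ → Prop} (hP : LSP B str H (fun x (g : γ × ℕ) => P x g.1 g.2)) :
    LSP B str H (fun x (g : (γ × ℕ) × ℕ) => P x g.1.1 g.2) :=
  LS.mid (F := fun x g i => ind (P x g i)) hP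

theorem bind {P : ι → γ → ℕ → Prop} (hF : LS B str H F)
    (hP : LSP B str H (fun x (g : γ × ℕ) => P x g.1 g.2)) :
    LSP B str H (fun x g => P x g (F x g)) :=
  LS.bind (G := fun x g i => ind (P x g i)) hF hP

theorem not (hP : LSP B str H P) : LSP B str H (fun x g => ¬ P x g) :=
  ((LS.const 1).sub hP).congr fun x g => by by_cases h : P x g <;> simp [ind, h]

theorem and (hP : LSP B str H P) (hQ : LSP B str H Q) : LSP B str H (fun x g => P x g ∧ Q x g) :=
  (LS.mul hP hQ).congr fun x g => by
    by_cases h : P x g <;> by_cases h' : Q x g <;> simp [ind, h, h']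

theorem or (hP : LSP B str H P) (hQ : LSP B str H Q) : LSP B str H (fun x g => P x g ∨ Q x g) :=
  (hP.not.and hQ.not).not.congr fun x g => by tauto

theorem imp (hP : LSP B str H P) (hQ : LSP B str H Q) : LSP B str H (fun x g => P x g → Q x g) :=
  (hP.not.or hQ).congr fun x g => by tauto

theorem iff (hP : LSP B str H P) (hQ : LSP B str H Q) :
    LSP B str H (fun x g => P x g ↔ Q x g) :=
  ((hP.imp hQ).and (hQ.imp hP)).congr fun x g => by tauto

theorem le (hF : LS B str H F) (hG : LS B str H G) : LSP B str H (fun x g => F x g ≤ G x g) :=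
  ((LS.const 1).sub (hF.sub hG)).congr fun x g => by
    by_cases h : F x g ≤ G x g
    · rw [ind_of h]; omega
    · rw [ind_of_not h]; omega

theorem lt (hF : LS B str H F) (hG : LS B str H G) : LSP B str H (fun x g => F x g < G x g) :=
  (le hF.succ hG).congr fun _ _ => Nat.lt_iff_add_one_le

theorem eq (hF : LS B str H F) (hG : LS B str H G) : LSP B str H (fun x g => F x g = G x g) :=
  ((le hF hG).and (le hG hF)).congr fun _ _ => le_antisymm_iff

theorem ex {P : ι → γ → ℕ → Prop} (hF : LS B str H F)
    (hP : LSP B str H (fun x (g : γ × ℕ) => P x g.1 g.2)) :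
    LSP B str H (fun x g => ∃ i < F x g, P x g i) :=
  (lt LS.zero (LS.sum (G := fun x g i => ind (P x g i)) hF hP)).congr fun x g => by
    rw [Finset.sum_pos_iff]
    refine exists_congr fun i => ?_
    by_cases h : P x g i <;> simp [ind, h]

theorem all {P : ι → γ → ℕ → Prop} (hF : LS B str H F)
    (hP : LSP B str H (fun x (g : γ × ℕ) => P x g.1 g.2)) :
    LSP B str H (fun x g => ∀ i < F x g, P x g i) :=
  (ex (P := fun x g i => ¬ P x g i) hF hP.not).not.congr fun x g => by push Not; rfl

end LSP

namespace LS

variable {P : ι → γ → Prop} {F G : ι → γ → ℕ}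

theorem ite [∀ x g, Decidable (P x g)] (hP : LSP B str H P) (hF : LS B str H F)
    (hG : LS B str H G) : LS B str H (fun x g => if P x g then F x g else G x g) :=
  ((mul hP hF).add (mul hP.not hG)).congr fun x g => by
    by_cases h : P x g <;> simp [ind, h]

theorem count {P : ι → γ → ℕ → Prop} [∀ x g, DecidablePred (P x g)] (hF : LS B str H F)
    (hP : LSP B str H (fun x (g : γ × ℕ) => P x g.1 g.2)) :
    LS B str H (fun x g => ((Finset.range (F x g)).filter (P x g)).card) :=
  (sum (G := fun x g i => ind (P x g i)) hF hP).congr fun x g => by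
    rw [Finset.card_filter]
    exact Finset.sum_congr rfl fun i _ => (ind_eq_ite _).symm

end LS

/-! ### Bounded search, division and shifts -/

/-- The least `i < n` with `P i`, or `n`. -/
noncomputable def leastBelow (n : ℕ) (P : ℕ → Prop) : ℕ :=
  (@Finset.filter ℕ (fun i => ∀ j < i + 1, ¬ P j) (Classical.decPred _) (Finset.range n)).card

theorem leastBelow_eq {n i : ℕ} {P : ℕ → Prop} (hi : i < n) (h : P i) (h' : ∀ j < i, ¬ P j) :
    leastBelow n P = i := by
  classical
  unfold leastBelow
  convert Finset.card_range i using 2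
  ext k
  simp only [Finset.mem_filter, Finset.mem_range]
  constructor
  · rintro ⟨_, hk⟩
    by_contra hik
    exact hk i (by omega) h
  · exact fun hk => ⟨by omega, fun j hj => h' j (by omega)⟩

theorem leastBelow_spec {n : ℕ} {P : ℕ → Prop} (h : ∃ i < n, P i) :
    leastBelow n P < n ∧ P (leastBelow n P) ∧ ∀ j < leastBelow n P, ¬ P j := by
  classical
  have h2 : ∃ i, P i := ⟨_, h.choose_spec.2⟩
  have h3 : leastBelow n P = Nat.find h2 := by
    obtain ⟨i, hi, hP⟩ := h
    exact leastBelow_eq ((Nat.find_min' h2 hP).trans_lt hi) (Nat.find_spec h2)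
      (fun j hj => Nat.find_min h2 hj)
  rw [h3]
  obtain ⟨i, hi, hP⟩ := h
  exact ⟨(Nat.find_min' h2 hP).trans_lt hi, Nat.find_spec h2, fun j hj => Nat.find_min h2 hj⟩

namespace LS

variable {F G : ι → γ → ℕ}

theorem least {P : ι → γ → ℕ → Prop} (hF : LS B str H F)
    (hP : LSP B str H (fun x (g : γ × ℕ) => P x g.1 g.2)) :
    LS B str H (fun x g => leastBelow (F x g) (P x g)) := by
  classical
  refine (count (P := fun x g i => ∀ j < i + 1, ¬ P x g j) hF
    (LSP.all last.succ (LSP.mid (P := fun x g i => ¬ P x g i) hP.not))).congr fun x g => ?_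
  unfold leastBelow
  congr

theorem div (hF : LS B str H F) (hG : LS B str H G) : LS B str H (fun x g => F x g / G x g) := by
  classical
  -- The quotient is the number of `i` with `(i + 1) * G ≤ F`. A zero divisor is treated separately,
  -- since then every `i < F` would be counted.
  refine (ite (LSP.eq hG zero) zero (count (P := fun x g i => (i + 1) * G x g ≤ F x g) hF
    (LSP.le (last.succ.mul hG.weaken) hF.weaken))).congr fun x g => ?_
  split_ifs with h
  · simp [h]
  · have h' : 0 < G x g := by omega
    symm
    rw [← Finset.card_range (F x g / G x g)]
    congr 1
    ext k
    simp only [Finset.mem_filter, Finset.mem_range]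
    rw [Nat.lt_iff_add_one_le, Nat.lt_iff_add_one_le, Nat.le_div_iff_mul_le h']
    exact ⟨fun hk => hk.2, fun hk => ⟨le_trans (by nlinarith) hk, hk⟩⟩

theorem mod (hF : LS B str H F) (hG : LS B str H G) : LS B str H (fun x g => F x g % G x g) :=
  (hF.sub (hG.mul (hF.div hG))).congr fun x g => by
    have := Nat.div_add_mod (F x g) (G x g)
    omega

theorem shiftRight (hF : LS B str H F) (hG : LS B str H G) :
    LS B str H (fun x g => F x g / 2 ^ G x g) := by
  have e : ∀ a k : ℕ, (Nat.rec a (fun _ s => s / 2) k : ℕ) = a / 2 ^ k := by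
    intro a k
    induction k with
    | zero => simp
    | succ k ih => simp only [ih]; rw [pow_succ, Nat.div_div_eq_div_mul]
  refine (iterate (S := fun _ _ s _ => s / 2) hG hF ((weaken last).div (const 2)) ?_).congr
    (fun x g => (e _ _).symm)
  refine (hF.pb.weaken).mono fun x g => ?_
  split_ifs
  · rw [e]; exact Nat.div_le_self _ _
  · omega

end LS

/-! ## Words -/

theorem getElem?_bits (n i : ℕ) : (Nat.bits n)[i]? = some true ↔ n.testBit i = true := by
  rw [Nat.testBit_eq_inth, List.getI_eq_getElem?_getD]
  cases (Nat.bits n)[i]? with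
  | none => simp
  | some b => simp

/-- Binary words that can be accessed in logarithmic space. -/
structure LSW (B : MultiTapeTM InSym) (str : ι → List InSym) (H : ι → Scope B)
    (L : ι → γ → List Bool) : Prop where
  length : LS B str H (fun x g => (L x g).length)
  bit : LSP B str H (fun x (g : γ × ℕ) => (L x g.1)[g.2]? = some true)

namespace LSW

theorem bit_at {L : ι → γ → List Bool} {F : ι → γ → ℕ} (h : LSW B str H L) (hF : LS B str H F) :
    LSP B str H (fun x g => (L x g)[F x g]? = some true) :=
  LSP.bind (P := fun x g i => (L x g)[i]? = some true) hF h.bit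

theorem tail {L : ι → γ → List Bool} (h : LSW B str H L) :
    LSW B str H (fun x g => (L x g).tail) where
  length := h.length.pred.congr fun x g => by simp
  bit := (LSP.bind (F := fun x (g : γ × ℕ) => g.2 + 1)
    (P := fun x g i => (L x g.1)[i]? = some true) LS.last.succ
    (LSP.mid (P := fun x g i => (L x g)[i]? = some true) h.bit)).congr fun x g => by simp

theorem eq {L L' : ι → γ → List Bool} (h : LSW B str H L) (h' : LSW B str H L') :
    LSP B str H (fun x g => L x g = L' x g) := by
  refine ((LSP.eq h.length h'.length).and (LSP.all (P := fun x g i =>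
    ((L x g)[i]? = some true ↔ (L' x g)[i]? = some true)) h.length (h.bit.iff h'.bit))).congr
    fun x g => ⟨fun e => by simp [e], fun ⟨e, e'⟩ => ?_⟩
  refine List.ext_getElem e fun i h1 h2 => ?_
  have := e' i h1
  rw [List.getElem?_eq_getElem h1, List.getElem?_eq_getElem h2] at this
  cases h3 : (L x g)[i] <;> cases h4 : (L' x g)[i] <;> simp_all

theorem bits {F : ι → γ → ℕ} (hF : LS B str H F) : LSW B str H (fun x g => Nat.bits (F x g)) := by
  classical
  constructor
  -- The length is the number of `i` with `2 ^ i ≤ F`; all of these lie below `F` because `i < 2 ^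
  -- i`.
  · refine (LS.count (P := fun x g i => F x g / 2 ^ i ≠ 0) hF
      (LSP.eq (hF.weaken.shiftRight LS.last) LS.zero).not).congr fun x g => ?_
    rw [Nat.size_eq_bits_len, ← Finset.card_range (F x g).size]
    congr 1
    ext i
    simp only [Finset.mem_filter, Finset.mem_range, Nat.lt_size]
    rw [Nat.div_ne_zero_iff]
    constructor
    · exact fun h => ⟨(Nat.lt_two_pow_self).trans_le h, (Nat.two_pow_pos i).ne', h⟩
    · exact fun h => h.2.2
  · refine (LSP.eq ((hF.weaken.shiftRight LS.last).mod (LS.const 2)) (LS.const 1)).congr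
      fun x g => ?_
    rw [getElem?_bits, Nat.testBit_eq_decide_div_mod_eq, decide_eq_true_iff]

end LSW

/-- Word `k` of a list, or the empty word. -/
def wordAt (ws : List (List Bool)) (k : ℕ) : List Bool := ws.getD k []

theorem encodeWords_cons (w : List Bool) (ws : List (List Bool)) :
    encodeWords (w :: ws) = w.map InSym.bit ++ InSym.sep :: encodeWords ws := by
  simp [encodeWords]

theorem encodeWords_append (ws ws' : List (List Bool)) :
    encodeWords (ws ++ ws') = encodeWords ws ++ encodeWords ws' := by
  simp [encodeWords]

/-- The number of separators among the first `p` symbols. -/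
def sepsBefore (y : List InSym) (p : ℕ) : ℕ :=
  ((Finset.range p).filter (fun i => symCode y[i]? = 2)).card

theorem symCode_bit (b : Bool) : symCode (some (.bit b)) = b.toNat := by cases b <;> rfl

theorem sepsBefore_append_left (w : List Bool) (y : List InSym) (p : ℕ) (hp : p ≤ w.length) :
    sepsBefore (w.map InSym.bit ++ InSym.sep :: y) p = 0 := by
  unfold sepsBefore
  rw [Finset.card_eq_zero, Finset.filter_eq_empty_iff]
  intro i hi
  rw [Finset.mem_range] at hi
  rw [List.getElem?_append_left (by simp; omega), List.getElem?_map,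
    List.getElem?_eq_getElem (by omega), Option.map_some, symCode_bit]
  cases w[i] <;> simp

theorem sepsBefore_append_right (w : List Bool) (y : List InSym) (p : ℕ) :
    sepsBefore (w.map InSym.bit ++ InSym.sep :: y) (w.length + 1 + p) = sepsBefore y p + 1 := by
  induction p with
  | zero =>
    have := sepsBefore_append_left w y w.length le_rfl
    unfold sepsBefore at this ⊢
    rw [add_zero, Finset.range_add_one, Finset.filter_insert, if_pos, Finset.card_insert_of_notMem,
      this]
    · simp
    · simp
    · rw [List.getElem?_append_right (by simp)]
      simp [symCode]
  | succ p ih =>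
    unfold sepsBefore at ih ⊢
    rw [← add_assoc, Finset.range_add_one, Finset.range_add_one (n := p), Finset.filter_insert,
      Finset.filter_insert]
    have e : (w.map InSym.bit ++ InSym.sep :: y)[w.length + 1 + p]? = y[p]? := by
      rw [List.getElem?_append_right (by simp; omega)]
      rw [List.length_map, show w.length + 1 + p - w.length = p + 1 by omega]
      rfl
    rw [e]
    split_ifs
    · rw [Finset.card_insert_of_notMem (by simp), Finset.card_insert_of_notMem (by simp), ih]
    · exact ih

/-- The separator that ends a word is counted only for later positions, so it still belongs to its
word. Hence the start of word `k` is the number of positions with fewer than `k` separators before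
them, and words are found by counting alone. -/
theorem sepsBefore_lt_iff (ws : List (List Bool)) (k p : ℕ) (hp : p < (encodeWords ws).length) :
    sepsBefore (encodeWords ws) p < k ↔ p < (encodeWords (ws.take k)).length := by
  induction ws generalizing k p with
  | nil => simp [encodeWords] at hp
  | cons w ws ih =>
    cases k with
    | zero => simp [encodeWords]
    | succ k =>
      rw [encodeWords_cons] at hp ⊢
      rw [List.take_succ_cons, encodeWords_cons]
      rcases le_or_gt p w.length with h | h
      · rw [sepsBefore_append_left _ _ _ h]
        simp
        omega
      · obtain ⟨p, rfl⟩ := Nat.exists_eq_add_of_le h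
        rw [Nat.succ_eq_add_one, sepsBefore_append_right]
        have := ih k p (by simp at hp; omega)
        simp only [List.length_append, List.length_map, List.length_cons]
        omega

/-- The position of the first symbol of word `k`. -/
def wordStart (ws : List (List Bool)) (k : ℕ) : ℕ := (encodeWords (ws.take k)).length

theorem wordStart_eq_card (ws : List (List Bool)) (k : ℕ) : wordStart ws k =
    ((Finset.range (encodeWords ws).length).filter
      (fun p => sepsBefore (encodeWords ws) p < k)).card := by
  rw [← Finset.card_range (wordStart ws k)]
  congr 1
  ext p
  simp only [Finset.mem_filter, Finset.mem_range]
  constructor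
  · intro h
    have h' : p < (encodeWords ws).length := by
      refine lt_of_lt_of_le h ?_
      conv_rhs => rw [← List.take_append_drop k ws, encodeWords_append]
      simp [wordStart]
    exact ⟨h', (sepsBefore_lt_iff ws k p h').2 h⟩
  · exact fun h => (sepsBefore_lt_iff ws k p h.1).1 h.2

/-- The last subtraction removes the separator. Beyond the end of the list the two starts coincide,
and truncated subtraction gives the length of the default word. -/
theorem length_wordAt (ws : List (List Bool)) (k : ℕ) :
    (wordAt ws k).length = wordStart ws (k + 1) - wordStart ws k - 1 := by
  unfold wordAt wordStart
  by_cases h : k < ws.length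
  · rw [List.take_succ_eq_append_getElem h, encodeWords_append, encodeWords_cons]
    simp [encodeWords, List.getD_eq_getElem?_getD, h]
  · rw [List.take_of_length_le (by omega), List.take_of_length_le (by omega)]
    simp [List.getD_eq_getElem?_getD, List.getElem?_eq_none (by omega : ws.length ≤ k)]

theorem getElem?_encodeWords (ws : List (List Bool)) (k i : ℕ) (hi : i < (wordAt ws k).length) :
    (encodeWords ws)[wordStart ws k + i]? = (wordAt ws k)[i]?.map InSym.bit := by
  by_cases h : k < ws.length
  · have key : encodeWords ws = encodeWords (ws.take k) ++
        (ws[k].map InSym.bit ++ InSym.sep :: encodeWords (ws.drop (k + 1))) := by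
      rw [← encodeWords_cons, ← encodeWords_append, ← List.drop_eq_getElem_cons h,
        List.take_append_drop]
    unfold wordAt at hi ⊢
    rw [wordStart, key, List.getElem?_append_right (by omega)]
    simp [List.getD_eq_getElem?_getD, h] at hi ⊢
    rw [List.getElem?_append_left (by simpa using hi)]
    simp
  · exfalso
    simp [wordAt, List.getD_eq_getElem?_getD, List.getElem?_eq_none (by omega : ws.length ≤ k)] at hi

theorem length_eq_sepsBefore (ws : List (List Bool)) :
    ws.length = sepsBefore (encodeWords ws) (encodeWords ws).length := by
  induction ws with
  | nil => simp [sepsBefore, encodeWords]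
  | cons w ws ih =>
    rw [encodeWords_cons]
    have := sepsBefore_append_right w (encodeWords ws) (encodeWords ws).length
    simp only [List.length_append, List.length_map, List.length_cons]
    rw [ih, ← this]
    congr 1
    omega

section Words

variable {ws : ι → List (List Bool)} {F : ι → γ → ℕ}

theorem LS.seps (hF : LS B str H F) : LS B str H (fun x g => sepsBefore (str x) (F x g)) :=
  (LS.count (P := fun x _ i => symCode (str x)[i]? = 2) hF
    (LSP.eq (LS.read LS.last) (LS.const 2))).congr fun _ _ => rfl

theorem LS.wordCount (hstr : ∀ x, str x = encodeWords (ws x)) :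
    LS B str H (fun x (_ : γ) => (ws x).length) :=
  (LS.seps LS.length).congr fun x _ => by rw [hstr, ← length_eq_sepsBefore]

theorem LS.startOfWord (hstr : ∀ x, str x = encodeWords (ws x)) (hF : LS B str H F) :
    LS B str H (fun x g => wordStart (ws x) (F x g)) :=
  (LS.count (P := fun x g p => sepsBefore (str x) p < F x g) LS.length
    (LSP.lt (LS.seps LS.last) hF.weaken)).congr fun x g => by
      rw [wordStart_eq_card, hstr]

theorem LSW.word (hstr : ∀ x, str x = encodeWords (ws x)) (hF : LS B str H F) :
    LSW B str H (fun x g => wordAt (ws x) (F x g)) := by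
  have hlen : LS B str H (fun x g => (wordAt (ws x) (F x g)).length) :=
    (((LS.startOfWord hstr hF.succ).sub (LS.startOfWord hstr hF)).sub (LS.const 1)).congr
      fun x g => length_wordAt _ _
  refine ⟨hlen, ((LSP.lt LS.last hlen.weaken).and (LSP.eq
    (LS.read ((LS.startOfWord hstr hF).weaken.add LS.last)) (LS.const 1))).congr fun x g => ?_⟩
  constructor
  · intro h
    obtain ⟨h1, h2⟩ := List.getElem?_eq_some_iff.1 h
    refine ⟨h1, ?_⟩
    rw [hstr, getElem?_encodeWords _ _ _ h1, h]
    rfl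
  · rintro ⟨h1, h2⟩
    rw [hstr, getElem?_encodeWords _ _ _ h1, List.getElem?_eq_getElem h1, Option.map_some,
      symCode_bit] at h2
    rw [List.getElem?_eq_getElem h1]
    cases h3 : (wordAt (ws x) (F x g.1))[g.2] <;> simp_all

end Words

/-! ## Strings produced in logarithmic space -/

/-- Search for a position in a string: numbers below `4` are codes of symbols that have been found,
and `4 + i` means that position `i` is looked for. -/
def scan (L : List InSym) (r : ℕ) : ℕ :=
  if r < 4 then r else if r - 4 < L.length then symCode L[r - 4]? else r - L.length

theorem symCode_lt (a : Option InSym) : symCode a < 4 := by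
  rcases a with _ | (_ | _) | _ <;> simp [symCode]

/-- Concatenation of strings becomes composition of functions on single numbers, and `flatMap` over
a range becomes iteration. So a symbol of a long string can be computed without storing the string.
-/
theorem scan_append (L L' : List InSym) (r : ℕ) : scan (L ++ L') r = scan L' (scan L r) := by
  unfold scan
  by_cases h1 : r < 4
  · simp [h1]
  · by_cases h2 : r - 4 < L.length
    · simp only [h1, h2, if_true, if_false, symCode_lt, List.length_append,
        List.getElem?_append_left h2]
      rw [if_pos (by omega)]
    · rw [if_neg h1, if_neg h1, if_neg h2, List.length_append]
      simp only [List.getElem?_append_right (show L.length ≤ r - 4 by omega)]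
      by_cases h3 : r - 4 < L.length + L'.length
      · rw [if_pos h3, if_neg (by omega), if_pos (by omega)]
        congr 2
        omega
      · rw [if_neg h3, if_neg (by omega), if_neg (by omega)]
        omega

/-- However many pieces are scanned in succession, the number never exceeds the starting value by
more than `3`: a position only decreases, and codes are below `4`. This is the growth bound for the
iteration. -/
theorem scan_le (L : List InSym) (r : ℕ) : scan L r ≤ r + 3 := by
  unfold scan
  have := symCode_lt L[r - 4]?
  split_ifs <;> omega

theorem sum_map_range (f : ℕ → ℕ) (n : ℕ) :
    ((List.range n).map f).sum = ∑ i ∈ Finset.range n, f i := by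
  induction n with
  | zero => simp
  | succ n ih => simp [List.range_succ, Finset.sum_range_succ, ih]

/-- Strings that are produced symbol by symbol in logarithmic space. -/
structure LSL (B : MultiTapeTM InSym) (str : ι → List InSym) (H : ι → Scope B)
    (S : ι → γ → List InSym) : Prop where
  scan : LS B str H (fun x (g : γ × ℕ) => scan (S x g.1) g.2)
  pb : PB str (fun x g => (S x g).length)

namespace LSL

variable {S T : ι → γ → List InSym} {F : ι → γ → ℕ}

theorem congr (h : LSL B str H S) (e : ∀ x g, T x g = S x g) : LSL B str H T := by
  have : T = S := funext fun x => funext fun g => e x g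
  rwa [this]

theorem nil : LSL B str H (fun _ (_ : γ) => []) where
  scan := LS.last.congr fun x g => by simp [_root_.scan]
  pb := PB.const 0

theorem singleton (a : InSym) : LSL B str H (fun _ (_ : γ) => [a]) where
  scan := (LS.ite (LSP.lt LS.last (LS.const 4)) LS.last (LS.ite (LSP.eq LS.last (LS.const 4))
    (LS.const (symCode (some a))) LS.last.pred)).congr fun x g => by
      unfold _root_.scan
      simp only [List.length_singleton]
      split_ifs <;> first | rfl | omega | skip
      · rename_i h1 h2 h3; simp [h3]
  pb := PB.const 1

theorem append (hS : LSL B str H S) (hT : LSL B str H T) :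
    LSL B str H (fun x g => S x g ++ T x g) where
  scan := (LS.bind (G := fun x g r => _root_.scan (T x g.1) r) hS.scan
    (LS.mid (F := fun x g r => _root_.scan (T x g) r) hT.scan)).congr
      fun x g => scan_append _ _ _
  pb := (hS.pb.add hT.pb).mono fun x g => by simp

theorem const (L : List InSym) : LSL B str H (fun _ (_ : γ) => L) := by
  induction L with
  | nil => exact nil
  | cons a L ih => exact (singleton a).append ih

theorem ite {P : ι → γ → Prop} [∀ x g, Decidable (P x g)] (hP : LSP B str H P)
    (hS : LSL B str H S) (hT : LSL B str H T) :
    LSL B str H (fun x g => if P x g then S x g else T x g) where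
  scan := (LS.ite hP.weaken hS.scan hT.scan).congr fun x g => by split_ifs <;> rfl
  pb := (hS.pb.add hT.pb).mono fun x g => by split_ifs <;> omega

theorem flatMap {S : ι → γ → ℕ → List InSym} (hF : LS B str H F)
    (hS : LSL B str H (fun x (g : γ × ℕ) => S x g.1 g.2)) :
    LSL B str H (fun x g => (List.range (F x g)).flatMap (S x g)) where
  scan := by
    have e : ∀ x (g : γ) (r k : ℕ), (Nat.rec r (fun j s => _root_.scan (S x g j) s) k : ℕ) =
        _root_.scan ((List.range k).flatMap (S x g)) r := by
      intro x g r k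
      induction k with
      | zero => simp [_root_.scan]
      | succ k ih =>
        simp only [ih]
        rw [List.range_succ, List.flatMap_append, scan_append]
        simp
    -- In the iteration the current value precedes the index, whereas in `hS` the index precedes the
    -- number to be scanned; the same program is used with a permuted layout.
    have hS' : LS B str H (fun x (h : ((γ × ℕ) × ℕ) × ℕ) =>
        _root_.scan (S x h.1.1.1 h.2) h.1.2) := by
      intro l D hl
      obtain ⟨p, hp⟩ := hS.scan ((l.1.1.1, l.2), l.1.2) D ⟨⟨hl.1.1.1, hl.2⟩, hl.1.2⟩
      refine ⟨p, fun a => ?_⟩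
      obtain ⟨c, hc⟩ := hp a
      exact ⟨c, fun x ρ h0 hb => hc x ρ h0 ⟨⟨hb.1.1.1, hb.2⟩, hb.1.2⟩⟩
    refine (LS.iterate (K := fun x (g : γ × ℕ) => F x g.1) (I := fun _ (g : γ × ℕ) => g.2)
      (S := fun x (g : γ × ℕ) s j => _root_.scan (S x g.1 j) s) hF.weaken LS.last hS' ?_).congr
      fun x g => (e _ _ _ _).symm
    refine (PB.last.weaken.add (PB.const 3)).mono fun x g => ?_
    split_ifs
    · rw [e]; exact scan_le _ _
    · omega
  pb := (hF.pb.sum (G := fun x g i => (S x g i).length) hS.pb).mono fun x g => by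
    rw [List.length_flatMap, sum_map_range]

theorem bits (hF : LS B str H F) :
    LSL B str H (fun x g => (Nat.bits (F x g)).map InSym.bit) := by
  classical
  refine (flatMap (S := fun x g i => if (Nat.bits (F x g))[i]? = some true then [.bit true]
    else [.bit false]) (LSW.bits hF).length (ite (LSW.bits hF).bit (singleton _)
      (singleton _))).congr fun x g => ?_
  generalize Nat.bits (F x g) = L
  induction L using List.reverseRecOn with
  | nil => simp
  | append_singleton L b ih =>
    rw [List.length_append, List.length_singleton, List.range_succ, List.flatMap_append,
      List.map_append, ih]
    congr 1
    · rw [List.flatMap_congr]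
      intro i hi
      rw [List.getElem?_append_left (List.mem_range.1 hi)]
    · cases b <;> simp

end LSL

/-! ## Simulation of a machine on a string produced in logarithmic space -/

instance : Finite HeadMove :=
  Finite.of_injective (β := Option Bool)
    (fun | .left => none | .stay => some true | .right => some false)
    (by rintro (_ | _ | _) (_ | _ | _) h <;> simp_all)

/-- The base machine whose programs simulate `M`. Its states record the last movement of the input
head of `M`, or that `M` has halted; unvisited cells are distinguished from blank ones. -/
abbrev oracleBase (M : MultiTapeTM InSym) : MultiTapeTM InSym where
  k := M.k
  Q := M.Q × Option HeadMove
  Γ := Option M.Γ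
  finite_Q := have := M.finite_Q; inferInstance
  finite_Γ := have := M.finite_Γ; inferInstance
  blank := none
  start := (M.start, some .stay)
  accepting := {q | q.2 = some .right}
  δ := fun _ _ _ => none

namespace OracleSim

variable {M : MultiTapeTM InSym}

/-- Movements of the input head that would leave the input are replaced. -/
def clip : InCell InSym → HeadMove → HeadMove
  | .left, .left => .stay
  | .right, .right => .stay
  | _, m => m

def nextMove (y : List InSym) (c : M.Cfg) : Option HeadMove :=
  (M.action y c).map fun a => clip (inputCell y c.inHead) a.inMove

/-- After clipping, the recorded movement says exactly how the position changes. A counter can thus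
follow the input head without knowledge of the length of the virtual input. -/
theorem inHead_step (y : List InSym) (c : M.Cfg) (hc : c.inHead ≤ y.length + 1) :
    (M.step y c).inHead ≤ y.length + 1 ∧
    (nextMove y c = some .left → c.inHead ≠ 0 ∧ (M.step y c).inHead = c.inHead - 1) ∧
    (nextMove y c = some .right → (M.step y c).inHead = c.inHead + 1) ∧
    (nextMove y c ≠ some .left → nextMove y c ≠ some .right → (M.step y c).inHead = c.inHead) := by
  unfold nextMove
  cases h : M.action y c with
  | none => simp [step_of_action_none h, hc]
  | some a =>
    rw [step_of_action_some h]
    simp only [MultiTapeTM.apply, Option.map_some]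
    obtain ⟨next, im, wr, mv⟩ := a
    rcases hi : c.inHead with _ | i
    · cases im <;> simp [moveIn, clip, inputCell]
    · by_cases hl : i < y.length
      · have e : inputCell y (i + 1) = .sym y[i] := by
          simp [inputCell, List.getElem?_eq_getElem hl]
        rw [e]
        cases im <;> simp [moveIn, clip] <;> omega
      · have e : inputCell y (i + 1) = .right := by
          simp [inputCell, List.getElem?_eq_none (by omega : y.length ≤ i)]
        rw [e]
        cases im <;> simp [moveIn, clip] <;> omega

/-- The configuration of the simulation, where the first `e j` cells of tape `j` have been
visited. -/
def simCfg (c : M.Cfg) (m : Option HeadMove) (e : Fin M.k → ℕ) : (oracleBase M).Cfg where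
  state := (c.state, m)
  inHead := 0
  tape := fun j i => if i < e j then some (c.tape j i) else none
  head := c.head

/-- Simulate a step in which the input head of `M` scans `c`. -/
def simStep (c : InCell InSym) : Prog (oracleBase M) :=
  .act fun q _ σ =>
    match M.δ q.1 c (fun j => (σ j).getD M.blank) with
    | none => ⟨(q.1, none), .stay, fun j => some ((σ j).getD M.blank), fun _ => .stay⟩
    | some a => ⟨(a.next, some (clip c a.inMove)), .stay, fun j => some (a.write j), a.move⟩

/-- Cells of `M` that have not been visited are blank, so reading them as blanks gives the action of
`M`. The scanned cell becomes visited in every case, also when `M` has halted, which explains the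
maximum. -/
theorem execLE_simStep (x y : List InSym) (H : ℕ) (ρ : ℕ → ℕ) (c : M.Cfg) (m : Option HeadMove)
    (e : Fin M.k → ℕ) (hc : ∀ j, c.head j ≤ e j) (hb : ∀ j, ∀ i ≥ e j, c.tape j i = M.blank)
    (hH : ∀ j, (M.step y c).head j ≤ H) :
    ExecLE x H (simStep (inputCell y c.inHead)) ρ (simCfg c m e) ρ
      (simCfg (M.step y c) (nextMove y c) (fun j => max (e j) (c.head j + 1))) 1 := by
  refine ExecLE.act ?_ hH
  have hσ : (fun j => ((simCfg c m e).tape j ((simCfg c m e).head j)).getD M.blank) =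
      fun j => c.tape j (c.head j) := by
    funext j
    simp only [simCfg]
    split_ifs with h
    · rfl
    · simp [hb j (c.head j) (by omega)]
  have hsym : ∀ j, (if c.head j < e j then some (c.tape j (c.head j)) else none).getD M.blank =
      c.tape j (c.head j) := congrFun hσ
  have hact : M.δ (simCfg c m e).state.1 (inputCell y c.inHead)
      (fun j => ((simCfg c m e).tape j ((simCfg c m e).head j)).getD M.blank) = M.action y c := by
    rw [hσ]; rfl
  rw [hact]
  unfold nextMove
  cases h : M.action y c with
  | none =>
    rw [step_of_action_none h]
    refine Cfg.ext_of rfl rfl ?_ ?_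
    · funext j i
      simp only [simCfg, MultiTapeTM.apply, Function.update_apply, hsym]
      by_cases h1 : i = c.head j
      · subst h1
        simp
      · have : (i < max (e j) (c.head j + 1)) ↔ i < e j := by
          have := hc j
          omega
        simp [h1, this]
    · rfl
  | some a =>
    rw [step_of_action_some h]
    refine Cfg.ext_of rfl rfl ?_ ?_
    · funext j i
      simp only [simCfg, MultiTapeTM.apply, Function.update_apply]
      by_cases h1 : i = c.head j
      · subst h1
        simp
      · have : (i < max (e j) (c.head j + 1)) ↔ i < e j := by
          have := hc j
          omega
        simp [h1, this]
    · rfl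

/-- The number of cells visited by the head of tape `j` before step `t`. -/
def extent (M : MultiTapeTM InSym) (y : List InSym) : ℕ → Fin M.k → ℕ
  | 0, _ => 0
  | t + 1, j => max (extent M y t j) ((M.run y t).head j + 1)

/-- The movement of the input head in the step before `t`. -/
def lastMove (M : MultiTapeTM InSym) (y : List InSym) : ℕ → Option HeadMove
  | 0 => some .stay
  | t + 1 => nextMove y (M.run y t)

theorem run_succ (M : MultiTapeTM InSym) (y : List InSym) (t : ℕ) :
    M.run y (t + 1) = M.step y (M.run y t) := by
  unfold MultiTapeTM.run
  rw [Function.iterate_succ_apply']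

/-- Heads start in cell `0` and move by at most one cell, so the visited cells form an initial
segment. The head may stand on the first cell after it, namely when it has just arrived there. -/
theorem extent_spec (y : List InSym) (t : ℕ) (j : Fin M.k) :
    (M.run y t).head j ≤ extent M y t j ∧ extent M y t j ≤ t ∧
      ∀ i ≥ extent M y t j, (M.run y t).tape j i = M.blank := by
  induction t with
  | zero => exact ⟨le_rfl, le_rfl, fun _ _ => rfl⟩
  | succ t ih =>
    obtain ⟨h1, h2, h3⟩ := ih
    simp only [run_succ, extent]
    cases h : M.action y (M.run y t) with
    | none =>
      rw [step_of_action_none h]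
      exact ⟨by omega, by omega, fun i hi => h3 i (by omega)⟩
    | some a =>
      rw [step_of_action_some h]
      refine ⟨?_, by omega, fun i hi => ?_⟩
      · simp only [MultiTapeTM.apply]
        cases a.move j <;> simp only [moveWork] <;> omega
      · simp only [MultiTapeTM.apply]
        rw [Function.update_of_ne (by omega)]
        exact h3 i (by omega)

theorem inHead_run_le (y : List InSym) (t : ℕ) : (M.run y t).inHead ≤ y.length + 1 := by
  induction t with
  | zero => exact Nat.zero_le _
  | succ t ih => rw [run_succ]; exact (inHead_step y _ ih).1

theorem extent_le {y : List InSym} {H : ℕ} (hH : ∀ t j, (M.run y t).head j + 1 ≤ H) (t : ℕ)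
    (j : Fin M.k) : extent M y t j ≤ H := by
  induction t with
  | zero => exact Nat.zero_le _
  | succ t ih => exact max_le ih (hH t j)

/-- The code of the symbol in a cell of an input tape. -/
def cellCode (y : List InSym) (v : ℕ) : ℕ :=
  if v = 0 then 0 else if scan y (v + 3) < 3 then scan y (v + 3) + 1 else 4

def cellOfCode : ℕ → InCell InSym
  | 0 => .left
  | 1 => .sym (.bit false)
  | 2 => .sym (.bit true)
  | 3 => .sym .sep
  | _ => .right

theorem cellOfCode_cellCode (y : List InSym) (v : ℕ) : cellOfCode (cellCode y v) = inputCell y v := by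
  unfold cellCode scan
  cases v with
  | zero => rfl
  | succ i =>
    simp only [Nat.add_eq_zero_iff, one_ne_zero, and_false, if_false, inputCell,
      show ¬ i + 1 + 3 < 4 by omega, show i + 1 + 3 - 4 = i by omega]
    by_cases h : i < y.length
    · rw [if_pos h, List.getElem?_eq_getElem h]
      rcases y[i] with (_ | _) | _ <;> rfl
    · rw [if_neg h, List.getElem?_eq_none (by omega)]
      rw [if_neg (by omega)]
      rfl

theorem cellCode_lt (y : List InSym) (v : ℕ) : cellCode y v < 5 := by
  unfold cellCode
  split_ifs <;> omega

theorem ls_cellCode {S : ι → γ → List InSym} (hS : LSL B str H S) :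
    LS B str H (fun x (g : γ × ℕ) => cellCode (S x g.1) g.2) := by
  have h : LS B str H (fun x (g : γ × ℕ) => scan (S x g.1) (g.2 + 3)) :=
    LS.bind (F := fun x (g : γ × ℕ) => g.2 + 3) (G := fun x g r => scan (S x g.1) r)
      (LS.last.add (LS.const 3)) (LS.mid (F := fun x g r => scan (S x g) r) hS.scan)
  exact LS.ite (LSP.eq LS.last (LS.const 0)) (LS.const 0)
    (LS.ite (LSP.lt h (LS.const 3)) h.succ (LS.const 4))

/-- Simulate a step, where counter `r` holds the code of the scanned input symbol. -/
def dispatch (r : ℕ) : Prog (oracleBase M) :=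
  .ite (.pos r) (.seq (.dec r) (.ite (.pos r) (.seq (.dec r) (.ite (.pos r) (.seq (.dec r)
    (.ite (.pos r) (.seq (.dec r) (simStep (cellOfCode 4))) (simStep (cellOfCode 3))))
    (simStep (cellOfCode 2)))) (simStep (cellOfCode 1)))) (simStep (cellOfCode 0))

theorem execLE_dispatch {x : List InSym} {H r v : ℕ} {ρ : ℕ → ℕ} {c c' : (oracleBase M).Cfg}
    (hv : v < 5) (hr : ρ r = 0)
    (h : ExecLE x H (simStep (cellOfCode v)) ρ c ρ c' 1) :
    ExecLE x H (dispatch r) (Function.update ρ r v) c ρ c' 13 := by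
  have h0 : Function.update ρ r 0 = ρ := Function.update_eq_self_iff.2 hr.symm
  have hp : ∀ k, (Cond.pos r : Cond (oracleBase M)).Holds x (Function.update ρ r (k + 1)) c :=
    fun k => by simp [Cond.Holds]
  have hn : ¬ (Cond.pos r : Cond (oracleBase M)).Holds x (Function.update ρ r 0) c := by
    simp [Cond.Holds]
  have hd : ∀ k, ExecLE (B := oracleBase M) x H (.dec r) (Function.update ρ r (k + 1)) c
      (Function.update ρ r k) c 1 := fun k => ExecLE.dec r (by simp) (by simp)
  have hs : ExecLE x H (simStep (cellOfCode v)) (Function.update ρ r 0) c ρ c' 1 := by rwa [h0]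
  unfold dispatch
  interval_cases v
  · exact (ExecLE.ite_neg hn hs).mono (by omega)
  · exact (ExecLE.ite_pos (hp 0) ((hd 0).seq (ExecLE.ite_neg hn hs))).mono (by omega)
  · exact (ExecLE.ite_pos (hp 1) ((hd 1).seq (ExecLE.ite_pos (hp 0) ((hd 0).seq
      (ExecLE.ite_neg hn hs))))).mono (by omega)
  · exact (ExecLE.ite_pos (hp 2) ((hd 2).seq (ExecLE.ite_pos (hp 1) ((hd 1).seq (ExecLE.ite_pos (hp 0) ((hd 0).seq
      (ExecLE.ite_neg hn hs))))))).mono (by omega)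
  · exact (ExecLE.ite_pos (hp 3) ((hd 3).seq (ExecLE.ite_pos (hp 2) ((hd 2).seq (ExecLE.ite_pos (hp 1) ((hd 1).seq (ExecLE.ite_pos (hp 0) ((hd 0).seq
      hs)))))))).mono (by omega)

noncomputable def isMove (m : Option HeadMove) : Cond (oracleBase M) :=
  .test fun q _ _ => @decide (q.2 = m) (Classical.propDecidable _)

theorem holds_isMove {x : List InSym} {ρ : ℕ → ℕ} {c : M.Cfg} {m m' : Option HeadMove}
    {e : Fin M.k → ℕ} : (isMove m').Holds x ρ (simCfg c m e) ↔ m = m' :=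
  @decide_eq_true_iff _ (Classical.propDecidable _)

open Classical in
noncomputable def inAccepting : Cond (oracleBase M) :=
  .test fun q _ _ => decide (q.1 ∈ M.accepting)

theorem holds_inAccepting {x : List InSym} {ρ : ℕ → ℕ} {c : M.Cfg} {m : Option HeadMove}
    {e : Fin M.k → ℕ} : inAccepting.Holds x ρ (simCfg c m e) ↔ c.state ∈ M.accepting :=
  @decide_eq_true_iff _ (Classical.propDecidable _)

/-- Update the position `V` of the input head of `M` and the number `T` of steps. -/
noncomputable def adjust (V T : ℕ) : Prog (oracleBase M) :=
  .seq (.ite (isMove (some .left)) (.dec V) .skip)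
    (.seq (.ite (isMove (some .right)) (.inc V) .skip) (.inc T))

theorem execLE_adjust {x : List InSym} {H V T v v' : ℕ} {ρ : ℕ → ℕ} {c : M.Cfg}
    {m : Option HeadMove} {e : Fin M.k → ℕ} (hVT : V ≠ T) (hV : ρ V = v)
    (h1 : m = some .left → v ≠ 0 ∧ v' = v - 1) (h2 : m = some .right → v' = v + 1)
    (h3 : m ≠ some .left → m ≠ some .right → v' = v) :
    ExecLE x H (adjust V T) ρ (simCfg c m e)
      (Function.update (Function.update ρ V v') T (ρ T + 1)) (simCfg c m e) 7 := by
  have hT : ∀ u, Function.update ρ V u T = ρ T := fun u => Function.update_of_ne hVT.symm _ _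
  have hlast : ExecLE x H (.inc T) (Function.update ρ V v') (simCfg c m e)
      (Function.update (Function.update ρ V v') T (ρ T + 1)) (simCfg c m e) 1 :=
    ExecLE.inc T (by rw [hT])
  have hself : Function.update ρ V v = ρ := Function.update_eq_self_iff.2 hV.symm
  by_cases hl : m = some .left
  · obtain ⟨hv, rfl⟩ := h1 hl
    exact ((ExecLE.ite_pos (holds_isMove.2 hl) (ExecLE.dec V (by rwa [hV]) (by rw [hV]))).seq
      ((ExecLE.ite_neg (by rw [holds_isMove, hl]; simp) ExecLE.skip).seq hlast)).mono (by omega)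
  · by_cases hr : m = some .right
    · obtain rfl := h2 hr
      exact ((ExecLE.ite_neg (by rwa [holds_isMove]) ExecLE.skip).seq
        ((ExecLE.ite_pos (holds_isMove.2 hr) (ExecLE.inc V (by rw [hV]))).seq hlast)).mono (by omega)
    · obtain rfl := h3 hl hr
      rw [hself] at hlast ⊢
      exact ((ExecLE.ite_neg (by rwa [holds_isMove]) ExecLE.skip).seq
        ((ExecLE.ite_neg (by rwa [holds_isMove]) ExecLE.skip).seq hlast)).mono (by omega)

/-! ### Clearing the tapes -/

/-- All tapes are treated in one step; a head that has reached the first unvisited cell waits there.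
So one common number of rounds serves tapes with different extents. -/
def seekFresh : Prog (oracleBase M) :=
  .act fun q _ σ => ⟨q, .stay, σ, fun j => match σ j with | none => .stay | some _ => .right⟩

def eraseLeft : Prog (oracleBase M) :=
  .act fun q _ _ => ⟨q, .stay, fun _ => none, fun _ => .left⟩

def resetState : Prog (oracleBase M) :=
  .act fun _ _ σ => ⟨(oracleBase M).start, .stay, σ, fun _ => .stay⟩

/-- All heads have moved right by `i` cells, but at most to the first unvisited cell. -/
def seekCfg (c : M.Cfg) (m : Option HeadMove) (e : Fin M.k → ℕ) (i : ℕ) : (oracleBase M).Cfg where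
  state := (c.state, m)
  inHead := 0
  tape := fun j p => if p < e j then some (c.tape j p) else none
  head := fun j => min (c.head j + i) (e j)

/-- The last visited cells of each tape have been cleared. -/
def eraseCfg (c : M.Cfg) (m : Option HeadMove) (e : Fin M.k → ℕ) (i : ℕ) : (oracleBase M).Cfg where
  state := (c.state, m)
  inHead := 0
  tape := fun j p => if p < e j ∧ p + i < e j + 1 then some (c.tape j p) else none
  head := fun j => e j - i

theorem execLE_seekFresh (x : List InSym) (H : ℕ) (ρ : ℕ → ℕ) (c : M.Cfg) (m : Option HeadMove)
    (e : Fin M.k → ℕ) (he : ∀ j, e j ≤ H) (i : ℕ) :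
    ExecLE x H seekFresh ρ (seekCfg c m e i) ρ (seekCfg c m e (i + 1)) 1 := by
  refine ExecLE.act ?_ (fun j => (min_le_right _ _).trans (he j))
  refine Cfg.ext_of rfl rfl ?_ ?_
  · funext j
    simp [MultiTapeTM.apply, seekCfg]
  · funext j
    simp only [MultiTapeTM.apply, seekCfg]
    by_cases h1 : min (c.head j + i) (e j) < e j
    · simp only [h1, if_true, moveWork]
      omega
    · simp only [h1, if_false, moveWork]
      omega

theorem execLE_eraseLeft (x : List InSym) (H : ℕ) (ρ : ℕ → ℕ) (c : M.Cfg) (m : Option HeadMove)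
    (e : Fin M.k → ℕ) (he : ∀ j, e j ≤ H) (i : ℕ) :
    ExecLE x H eraseLeft ρ (eraseCfg c m e i) ρ (eraseCfg c m e (i + 1)) 1 := by
  refine ExecLE.act ?_ (fun j => (Nat.sub_le _ _).trans (he j))
  refine Cfg.ext_of rfl rfl ?_ ?_
  · funext j p
    simp only [MultiTapeTM.apply, eraseCfg, Function.update_apply]
    split_ifs <;> first | rfl | omega
  · funext j
    simp only [MultiTapeTM.apply, eraseCfg, moveWork]
    omega

/-- Clear all tapes and return all heads, where counter `T` is at least the number of visited cells
of each tape and the two next counters are zero. -/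
def clear (T : ℕ) : Prog (oracleBase M) :=
  .seq (.copy T (T + 1) (T + 2)) (.seq (.whl (.pos (T + 1)) (.seq (.dec (T + 1)) seekFresh))
    -- One more round than for the way right: the heads start on an unvisited cell, and cell `0` has
    -- to be erased too. Further erasures in cell `0` are harmless.
    (.seq (.inc T) (.seq (.whl (.pos T) (.seq (.dec T) eraseLeft)) resetState)))

theorem execLE_clear {x : List InSym} {H T : ℕ} {ρ : ℕ → ℕ} {c : M.Cfg} {m : Option HeadMove}
    {e : Fin M.k → ℕ} (hce : ∀ j, c.head j ≤ e j) (he : ∀ j, e j ≤ H) (hT : ∀ j, e j ≤ ρ T)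
    (h1 : ρ (T + 1) = 0) (h2 : ρ (T + 2) = 0) :
    ExecLE x H (clear T) ρ (simCfg c m e) (Function.update ρ T 0) (oracleBase M).init
      (ρ T * 20 + 20) := by
  have ha := ExecLE.copy (B := oracleBase M) (x := x) (H := H) (c := simCfg c m e) T (T + 1) (T + 2)
    (by omega) (by omega) (by omega) h2 rfl
  have hb := ExecLE.loop (B := oracleBase M) (x := x) (H := H) (N := 1) (p := seekFresh)
    (r := T + 1) (fun i => Function.update ρ (T + 1) (ρ T - i))
    (fun i => seekCfg c m e i) (ρ T) (fun i hi => by simp)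
    (fun i hi => by
      rw [Function.update_idem, Nat.sub_sub]
      exact execLE_seekFresh x H _ c m e he i)
  have hd := ExecLE.loop (B := oracleBase M) (x := x) (H := H) (N := 1) (p := eraseLeft)
    (r := T) (fun i => Function.update ρ T (ρ T + 1 - i))
    (fun i => eraseCfg c m e i) (ρ T + 1) (fun i hi => by simp)
    (fun i hi => by
      rw [Function.update_idem, Nat.sub_sub]
      exact execLE_eraseLeft x H _ c m e he i)
  have hc0 : seekCfg c m e 0 = simCfg c m e := by
    refine Cfg.ext_of rfl rfl rfl ?_
    funext j
    exact min_eq_left (hce j)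
  have hc1 : seekCfg c m e (ρ T) = eraseCfg c m e 0 := by
    refine Cfg.ext_of rfl rfl ?_ ?_
    · funext j p
      simp only [seekCfg, eraseCfg]
      split_ifs <;> first | rfl | omega
    · funext j
      have := hT j
      simp only [seekCfg, eraseCfg]
      omega
  have hr : ∀ σ : ℕ → ℕ, ExecLE x H resetState σ (eraseCfg c m e (ρ T + 1)) σ
      (oracleBase M).init 1 := by
    intro σ
    refine ExecLE.act ?_ (fun j => Nat.zero_le _)
    refine Cfg.ext_of rfl rfl ?_ ?_
    · funext j p
      have := hT j
      simp only [MultiTapeTM.apply, MultiTapeTM.init, eraseCfg, Function.update_apply]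
      split_ifs <;> first | rfl | omega
    · funext j
      have := hT j
      simp only [MultiTapeTM.apply, MultiTapeTM.init, eraseCfg, moveWork]
      omega
  have e0 : Function.update ρ (T + 1) 0 = ρ := Function.update_eq_self_iff.2 h1.symm
  rw [h1, zero_add] at ha
  simp only [Nat.sub_self, Nat.sub_zero, e0, hc0, hc1] at hb hd
  exact (ha.seq (hb.seq ((ExecLE.inc T rfl).seq (hd.seq (hr _))))).mono (by omega)

/-- Run `M` until it halts, clear the tapes, and set counter `D` to `1` if `M` accepts. The program
`q` computes the code of the input symbol that `M` scans. -/
noncomputable def simulate (q : Prog (oracleBase M)) (D : ℕ) : Prog (oracleBase M) :=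
  .seq (.whl (.test fun q _ _ => q.2.isSome)
    (.seq q (.seq (dispatch (D + 3)) (adjust (D + 1) (D + 2)))))
    (.seq (.ite inAccepting (.inc D) .skip)
      (.seq (clear (D + 2)) (.zero (D + 1))))

/-- After `t` rounds counter `D + 1` holds the position of the input head of `M` and `D + 2` holds
`t`. There are `τ + 1` rounds, because the last one is spent on discovering that `M` has halted. The
number of rounds bounds the extents of the tapes, so the same counter controls the clearing. -/
theorem execLE_simulate {x y : List InSym} {H D N τ : ℕ} {q : Prog (oracleBase M)} {ρ : ℕ → ℕ}
    (h0 : ∀ i ≥ D, ρ i = 0) (hH : ∀ t j, (M.run y t).head j + 1 ≤ H)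
    (hτ : M.action y (M.run y τ) = none) (hτ' : ∀ t < τ, M.action y (M.run y t) ≠ none)
    (hq : ∀ v t m e, v ≤ y.length + 1 → t ≤ τ →
      ExecLE x H q (Function.update (Function.update ρ (D + 1) v) (D + 2) t)
      (simCfg (M.run y t) m e)
      (Function.update (Function.update (Function.update ρ (D + 1) v) (D + 2) t) (D + 3)
        (cellCode y v)) (simCfg (M.run y t) m e) N) :
    ExecLE x H (simulate q D) ρ (oracleBase M).init
      (Function.update ρ D (ind ((M.run y τ).state ∈ M.accepting))) (oracleBase M).init
      ((τ + 1) * (N + 50) + y.length * 4 + 50) := by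
  have hrun : M.run y (τ + 1) = M.run y τ := by rw [run_succ, step_of_action_none hτ]
  let s : ℕ → ℕ → ℕ := fun t =>
    Function.update (Function.update ρ (D + 1) (M.run y t).inHead) (D + 2) t
  let d : ℕ → (oracleBase M).Cfg := fun t => simCfg (M.run y t) (lastMove M y t) (extent M y t)
  have hloop := ExecLE.whl (B := oracleBase M) (x := x) (H := H) (N := N + 22)
    (b := .test fun q _ _ => q.2.isSome)
    (p := .seq q (.seq (dispatch (D + 3)) (adjust (D + 1) (D + 2)))) s d (τ + 1)
    (fun t ht => by
      constructor
      · show (lastMove M y t).isSome = true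
        cases t with
        | zero => rfl
        | succ t =>
          simp only [lastMove, nextMove, Option.isSome_map]
          exact Option.isSome_iff_ne_none.2 (hτ' t (by omega))
      · obtain ⟨e1, -, e3⟩ := (forall_and.1 fun j => by
          have := extent_spec (M := M) y t j
          exact ⟨this.1, this.2.1, this.2.2⟩ : _ ∧ _) |>.imp id (fun h => forall_and.1 h)
        obtain ⟨-, g1, g2, g3⟩ := inHead_step (M := M) y (M.run y t) (inHead_run_le y t)
        have hs3 : s t (D + 3) = 0 := by
          simp only [s, Function.update_apply]
          split_ifs <;> first | omega | exact h0 _ (by omega)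
        have a1 := hq (M.run y t).inHead t (lastMove M y t) (extent M y t) (inHead_run_le y t)
          (by omega)
        have a2 := execLE_simStep x y H (s t) (M.run y t) (lastMove M y t) (extent M y t) e1 e3
          (fun j => by have := hH (t + 1) j; rw [run_succ] at this; omega)
        rw [← cellOfCode_cellCode] at a2
        have a3 := execLE_dispatch (cellCode_lt y _) hs3 a2
        have a4 := execLE_adjust (M := M) (x := x) (H := H) (V := D + 1) (T := D + 2) (ρ := s t)
          (c := M.step y (M.run y t)) (e := fun j => max (extent M y t j) ((M.run y t).head j + 1))
          (by omega) (by simp [s]) g1 g2 g3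
        refine ((a1.seq (a3.seq a4)).mono (N' := N + 22) (by omega)).congr ?_ ?_
        · funext i
          simp only [s, run_succ, Function.update_apply]
          split_ifs <;> rfl
        · simp only [d, run_succ, lastMove]
          rfl)
    (by
      show ¬ (lastMove M y (τ + 1)).isSome = true
      simp [lastMove, nextMove, hτ])
  have hs0 : s 0 = ρ := by
    funext i
    simp only [s, Function.update_apply]
    split_ifs with h1 h2
    · rw [h1, h0 _ (by omega)]
    · rw [h2, h0 _ (by omega)]; rfl
    · rfl
  have hd0 : d 0 = (oracleBase M).init := by
    refine Cfg.ext_of rfl rfl ?_ rfl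
    funext j i
    simp [d, simCfg, extent, MultiTapeTM.init]
  rw [hs0, hd0] at hloop
  have hV := inHead_run_le (M := M) y (τ + 1)
  set σ := Function.update (s (τ + 1)) D (ind ((M.run y τ).state ∈ M.accepting)) with hσ
  have hsD : s (τ + 1) D = 0 := by
    simp only [s, Function.update_apply]
    split_ifs <;> first | omega | exact h0 _ (by omega)
  have hacc : ExecLE x H (.ite inAccepting
      (.inc D) .skip) (s (τ + 1)) (d (τ + 1)) σ (d (τ + 1)) 2 := by
    have hiff : inAccepting.Holds x (s (τ + 1)) (d (τ + 1)) ↔ (M.run y τ).state ∈ M.accepting := by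
      rw [← hrun]
      exact holds_inAccepting
    by_cases h : (M.run y τ).state ∈ M.accepting
    · exact ExecLE.ite_pos (hiff.2 h) (ExecLE.inc D (by rw [hσ, ind_of h, hsD]))
    · rw [hσ, ind_of_not h, Function.update_eq_self_iff.2 hsD.symm]
      exact ExecLE.ite_neg (fun h' => h (hiff.1 h')) ExecLE.skip
  have hσ2 : σ (D + 2) = τ + 1 := by
    simp [σ, s]
  have hz : ∀ i, D + 3 ≤ i → σ i = 0 := by
    intro i hi
    simp only [σ, s, Function.update_apply]
    split_ifs <;> first | omega | exact h0 _ (by omega)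
  have hclear := execLE_clear (M := M) (x := x) (H := H) (T := D + 2) (ρ := σ)
    (c := M.run y (τ + 1)) (m := lastMove M y (τ + 1)) (e := extent M y (τ + 1))
    (fun j => (extent_spec y _ j).1) (fun j => extent_le hH _ j)
    (fun j => by rw [hσ2]; exact (extent_spec y _ j).2.1) (hz _ (by omega)) (hz _ (by omega))
  have hσ1 : Function.update σ (D + 2) 0 (D + 1) = (M.run y (τ + 1)).inHead := by
    simp [σ, s]
  refine (hloop.seq (hacc.seq (hclear.seq (ExecLE.zero (D + 1) ?_)))).mono ?_
  · have z1 := h0 (D + 1) (by omega)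
    have z2 := h0 (D + 2) (by omega)
    funext i
    simp only [σ, s, Function.update_apply]
    split_ifs <;> first | rfl | omega | (subst_vars; simp_all)
  · rw [hσ1, hσ2]
    ring_nf
    ring_nf at hV
    omega

end OracleSim

theorem polyBdd_eval (p : Polynomial ℕ) : PolyBdd (fun n => p.eval n) := by
  induction p using Polynomial.induction_on' with
  | add p q hp hq => simpa using hp.add hq
  | monomial k a =>
    simp only [Polynomial.eval_monomial]
    exact (PolyBdd.const a).mul ((PolyBdd.pow k).mono fun n => Nat.pow_le_pow_left (by omega) k)

theorem run_eq_of_halted {M : MultiTapeTM InSym} {y : List InSym} {τ t : ℕ}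
    (hτ : M.action y (M.run y τ) = none) (h : τ ≤ t) : M.run y t = M.run y τ := by
  induction t, h using Nat.le_induction with
  | base => rfl
  | succ t _ ih => rw [OracleSim.run_succ, ih, step_of_action_none hτ]

/-- A machine that decides `Y` on the strings `S`, which are produced in logarithmic space. -/
theorem LSP.of_machine {M : MultiTapeTM InSym} {S : ι → γ → List InSym} {Y : ι → γ → Prop}
    {p : Polynomial ℕ} {h : ι → ℕ}
    (hS : LSL (oracleBase M) str (fun x => Scope.full _ (h x)) S)
    (hY : ∀ x g, M.AnswersWithin (S x g) (Y x g) (p.eval (S x g).length))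
    (hH : ∀ x g t j, (M.run (S x g) t).head j + 1 ≤ h x) :
    LSP (oracleBase M) str (fun x => Scope.init _ (h x)) Y := by
  intro l D hl
  have hcell := OracleSim.ls_cellCode hS
  obtain ⟨q, hq⟩ := hcell (l, D + 1) (D + 3) ⟨Ctx.below_mono hl (by omega), show D + 1 < D + 3 by omega⟩
  refine ⟨OracleSim.simulate q D, fun a => ?_⟩
  obtain ⟨b, hb⟩ := hS.pb a
  obtain ⟨k, hk⟩ := polyBdd_eval p
  -- The additional argument is a head position, at most `|S| + 1`. As `|S|` is at most the `b`-th
  -- power of `|x| + 2`, the exponent `b + 1` suffices for it, and `a` for the other arguments.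
  obtain ⟨e, he⟩ := hq (a + b + 1)
  obtain ⟨e', he'⟩ := ((((PolyBdd.pow ((b + 2) * k)).add (PolyBdd.const 1)).mul
    ((PolyBdd.pow e).add (PolyBdd.const 50))).add ((PolyBdd.pow b).mul (PolyBdd.const 4))).add
    (PolyBdd.const 50)
  refine ⟨e', fun x ρ h0 hbd c hc => ?_⟩
  obtain rfl : c = (oracleBase M).init := hc
  set g := Ctx.get l ρ with hg
  obtain ⟨t₀, ht₀, hhalt, hans⟩ := hY x g
  have hex : ∃ t, M.action (S x g) (M.run (S x g) t) = none := ⟨t₀, hhalt⟩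
  classical
  set τ := Nat.find hex with hτdef
  have hτ : M.action (S x g) (M.run (S x g) τ) = none := Nat.find_spec hex
  have hτt : τ ≤ t₀ := Nat.find_min' hex hhalt
  rw [run_eq_of_halted hτ hτt] at hans
  have hlen : (S x g).length ≤ ((str x).length + 2) ^ b := hb x g hbd
  -- With `n = |x| + 2 ≥ 2`, the base of the time bound is `|S| + 2 ≤ n ^ b + 2 ≤ n ^ (b + 2)`.
  have hτb : τ ≤ ((str x).length + 2) ^ ((b + 2) * k) := by
    refine (hτt.trans (ht₀.trans (hk _))).trans ?_
    rw [pow_mul]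
    refine Nat.pow_le_pow_left ?_ k
    have h1 : 1 ≤ ((str x).length + 2) ^ b := Nat.one_le_pow _ _ (by omega)
    have h2 : 4 ≤ ((str x).length + 2) ^ 2 := Nat.pow_le_pow_left (show 2 ≤ _ by omega) 2
    rw [pow_add]
    nlinarith
  have hmain := OracleSim.execLE_simulate (M := M) (x := str x) (y := S x g) (H := h x) (D := D)
    (N := ((str x).length + 2) ^ e) (τ := τ) (q := q) (ρ := ρ) h0 (hH x g) hτ
    (fun t ht => Nat.find_min hex ht) (fun v t m ex hv ht => by
      set σ := Function.update (Function.update ρ (D + 1) v) (D + 2) t with hσ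
      have e1 : Ctx.get (γ := γ × ℕ) (l, D + 1) σ = (g, v) := by
        refine Prod.ext ?_ ?_
        · exact Ctx.get_congr hl fun i hi => by
            simp only [σ, Function.update_apply]
            split_ifs <;> omega
        · show σ (D + 1) = v
          simp [σ]
      have := he x σ (fun i hi => by
          simp only [σ, Function.update_apply]
          split_ifs <;> first | omega | exact h0 i (by omega)) (by
          rw [e1]
          refine ⟨Ctx.bdd_mono hbd (Nat.pow_le_pow_right (by omega) (by omega)), ?_⟩
          refine hv.trans ?_
          have h1 : ((str x).length + 2) ^ (b + 1) ≤ ((str x).length + 2) ^ (a + b + 1) :=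
            Nat.pow_le_pow_right (by omega) (by omega)
          have h2 : 1 ≤ ((str x).length + 2) ^ b := Nat.one_le_pow _ _ (by omega)
          rw [pow_succ] at h1
          show (S x g).length + 1 ≤ _
          nlinarith) (OracleSim.simCfg (M.run (S x g) t) m ex)
        ⟨rfl, fun j => (Nat.le_succ _).trans (hH x g t j)⟩
      rw [e1] at this
      exact this)
  have e2 : ind ((M.run (S x g) τ).state ∈ M.accepting) = ind (Y x g) := by rw [hans]
  rw [e2] at hmain
  refine hmain.mono (le_trans ?_ (he' _))
  dsimp only
  have := Nat.mul_le_mul_right (((str x).length + 2) ^ e + 50) (Nat.add_le_add_right hτb 1)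
  omega

/-! ## Reductions preserve the linear space hypothesis -/

def acceptState (M : MultiTapeTM InSym) : Prog (oracleBase M) :=
  .act fun q _ σ => ⟨(q.1, some .right), .stay, σ, fun _ => .stay⟩

/-- The program leaves the truth value in counter `0` and the base machine in its initial
configuration, whose state carries the flag `some .stay`. Only a positive answer switches the flag
to the accepting value `some .right`. -/
theorem LSP.exists_machine {M : MultiTapeTM InSym} {Y : ι → Prop} {h : ι → ℕ}
    (hY : LSP (oracleBase M) str (fun x => Scope.init _ (h x)) (fun x (_ : Unit) => Y x)) :
    ∃ (M' : MultiTapeTM InSym) (e : ℕ), ∀ x, ∃ t ≤ ((str x).length + 2) ^ e,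
      M'.AnswersWithin (str x) (Y x) (t * (2 * (h x + (Nat.log 2 (t + 1) + 2)) + 3) + 1) ∧
      ∀ n j, (M'.run (str x) n).head j ≤ h x + (Nat.log 2 (t + 1) + 2) := by
  obtain ⟨p, hp⟩ := hY () 0 trivial
  obtain ⟨M', hM'⟩ := exists_machine_of_prog (.seq p (.ite (.pos 0) (acceptState M) .skip))
  obtain ⟨e, he⟩ := hp 0
  obtain ⟨e', he'⟩ := (PolyBdd.pow e).add (PolyBdd.const 3)
  refine ⟨M', e', fun x => ?_⟩
  have h1 := he x (fun _ => 0) (fun _ _ => rfl) trivial _ rfl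
  have h2 : ∃ c' : (oracleBase M).Cfg, ExecLE (str x) (h x) (.ite (.pos 0) (acceptState M) .skip)
      (Function.update (fun _ => 0) 0 (ind (Y x))) (oracleBase M).init
      (Function.update (fun _ => 0) 0 (ind (Y x))) c' 2 ∧
      (c'.state ∈ (oracleBase M).accepting ↔ Y x) := by
    by_cases hx : Y x
    · exact ⟨_, ExecLE.ite_pos (by simp [Cond.Holds, ind_of hx])
        (ExecLE.act rfl fun j => Nat.zero_le _), iff_of_true rfl hx⟩
    · refine ⟨_, ExecLE.ite_neg (by simp [Cond.Holds, ind_of_not hx]) ExecLE.skip,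
        iff_of_false (fun h => ?_) hx⟩
      simp [MultiTapeTM.init] at h
  obtain ⟨c', h2, hc'⟩ := h2
  obtain ⟨t, ht, h3⟩ := h1.seq h2
  obtain ⟨⟨n, hn, h4, h5⟩, h6⟩ := hM' (str x) (h x) _ _ t (h x + (Nat.log 2 (t + 1) + 2)) h3
    (by omega) (by omega)
  exact ⟨t, ht.trans (he' _), ⟨n, hn, h4, h5.trans hc'⟩, h6⟩

/-! ### Growth of polynomials and polylogarithms -/

theorem Polynomial.aeval_mono_of_nonneg (p : Polynomial ℕ) {u v : ℝ} (hu : 0 ≤ u) (huv : u ≤ v) :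
    Polynomial.aeval u p ≤ Polynomial.aeval v p := by
  induction p using Polynomial.induction_on' with
  | add p q hp hq => simpa using add_le_add hp hq
  | monomial k a =>
    simp only [Polynomial.aeval_monomial]
    gcongr

theorem Polynomial.aeval_nonneg_of_nonneg (p : Polynomial ℕ) {u : ℝ} (hu : 0 ≤ u) :
    0 ≤ Polynomial.aeval u p := by
  induction p using Polynomial.induction_on' with
  | add p q hp hq => simpa using add_nonneg hp hq
  | monomial k a =>
    simp only [Polynomial.aeval_monomial]
    exact mul_nonneg (by simp) (pow_nonneg hu k)

theorem Polynomial.eval_mono_of_le (p : Polynomial ℕ) {u v : ℕ} (huv : u ≤ v) :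
    p.eval u ≤ p.eval v := by
  induction p using Polynomial.induction_on' with
  | add p q hp hq => simpa using add_le_add hp hq
  | monomial k a =>
    simp only [Polynomial.eval_monomial]
    gcongr

theorem logb_natCast_nonneg (n : ℕ) : 0 ≤ Real.logb 2 (n : ℝ) := by
  rcases Nat.eq_zero_or_pos n with rfl | hn
  · simp
  · exact Real.logb_nonneg (by norm_num) (by exact_mod_cast hn)

/-- For `n ≥ 1` the inequality `n + 2 ≤ 4 * n` gives the summand `2`; for `n = 0` the convention
that the logarithm of zero is zero leaves room enough. This makes a polylogarithm of a polynomially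
longer string a polylogarithm of the original length. -/
theorem logb_le_of_le_pow {n k c : ℕ} (h : k ≤ (n + 2) ^ c) :
    Real.logb 2 (k : ℝ) ≤ c * (Real.logb 2 (n : ℝ) + 2) := by
  have h0 := logb_natCast_nonneg n
  rcases Nat.eq_zero_or_pos k with rfl | hk
  · simp
    positivity
  have h1 : Real.logb 2 ((n + 2 : ℕ) : ℝ) ≤ Real.logb 2 (n : ℝ) + 2 := by
    rcases Nat.eq_zero_or_pos n with rfl | hn
    · simp
    · have h2 : Real.logb 2 ((n : ℝ) * 2 ^ 2) = Real.logb 2 (n : ℝ) + 2 := by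
        rw [Real.logb_mul (by positivity) (by positivity), Real.logb_pow]
        simp
      rw [← h2]
      refine Real.logb_le_logb_of_le (by norm_num) (by positivity) ?_
      have : (1 : ℝ) ≤ n := by exact_mod_cast hn
      push_cast
      linarith
  have h2 : Real.logb 2 (k : ℝ) ≤ Real.logb 2 (((n + 2) ^ c : ℕ) : ℝ) :=
    Real.logb_le_logb_of_le (by norm_num) (by exact_mod_cast hk) (by exact_mod_cast h)
  rw [Nat.cast_pow, Real.logb_pow] at h2
  exact h2.trans (mul_le_mul_of_nonneg_left h1 (Nat.cast_nonneg c))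

/-- Truth-table reductions: an instance of `P` is decided with the help of the answers to the
instances `f x g` of `Q`, whose encodings are computed in logarithmic space. -/
theorem LSH.of_reduction {P Q : ParamProblem} (f : P.Inst → γ → Q.Inst) (C c : ℕ)
    (hf : ∀ (B : MultiTapeTM InSym) (H : P.Inst → Scope B),
      LSL B P.encode H (fun x g => Q.encode (f x g)))
    (hlen : ∀ x g, (Q.encode (f x g)).length ≤ ((P.encode x).length + 2) ^ c)
    (hsize : ∀ x g, Q.size (f x g) ≤ C * max 1 (P.size x))
    (hyes : ∀ (B : MultiTapeTM InSym) (H : P.Inst → Scope B),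
      LSP B P.encode H (fun x g => Q.yes (f x g)) →
      LSP B P.encode H (fun x (_ : Unit) => P.yes x))
    (hP : LSH P) : LSH Q := by
  rintro ε hε0 hε1 ℓ ⟨p, hp⟩ ⟨M, q, hM⟩
  -- A constant of at least `1` satisfies `C' ^ ε ≤ C'`, and it absorbs the replacement of the size
  -- `0` by `1`.
  set C' := max 1 C with hC'
  have hC1 : (1 : ℝ) ≤ C' := by exact_mod_cast le_max_left 1 C
  let lam : P.Inst → ℝ := fun x => Real.logb 2 ((P.encode x).length : ℝ)
  have hlam : ∀ x, 0 ≤ lam x := fun x => logb_natCast_nonneg _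
  let m : P.Inst → ℝ := fun x => ((max 1 (P.size x) : ℕ) : ℝ) ^ ε
  have hm : ∀ x, 1 ≤ m x := fun x =>
    Real.one_le_rpow (by exact_mod_cast le_max_left 1 _) hε0.le
  let R : P.Inst → ℝ := fun x => C' * m x * Polynomial.aeval (c * (lam x + 2)) p
  -- `R x` is the space allowed to `M` on the questions asked at `x`. The minimum with a time bound
  -- of `M` changes nothing about its validity and makes `h x` polynomially bounded at once, as the
  -- time analysis requires.
  let h : P.Inst → ℕ := fun x =>
    min ⌊R x⌋₊ (q.eval (((P.encode x).length + 2) ^ c) + 1)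
  have hspace : ∀ x g t j, (M.run (Q.encode (f x g)) t).head j + 1 ≤ h x := by
    intro x g t j
    refine le_min (Nat.le_floor ?_) ?_
    · have h1 := (hM (f x g)).2 t j
      push_cast
      refine h1.trans ?_
      refine mul_le_mul ?_ ?_ ?_ ?_
      · have h2 : ((max 1 (Q.size (f x g)) : ℕ) : ℝ) ≤ C' * ((max 1 (P.size x) : ℕ) : ℝ) := by
          have h3 := hsize x g
          have h4 : max 1 (Q.size (f x g)) ≤ C' * max 1 (P.size x) := by
            have h5 : C * max 1 (P.size x) ≤ C' * max 1 (P.size x) :=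
              Nat.mul_le_mul_right _ (le_max_right _ _)
            have h6 : 1 * 1 ≤ C' * max 1 (P.size x) :=
              Nat.mul_le_mul (le_max_left _ _) (le_max_left _ _)
            omega
          exact_mod_cast h4
        refine (Real.rpow_le_rpow (by positivity) h2 hε0.le).trans ?_
        rw [Real.mul_rpow (by positivity) (by positivity)]
        refine mul_le_mul_of_nonneg_right ?_ (by positivity)
        calc (C' : ℝ) ^ ε ≤ (C' : ℝ) ^ (1 : ℝ) := Real.rpow_le_rpow_of_exponent_le hC1 hε1.le
          _ = C' := Real.rpow_one _
      · rw [hp]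
        exact Polynomial.aeval_mono_of_nonneg _ (logb_natCast_nonneg _) (logb_le_of_le_pow (hlen x g))
      · rw [hp]
        exact Polynomial.aeval_nonneg_of_nonneg _ (logb_natCast_nonneg _)
      · have := hm x
        positivity
    · obtain ⟨t₀, ht₀, hh, -⟩ := (hM (f x g)).1
      have h1 : ∀ t, (M.run (Q.encode (f x g)) t).head j ≤ t := fun t =>
        (OracleSim.extent_spec _ t j).1.trans (OracleSim.extent_spec _ t j).2.1
      have h2 : (M.run (Q.encode (f x g)) t).head j ≤ t₀ := by
        rcases le_total t t₀ with h3 | h3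
        · exact (h1 t).trans h3
        · rw [run_eq_of_halted hh h3]
          exact h1 t₀
      have h3 : q.eval (Q.encode (f x g)).length ≤ q.eval (((P.encode x).length + 2) ^ c) := by
        exact Polynomial.eval_mono_of_le q (hlen x g)
      omega
  obtain ⟨M', e, hM'⟩ := (hyes _ _ (LSP.of_machine (h := h) (hf _ _) (fun x g => (hM (f x g)).1)
    hspace)).exists_machine
  obtain ⟨k, hk⟩ := polyBdd_eval q
  have hpoly : PolyBdd (fun n => q.eval ((n + 2) ^ c)) := by
    obtain ⟨c', hc'⟩ := (PolyBdd.pow c).add (PolyBdd.const 2)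
    exact ⟨c' * k, fun n => (hk _).trans (by
      rw [pow_mul]; exact Nat.pow_le_pow_left (hc' n) k)⟩
  obtain ⟨E, hE⟩ := ((PolyBdd.pow e).mul (((PolyBdd.const 2).mul ((hpoly.add (PolyBdd.const 1)).add
    ((PolyBdd.pow e).add (PolyBdd.const 3)))).add (PolyBdd.const 3))).add (PolyBdd.const 1)
  -- The first summand pays for the tapes of `M`, the second for the logarithm of the running time
  -- `t`, with `t + 1` at most the power `e + 1` of `|x| + 2`. The summand `3` is the `2` in the
  -- bound for the counters plus the `1` by which cells exceed head positions.
  refine hP ε hε0 hε1 (fun n => Polynomial.aeval (Real.logb 2 (n : ℝ))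
    ((C' : Polynomial ℕ) * p.comp ((c : Polynomial ℕ) * (Polynomial.X + 2)) +
      ((e + 1 : ℕ) : Polynomial ℕ) * (Polynomial.X + 2) + 3)) ⟨_, fun n => rfl⟩
    ⟨M', (Polynomial.X + 2) ^ E, fun x => ?_⟩
  obtain ⟨t, ht, ⟨n, hn, h1, h2⟩, h3⟩ := hM' x
  have hlog : Nat.log 2 (t + 1) ≤ t + 1 := Nat.log_le_self _ _
  refine ⟨⟨n, hn.trans ?_, h1, h2⟩, fun s j => ?_⟩
  · simp only [Polynomial.eval_pow, Polynomial.eval_add, Polynomial.eval_X, Polynomial.eval_ofNat]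
    refine le_trans ?_ (hE _)
    have h4 : h x ≤ q.eval (((P.encode x).length + 2) ^ c) + 1 := min_le_right _ _
    have h5 : 2 * (h x + (Nat.log 2 (t + 1) + 2)) + 3 ≤
        2 * (q.eval (((P.encode x).length + 2) ^ c) + 1 + (((P.encode x).length + 2) ^ e + 3)) + 3 := by
      omega
    exact Nat.add_le_add_right (Nat.mul_le_mul ht h5) 1
  · have h4 : (h x : ℝ) ≤ R x := by
      refine (Nat.cast_le.2 (min_le_left _ _)).trans (Nat.floor_le ?_)
      have := hm x
      have := Polynomial.aeval_nonneg_of_nonneg p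
        (u := c * (lam x + 2)) (mul_nonneg (by positivity) (by linarith [hlam x]))
      positivity
    have h5 : (Nat.log 2 (t + 1) : ℝ) ≤ ((e + 1 : ℕ) : ℝ) * (lam x + 2) := by
      refine le_trans ?_ (logb_le_of_le_pow (k := t + 1) ?_)
      · exact Real.natLog_le_logb _ _
      · rw [pow_succ]
        have : 1 ≤ ((P.encode x).length + 2) ^ e := Nat.one_le_pow _ _ (by omega)
        nlinarith
    have h6 : ((M'.run (P.encode x) s).head j : ℝ) ≤ h x + (Nat.log 2 (t + 1) + 2) := by
      exact_mod_cast h3 s j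
    -- Since `m x ≥ 1`, terms without the factor `m x` also fit under a bound of the form size power
    -- times polylogarithm.
    have h7 : ∀ u : ℝ, 0 ≤ u → u ≤ m x * u := fun u hu => le_mul_of_one_le_left hu (hm x)
    have h8 := h7 (((e + 1 : ℕ) : ℝ) * (lam x + 2) + 3)
      (add_nonneg (mul_nonneg (by positivity) (by linarith [hlam x])) (by norm_num))
    have e1 : Polynomial.aeval (lam x)
        ((C' : Polynomial ℕ) * p.comp ((c : Polynomial ℕ) * (Polynomial.X + 2)) +
        ((e + 1 : ℕ) : Polynomial ℕ) * (Polynomial.X + 2) + 3) =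
        C' * Polynomial.aeval (c * (lam x + 2)) p + ((e + 1 : ℕ) : ℝ) * (lam x + 2) + 3 := by
      simp [Polynomial.aeval_comp, map_ofNat]
    show _ ≤ m x * _
    refine le_trans ?_ (le_of_eq (congrArg (m x * ·) e1.symm))
    have e2 : m x * (C' * Polynomial.aeval (c * (lam x + 2)) p + ((e + 1 : ℕ) : ℝ) * (lam x + 2) + 3)
        = R x + m x * (((e + 1 : ℕ) : ℝ) * (lam x + 2) + 3) := by
      simp only [R]; ring
    simp only [e2]
    linarith

/-- Many-one reductions. -/
theorem LSH.of_manyOne {P Q : ParamProblem} (f : P.Inst → Q.Inst) (C : ℕ)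
    (hf : ∀ (B : MultiTapeTM InSym) (H : P.Inst → Scope B),
      LSL B P.encode H (fun x (_ : Unit) => Q.encode (f x)))
    (hsize : ∀ x, Q.size (f x) ≤ C * max 1 (P.size x))
    (hyes : ∀ x, P.yes x ↔ Q.yes (f x))
    (hP : LSH P) : LSH Q := by
  -- The lengths of the encodings do not depend on the base machine, so a trivial one serves to
  -- extract their polynomial bound from `hf`.
  obtain ⟨c, hc⟩ := (hf _ (fun _ => Scope.init (oracleBase
    ⟨0, Unit, Unit, inferInstance, inferInstance, (), (), ∅, fun _ _ _ => none⟩) 0)).pb 0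
  exact LSH.of_reduction (γ := Unit) (fun x _ => f x) C c hf (fun x _ => hc x () trivial)
    (fun x _ => hsize x) (fun B H h => h.congr fun x _ => hyes x) hP

@[simp] theorem ind_true : ind True = 1 := ind_of trivial

@[simp] theorem ind_false : ind False = 0 := ind_of_not not_false

/-! ## Lists -/

theorem List.countP_le_card {α : Type*} [DecidableEq α] {l : List α} (hl : l.Nodup) {p : α → Bool}
    (s : Finset α) (h : ∀ a ∈ l, p a = true → a ∈ s) : l.countP p ≤ s.card := by
  rw [List.countP_eq_length_filter, ← List.toFinset_card_of_nodup (hl.filter p)]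
  refine Finset.card_le_card fun a ha => ?_
  simp only [List.mem_toFinset, List.mem_filter] at ha
  exact h a ha.1 ha.2

theorem List.card_filter_get {α : Type*} (l : List α) (p : α → Prop) [DecidablePred p] :
    (Finset.univ.filter (fun i : Fin l.length => p l[i])).card = l.countP (fun a => p a) := by
  rw [← Fintype.card_subtype, Fintype.card_eq_nat_card]
  induction l with
  | nil => simp
  | cons a l ih =>
    rw [List.countP_cons, ← ih, ← Fintype.card_eq_nat_card, ← Fintype.card_eq_nat_card,
      Fintype.card_subtype, Fintype.card_subtype]
    have := Fin.card_filter_univ_succ (n := l.length) (fun i => p (a :: l)[i])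
    simp only [List.length_cons] at this ⊢
    rw [this]
    simp
    split_ifs <;> simp

theorem List.flatMap_filter_eq {α β : Type*} (l : List α) (p : α → Prop) [DecidablePred p]
    (g : α → List β) : (l.filter (fun a => p a)).flatMap g =
      l.flatMap (fun a => if p a then g a else []) := by
  induction l with
  | nil => rfl
  | cons a l ih =>
    by_cases h : p a
    · simp [h, ih]
    · simp [h, ih]

theorem encodeWords_flatMap {α : Type*} (l : List α) (g : α → List (List Bool)) :
    encodeWords (l.flatMap g) = l.flatMap (fun a => encodeWords (g a)) := by
  induction l with
  | nil => rfl
  | cons a l ih => rw [List.flatMap_cons, encodeWords_append, ih, List.flatMap_cons]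

theorem LSL.self : LSL B str H (fun x (_ : γ) => str x) where
  scan := (LS.ite (LSP.lt LS.last (LS.const 4)) LS.last (LS.ite
    (LSP.lt (LS.last.sub (LS.const 4)) LS.length) (LS.read (LS.last.sub (LS.const 4)))
    (LS.last.sub LS.length))).congr fun _ _ => rfl
  pb := PB.length

/-! ## Linear programs given by lists of rows and columns -/

namespace LPTwoThree

section

variable {ρ κ : Type} (R : List ρ) (C : List κ) (hR : 1 ≤ R.length) (hC : 1 ≤ C.length)
  (a : ρ → κ → ℚ) (b : ρ → ℚ) (hrow : ∀ r ∈ R, C.countP (fun c => a r c ≠ 0) ≤ 2)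
  (hcol : ∀ c ∈ C, R.countP (fun r => a r c ≠ 0) ≤ 3)

def ofLists : LPTwoThree where
  m := R.length
  n := C.length
  m_pos := hR
  n_pos := hC
  A i j := a R[i] C[j]
  b i := b R[i]
  row_sparse i := by
    rw [List.card_filter_get C (fun c => a R[i] c ≠ 0)]
    exact hrow _ (List.getElem_mem _)
  col_sparse j := by
    rw [List.card_filter_get R (fun r => a r C[j] ≠ 0)]
    exact hcol _ (List.getElem_mem _)

theorem encode_ofLists : (ofLists R C hR hC a b hrow hcol).encode =
    R.flatMap (fun r => C.flatMap (fun c => encodeWords (ratWords (a r c))) ++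
      (encodeWords (ratWords (b r)) ++ encodeWords [[]])) := by
  have h1 : ∀ r : ρ, List.ofFn (fun j : Fin C.length => a r C[j]) = C.map (a r) := fun r => by
    refine List.ext_getElem (by simp) fun i _ _ => by simp
  have h2 : List.ofFn (fun i : Fin R.length => (C.map (a R[i]) ++ [b R[i]]).flatMap ratWords) =
      R.map (fun r => (C.map (a r) ++ [b r]).flatMap ratWords) :=
    List.ext_getElem (by simp) fun i _ _ => by simp
  have h3 : (ofLists R C hR hC a b hrow hcol).encode = encodeWords (tableWords (List.ofFn
      (fun i : Fin R.length => (List.ofFn (fun j : Fin C.length => a R[i] C[j]) ++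
        [b R[i]]).flatMap ratWords))) := rfl
  rw [h3]
  simp only [h1]
  rw [h2, tableWords, List.flatMap_map, encodeWords_flatMap]
  refine List.flatMap_congr fun r _ => ?_
  rw [encodeWords_append, encodeWords_flatMap, List.flatMap_append, List.flatMap_map]
  simp

theorem feasible_ofLists [DecidableEq κ] (hnd : C.Nodup) :
    (ofLists R C hR hC a b hrow hcol).Feasible ↔
    ∃ X : κ → ℚ, (∀ c, X c = 0 ∨ X c = 1) ∧
      ∀ r ∈ R, b r ≤ ∑ c ∈ C.toFinset, a r c * X c := by
  have key : ∀ (r : ρ) (X : κ → ℚ), ∑ c ∈ C.toFinset, a r c * X c =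
      ∑ j : Fin C.length, a r C[j] * X C[j] := by
    intro r X
    rw [List.sum_toFinset (M := ℚ) (fun c => a r c * X c) hnd]
    exact (Fin.sum_univ_fun_getElem C (fun c => a r c * X c)).symm
  simp only [key]
  constructor
  · rintro ⟨x, hx, hx'⟩
    refine ⟨fun c => if h : C.idxOf c < C.length then x ⟨C.idxOf c, h⟩ else 0, fun c => ?_, ?_⟩
    · dsimp only
      split_ifs with h
      · exact hx _
      · exact Or.inl rfl
    · intro r hr
      obtain ⟨i, hi, rfl⟩ := List.getElem_of_mem hr
      refine (hx' ⟨i, hi⟩).trans (le_of_eq ?_)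
      show ∑ j : Fin C.length, a R[i] C[j] * x j = _
      refine Finset.sum_congr rfl fun j _ => ?_
      have : C.idxOf C[j] = j := hnd.idxOf_getElem j j.2
      simp only [this, j.2, dite_true]
      rfl
  · rintro ⟨X, hX, hX'⟩
    exact ⟨fun j => X C[j], fun j => hX _, fun i => hX' _ (List.getElem_mem _)⟩

end

/-- A difference of two indicators is `0`, `1` or `-1`, so one of three fixed strings is produced.
-/
theorem lsl_ratWords {P Q : ι → γ → Prop} (hP : LSP B str H P) (hQ : LSP B str H Q) :
    LSL B str H (fun x g => encodeWords (ratWords ((ind (P x g) : ℚ) - ind (Q x g)))) := by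
  classical
  refine (LSL.ite (hP.iff hQ) (LSL.const (encodeWords (ratWords 0))) (LSL.ite hP
    (LSL.const (encodeWords (ratWords 1))) (LSL.const (encodeWords (ratWords (-1)))))).congr
    fun x g => ?_
  by_cases h : P x g <;> by_cases h' : Q x g <;> simp [h, h', ind]

end LPTwoThree

/-! ## Reading a graph -/

namespace ThreeDSTCON

/-- Adjacency of natural numbers. -/
def Adj (G : ThreeDSTCON) (u v : ℕ) : Prop := ∃ e ∈ G.E, (e.1 : ℕ) = u ∧ (e.2 : ℕ) = v

theorem Adj.lt {G : ThreeDSTCON} {u v : ℕ} (h : G.Adj u v) : u < G.n ∧ v < G.n := by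
  obtain ⟨e, -, rfl, rfl⟩ := h
  exact ⟨e.1.2, e.2.2⟩

theorem adj_iff {G : ThreeDSTCON} {u v : Fin G.n} : G.Adj u v ↔ (u, v) ∈ G.E := by
  constructor
  · rintro ⟨⟨u', v'⟩, he, h1, h2⟩
    rwa [← Fin.ext h1, ← Fin.ext h2]
  · exact fun h => ⟨_, h, rfl, rfl⟩

theorem connected_iff (G : ThreeDSTCON) :
    G.Connected ↔ Relation.ReflTransGen G.Adj G.s G.t := by
  constructor
  · exact fun h => Relation.ReflTransGen.lift (r := fun u v => (u, v) ∈ G.E)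
      (fun v : Fin G.n => (v : ℕ)) (fun u v huv => adj_iff.2 huv) _ _ h
  · intro h
    have key : ∀ v : ℕ, Relation.ReflTransGen G.Adj G.s v → ∀ hv : v < G.n,
        Relation.ReflTransGen (fun u v => (u, v) ∈ G.E) G.s ⟨v, hv⟩ := by
      intro v hv
      induction hv with
      | refl => exact fun _ => .refl
      | tail _ h2 ih => exact fun hv => (ih h2.lt.1).tail (adj_iff.1 h2)
    exact key _ h G.t.2

def words (G : ThreeDSTCON) : List (List Bool) :=
  List.ofFn (fun u => List.ofFn (fun v => decide ((u, v) ∈ G.E))) ++ [Nat.bits G.s, Nat.bits G.t]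

theorem encode_eq (G : ThreeDSTCON) : G.encode = encodeWords G.words := rfl

variable {H : ThreeDSTCON → Scope B} {F K : ThreeDSTCON → γ → ℕ}

theorem ls_n : LS B encode H (fun G (_ : γ) => G.n) :=
  ((LS.wordCount encode_eq).sub (LS.const 2)).congr fun G _ => by simp [words]

theorem lsp_adj (hF : LS B encode H F) (hK : LS B encode H K) :
    LSP B encode H (fun G g => G.Adj (F G g) (K G g)) := by
  refine ((LSP.lt hF ls_n).and ((LSW.word encode_eq hF).bit_at hK)).congr fun G g => ?_
  constructor
  · intro h
    refine ⟨h.lt.1, ?_⟩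
    have h1 := h.lt
    have h2 : (⟨F G g, h1.1⟩, ⟨K G g, h1.2⟩) ∈ G.E := adj_iff.1 h
    have h3 : wordAt G.words (F G g) = List.ofFn (fun v => decide ((⟨F G g, h1.1⟩, v) ∈ G.E)) := by
      simp [wordAt, words, List.getD_eq_getElem?_getD, List.getElem?_append_left, h1.1]
    rw [h3, List.getElem?_eq_getElem (by simp; exact h1.2)]
    simpa using h2
  · rintro ⟨h1, h2⟩
    have h3 : wordAt G.words (F G g) = List.ofFn (fun v => decide ((⟨F G g, h1⟩, v) ∈ G.E)) := by
      simp [wordAt, words, List.getD_eq_getElem?_getD, List.getElem?_append_left, h1]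
    rw [h3] at h2
    obtain ⟨h4, h5⟩ := List.getElem?_eq_some_iff.1 h2
    rw [List.length_ofFn] at h4
    rw [List.getElem_ofFn] at h5
    exact ⟨_, of_decide_eq_true h5, rfl, rfl⟩

theorem lsp_eq_s (hF : LS B encode H F) : LSP B encode H (fun G g => F G g = G.s) := by
  refine (LSW.eq (LSW.bits hF) (LSW.word encode_eq ls_n)).congr fun G g => ?_
  have h3 : wordAt G.words G.n = Nat.bits G.s := by
    simp [wordAt, words, List.getD_eq_getElem?_getD]
  rw [h3]
  exact natBits_injective.eq_iff.symm

theorem lsp_eq_t (hF : LS B encode H F) : LSP B encode H (fun G g => F G g = G.t) := by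
  refine (LSW.eq (LSW.bits hF) (LSW.word encode_eq ls_n.succ)).congr fun G g => ?_
  have h3 : wordAt G.words (G.n + 1) = Nat.bits G.t := by
    simp [wordAt, words, List.getD_eq_getElem?_getD]
  rw [h3]
  exact natBits_injective.eq_iff.symm

end ThreeDSTCON

/-! ## From connectivity to linear programs -/

namespace ThreeDSTCON

variable (G : ThreeDSTCON)

/-- Only vertices on an edge become columns. The number of columns is then bounded by the number of
edges, however many isolated vertices there are. -/
def Touched (w : ℕ) : Prop := ∃ v < G.n, G.Adj w v ∨ G.Adj v w

open Classical in
noncomputable def edgeList : List (ℕ × ℕ) :=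
  (List.range G.n ×ˢ List.range G.n).filter (fun e => G.Adj e.1 e.2)

open Classical in
noncomputable def vertexList : List ℕ := (List.range G.n).filter (fun w => G.Touched w)

/-- A trivial row and column are added, in order that there is always a row and a column. -/
noncomputable def lpRows : List (Option (ℕ × ℕ)) := none :: G.edgeList.map some

noncomputable def lpCols : List (Option ℕ) := none :: G.vertexList.map some

/-- The vertex `w` is the vertex `v`, and it is a variable of the program. -/
def IsVar (v w : ℕ) : Prop := w = v ∧ ¬ w = G.s ∧ ¬ w = G.t

/-- The row of an edge `(u, v)` is the condition `X v - X u ≥ 0`, into which `X s = 1` and `X t = 0`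
have been substituted. The constants that arise from `s` are moved to the right-hand side `lpBound`.
For a loop the two indicators cancel. -/
noncomputable def lpEntry : Option (ℕ × ℕ) → Option ℕ → ℚ
  | some e, some w => (ind (G.IsVar e.2 w) : ℚ) - ind (G.IsVar e.1 w)
  | _, _ => 0

/-- The trivial row reads `0 ≥ 1` when `s = t`, where the substitution of both values would be
contradictory, and `0 ≥ 0` otherwise. -/
noncomputable def lpBound : Option (ℕ × ℕ) → ℚ
  | some e => (ind (e.1 = G.s) : ℚ) - ind (e.2 = G.s)
  | none => (ind ((G.s : ℕ) = G.t) : ℚ) - ind False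

theorem mem_edgeList {e : ℕ × ℕ} : e ∈ G.edgeList ↔ G.Adj e.1 e.2 := by
  simp only [edgeList, List.mem_filter, decide_eq_true_eq]
  exact ⟨fun h => h.2, fun h => ⟨List.pair_mem_product.2
    ⟨List.mem_range.2 h.lt.1, List.mem_range.2 h.lt.2⟩, h⟩⟩

theorem nodup_edgeList : G.edgeList.Nodup :=
  (List.nodup_range.product List.nodup_range).filter _

theorem mem_vertexList {w : ℕ} : w ∈ G.vertexList ↔ G.Touched w := by
  simp only [vertexList, List.mem_filter, decide_eq_true_eq, List.mem_range]
  refine ⟨fun h => h.2, fun h => ⟨?_, h⟩⟩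
  obtain ⟨v, hv, h | h⟩ := h
  · exact h.lt.1
  · exact h.lt.2

theorem nodup_vertexList : G.vertexList.Nodup := List.nodup_range.filter _

theorem nodup_lpCols : G.lpCols.Nodup := by
  refine List.nodup_cons.2 ⟨by simp, ?_⟩
  exact List.Nodup.map (Option.some_injective _) G.nodup_vertexList

theorem nodup_lpRows : G.lpRows.Nodup := by
  refine List.nodup_cons.2 ⟨by simp, ?_⟩
  exact List.Nodup.map (Option.some_injective _) G.nodup_edgeList

theorem lpEntry_ne_zero {r : Option (ℕ × ℕ)} {c : Option ℕ} (h : G.lpEntry r c ≠ 0) :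
    ∃ e, r = some e ∧ (c = some e.1 ∨ c = some e.2) := by
  rcases r with _ | e <;> rcases c with _ | w
  · exact absurd rfl h
  · exact absurd rfl h
  · exact absurd rfl h
  · refine ⟨e, rfl, ?_⟩
    by_contra hc
    rw [not_or, Option.some_inj, Option.some_inj] at hc
    refine h ?_
    have h1 : ¬ G.IsVar e.2 w := fun h' => hc.2 h'.1
    have h2 : ¬ G.IsVar e.1 w := fun h' => hc.1 h'.1
    simp [lpEntry, ind_of_not h1, ind_of_not h2]

theorem lp_row_sparse (r : Option (ℕ × ℕ)) :
    G.lpCols.countP (fun c => G.lpEntry r c ≠ 0) ≤ 2 := by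
  rcases r with _ | e
  · refine (List.countP_le_card G.nodup_lpCols ∅ fun c _ h => ?_).trans (by simp)
    obtain ⟨e, he, -⟩ := G.lpEntry_ne_zero (of_decide_eq_true h)
    simp at he
  · refine (List.countP_le_card G.nodup_lpCols {some e.1, some e.2} fun c _ h => ?_).trans
      Finset.card_le_two
    obtain ⟨e', he, h'⟩ := G.lpEntry_ne_zero (of_decide_eq_true h)
    rw [Option.some_inj] at he
    subst he
    simpa using h'

/-- A row with a nonzero entry in the column of `w` comes from an edge that enters or leaves `w`,
and there are at most three of these. -/
theorem lp_col_sparse (c : Option ℕ) (hc : c ∈ G.lpCols) :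
    G.lpRows.countP (fun r => G.lpEntry r c ≠ 0) ≤ 3 := by
  classical
  rcases c with _ | w
  · refine (List.countP_le_card G.nodup_lpRows ∅ fun r _ h => ?_).trans (by simp)
    obtain ⟨e, -, he⟩ := G.lpEntry_ne_zero (of_decide_eq_true h)
    simp at he
  · have hw : w < G.n := by
      simp only [lpCols, List.mem_cons, reduceCtorEq, List.mem_map, Option.some_inj,
        exists_eq_right, false_or, mem_vertexList] at hc
      obtain ⟨v, hv, h | h⟩ := hc
      · exact h.lt.1
      · exact h.lt.2
    refine (List.countP_le_card G.nodup_lpRows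
      (((G.E.filter (fun e => e.2 = ⟨w, hw⟩)) ∪ (G.E.filter (fun e => e.1 = ⟨w, hw⟩))).image
        (fun e => some ((e.1 : ℕ), (e.2 : ℕ)))) fun r hr h => ?_).trans
      (Finset.card_image_le.trans ((Finset.card_union_le _ _).trans (G.degree_le ⟨w, hw⟩)))
    obtain ⟨⟨u, v⟩, rfl, he⟩ := G.lpEntry_ne_zero (of_decide_eq_true h)
    simp only [lpRows, List.mem_cons, reduceCtorEq, List.mem_map, Option.some_inj,
        exists_eq_right, false_or, mem_edgeList] at hr
    obtain ⟨⟨u', v'⟩, hE, rfl, rfl⟩ := hr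
    simp only [Option.some_inj] at he
    refine Finset.mem_image.2 ⟨_, ?_, rfl⟩
    simp only [Finset.mem_union, Finset.mem_filter, hE, true_and, Fin.ext_iff]
    tauto

noncomputable def toLP : LPTwoThree :=
  LPTwoThree.ofLists G.lpRows G.lpCols (by simp [lpRows]) (by simp [lpCols]) G.lpEntry G.lpBound
    (fun r _ => G.lp_row_sparse r) G.lp_col_sparse

theorem toLP_m_le : G.toLP.m ≤ G.E.card + 1 := by
  show G.lpRows.length ≤ _
  rw [lpRows, List.length_cons, List.length_map, ← List.toFinset_card_of_nodup G.nodup_edgeList]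
  refine Nat.succ_le_succ ((Finset.card_le_card (t := G.E.image
    (fun e => ((e.1 : ℕ), (e.2 : ℕ)))) fun e he => ?_).trans Finset.card_image_le)
  rw [List.mem_toFinset, mem_edgeList] at he
  obtain ⟨e', he', h1, h2⟩ := he
  exact Finset.mem_image.2 ⟨e', he', Prod.ext h1 h2⟩

theorem toLP_n_le : G.toLP.n ≤ 2 * G.E.card + 1 := by
  show G.lpCols.length ≤ _
  rw [lpCols, List.length_cons, List.length_map,
    ← List.toFinset_card_of_nodup G.nodup_vertexList]
  refine Nat.succ_le_succ ((Finset.card_le_card (t := G.E.image (fun e => (e.1 : ℕ)) ∪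
    G.E.image (fun e => (e.2 : ℕ))) fun w hw => ?_).trans ((Finset.card_union_le _ _).trans ?_))
  · rw [List.mem_toFinset, mem_vertexList] at hw
    obtain ⟨v, -, ⟨e, he, h1, h2⟩ | ⟨e, he, h1, h2⟩⟩ := hw
    · exact Finset.mem_union_left _ (Finset.mem_image.2 ⟨e, he, h1⟩)
    · exact Finset.mem_union_right _ (Finset.mem_image.2 ⟨e, he, h2⟩)
  · rw [two_mul]
    exact add_le_add Finset.card_image_le Finset.card_image_le

theorem sum_lpEntry {e : ℕ × ℕ} (he : G.Adj e.1 e.2) (X : Option ℕ → ℚ) :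
    ∑ c ∈ G.lpCols.toFinset, G.lpEntry (some e) c * X c =
      (if e.2 = G.s ∨ e.2 = G.t then 0 else X (some e.2)) -
      (if e.1 = G.s ∨ e.1 = G.t then 0 else X (some e.1)) := by
  have key : ∀ v, G.Touched v → ∑ c ∈ G.lpCols.toFinset,
      ((fun c => match c with | some w => (ind (G.IsVar v w) : ℚ) | none => 0 : Option ℕ → ℚ) c) *
      X c = if v = G.s ∨ v = G.t then 0 else X (some v) := by
    intro v hv
    have hmem : some v ∈ G.lpCols.toFinset := by
      simp [lpCols, mem_vertexList, hv]
    rw [Finset.sum_eq_single_of_mem _ hmem]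
    · dsimp only
      split_ifs with h
      · rw [ind_of_not (by unfold IsVar; tauto)]; simp
      · rw [ind_of (by unfold IsVar; tauto)]; simp
    · rintro (_ | w) _ hw
      · simp
      · have : ¬ G.IsVar v w := fun h => hw (by rw [h.1])
        simp [ind_of_not this]
  rw [← key e.2 ⟨e.1, he.lt.1, Or.inr he⟩, ← key e.1 ⟨e.2, he.lt.2, Or.inl he⟩,
    ← Finset.sum_sub_distrib]
  refine Finset.sum_congr rfl fun c _ => ?_
  rcases c with _ | w
  · simp [lpEntry]
  · simp only [lpEntry]; ring

/-- In a solution the value `1` spreads from `s` along edges, so a path to `t` would force `0 ≥ 1`.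
Conversely, if `t` is not reachable, the indicator of reachability from `s` has the right values at
`s` and `t` and is monotone along edges. -/
theorem toLP_feasible : G.toLP.Feasible ↔ ¬ G.Connected := by
  rw [toLP, LPTwoThree.feasible_ofLists _ _ _ _ _ _ _ _ G.nodup_lpCols, connected_iff]
  constructor
  · rintro ⟨X, hX, h⟩ hc
    have hst : (G.s : ℕ) ≠ G.t := by
      intro hst
      have := h none (by simp [lpRows])
      simp [lpBound, lpEntry, ind_of hst, ind_of_not not_false] at this
      linarith
    have key : ∀ v, Relation.ReflTransGen G.Adj G.s v →
        v = G.s ∨ (v ≠ G.t ∧ X (some v) = 1) := by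
      intro v hv
      induction hv with
      | refl => exact Or.inl rfl
      | @tail u v _ huv ih =>
        have h1 := h (some (u, v)) (by simp [lpRows, mem_edgeList, huv])
        rw [G.sum_lpEntry huv] at h1
        by_cases hvs : v = G.s
        · exact Or.inl hvs
        · right
          have h2 : (1 : ℚ) ≤ if v = G.s ∨ v = G.t then 0 else X (some v) := by
            simp only [lpBound, ind_of_not hvs] at h1
            rcases ih with rfl | ⟨hu1, hu2⟩
            · simp at h1
              simpa [hvs] using h1
            · by_cases hus : u = G.s
              · subst hus
                simp at h1
                simpa [hvs] using h1
              · simp [hus, hu1, hu2] at h1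
                exact h1
          split_ifs at h2 with h3
          · norm_num at h2
          · refine ⟨fun h4 => h3 (Or.inr h4), ?_⟩
            rcases hX (some v) with h5 | h5
            · rw [h5] at h2; norm_num at h2
            · exact h5
    rcases key _ hc with h1 | h1
    · exact hst h1.symm
    · exact h1.1 rfl
  · intro hc
    let Y : ℕ → ℕ := fun v => ind (Relation.ReflTransGen G.Adj G.s v)
    have hYs : Y G.s = 1 := ind_of .refl
    have hYt : Y G.t = 0 := ind_of_not hc
    have hY : ∀ {u v}, G.Adj u v → Y u ≤ Y v := by
      intro u v huv
      by_cases h : Relation.ReflTransGen G.Adj G.s u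
      · simp only [Y]; rw [ind_of h, ind_of (h.tail huv)]
      · simp only [Y]; rw [ind_of_not h]; exact Nat.zero_le _
    refine ⟨fun c => match c with | some w => (Y w : ℚ) | none => 0, ?_, ?_⟩
    · rintro (_ | w)
      · exact Or.inl rfl
      · by_cases h : Relation.ReflTransGen G.Adj G.s w
        · right; simp [Y, ind_of h]
        · left; simp [Y, ind_of_not h]
    · intro r hr
      rcases r with _ | ⟨u, v⟩
      · have hst : ¬ (G.s : ℕ) = G.t := fun hst => hc (hst ▸ .refl)
        simp [lpBound, lpEntry, ind_of_not hst, ind_of_not not_false]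
      · simp only [lpRows, List.mem_cons, reduceCtorEq, List.mem_map, Option.some_inj,
          exists_eq_right, false_or, mem_edgeList] at hr
        rw [G.sum_lpEntry hr]
        have h1 : (Y u : ℚ) ≤ Y v := by exact_mod_cast hY hr
        have h2 : ∀ w : ℕ, (if w = G.s ∨ w = G.t then (0 : ℚ) else Y w) = Y w - ind (w = G.s) := by
          intro w
          by_cases hs : w = G.s
          · rw [hs, hYs]; simp
          · by_cases ht : w = G.t
            · rw [ind_of_not hs, ht, hYt]; simp
            · simp [hs, ht]
        simp only [h2, lpBound]
        linarith

/-- The lists of rows and columns are filtered ranges or products of ranges with tests decided in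
logarithmic space. Hence a `flatMap` over them is a loop over vertices or pairs of vertices that
emits nothing where the test fails. -/
theorem lsl_toLP {H : ThreeDSTCON → Scope B} :
    LSL B encode H (fun G (_ : γ) => G.toLP.encode) := by
  classical
  have hvar : ∀ {γ : Type} [Ctx γ] {F K : ThreeDSTCON → γ → ℕ}, LS B encode H F → LS B encode H K →
      LSP B encode H (fun G g => G.IsVar (F G g) (K G g)) := fun hF hK =>
    (LSP.eq hK hF).and ((lsp_eq_s hK).not.and (lsp_eq_t hK).not)
  have htouch : ∀ {γ : Type} [Ctx γ], LSP B encode H (fun G (g : γ × ℕ) => G.Touched g.2) :=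
    fun {γ} _ => LSP.ex (γ := γ × ℕ) (P := fun G g v => G.Adj g.2 v ∨ G.Adj v g.2) ls_n
      ((lsp_adj LS.last.weaken LS.last).or (lsp_adj LS.last LS.last.weaken))
  have hcols : ∀ {γ : Type} [Ctx γ] {S : ThreeDSTCON → γ → Option ℕ → List InSym},
      LSL B encode H (fun G g => S G g none) →
      LSL B encode H (fun G (g : γ × ℕ) => S G g.1 (some g.2)) →
      LSL B encode H (fun G g => G.lpCols.flatMap (S G g)) := fun {γ} _ {S} h1 h2 =>
    (h1.append (LSL.flatMap (S := fun G g w => if G.Touched w then S G g (some w) else []) ls_n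
      (LSL.ite htouch h2 LSL.nil))).congr fun G g => by
        rw [lpCols, List.flatMap_cons, List.flatMap_map, vertexList, List.flatMap_filter_eq]
  have hrows : ∀ {S : ThreeDSTCON → Option (ℕ × ℕ) → List InSym},
      LSL B encode H (fun G (_ : γ) => S G none) →
      LSL B encode H (fun G (g : (γ × ℕ) × ℕ) => S G (some (g.1.2, g.2))) →
      LSL B encode H (fun G (_ : γ) => G.lpRows.flatMap (S G)) := fun {S} h1 h2 =>
    (h1.append (LSL.flatMap (S := fun G _ u => (List.range G.n).flatMap fun v =>
      if G.Adj u v then S G (some (u, v)) else []) ls_n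
      (LSL.flatMap (γ := γ × ℕ) (S := fun G g v => if G.Adj g.2 v then S G (some (g.2, v)) else []) ls_n
      (LSL.ite (lsp_adj LS.last.weaken LS.last) h2 LSL.nil)))).congr fun G g => by
        rw [lpRows, List.flatMap_cons, List.flatMap_map, edgeList, List.flatMap_filter_eq]
        congr 1
        show List.flatMap _ ((List.range G.n).flatMap _) = _
        rw [List.flatMap_assoc]
        simp only [List.flatMap_map]
  have hzero : ∀ {γ : Type} [Ctx γ], LSL B encode H (fun _ (_ : γ) =>
      encodeWords (LPTwoThree.ratWords 0)) := LSL.const _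
  have hfalse : ∀ {γ : Type} [Ctx γ], LSP B encode H (fun _ (_ : γ) => False) :=
    (LS.const 0).congr fun _ _ => ind_of_not not_false
  have hst : LSP B encode H (fun G (_ : γ) => (G.s : ℕ) = G.t) :=
    (LSW.eq (LSW.word encode_eq ls_n) (LSW.word encode_eq ls_n.succ)).congr fun G g => by
      simp [wordAt, words, List.getD_eq_getElem?_getD,
        natBits_injective.eq_iff]
  refine (hrows (S := fun G r => G.lpCols.flatMap
    (fun c => encodeWords (LPTwoThree.ratWords (G.lpEntry r c))) ++
      (encodeWords (LPTwoThree.ratWords (G.lpBound r)) ++ encodeWords [[]])) ?_ ?_).congr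
    fun G g => LPTwoThree.encode_ofLists _ _ _ _ _ _ _ _
  · exact (hcols (S := fun G _ c => encodeWords (LPTwoThree.ratWords (G.lpEntry none c)))
      hzero hzero).append ((LPTwoThree.lsl_ratWords hst hfalse).append (LSL.const _))
  · refine (hcols (S := fun G (g : (γ × ℕ) × ℕ) c =>
      encodeWords (LPTwoThree.ratWords (G.lpEntry (some (g.1.2, g.2)) c))) hzero ?_).append
      (LSL.append ?_ (LSL.const _))
    · exact LPTwoThree.lsl_ratWords (hvar LS.last.weaken LS.last)
        (hvar LS.last.weaken.weaken LS.last)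
    · exact LPTwoThree.lsl_ratWords (lsp_eq_s LS.last.weaken) (lsp_eq_s LS.last)

end ThreeDSTCON

/-! ## Satisfiability of 2CNF formulas and the implication graph -/

section ImplicationGraph

variable {V : Type}

/-- The negation of a literal. -/
def negLit (l : V × Bool) : V × Bool := (l.1, !l.2)

@[simp] theorem negLit_negLit (l : V × Bool) : negLit (negLit l) = l := by simp [negLit]

/-- The implications of a set of clauses `l ∨ l'`. -/
def Implies (K : V × Bool → V × Bool → Prop) (u w : V × Bool) : Prop := K (negLit u) w

/-- Contraposition: since clauses are symmetric, each implication may be reversed with both sides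
negated. -/
theorem reflTransGen_implies_neg {K : V × Bool → V × Bool → Prop} (hK : ∀ l l', K l l' → K l' l)
    {u w : V × Bool} (h : Relation.ReflTransGen (Implies K) u w) :
    Relation.ReflTransGen (Implies K) (negLit w) (negLit u) := by
  induction h with
  | refl => exact .refl
  | tail _ h ih =>
    refine Relation.ReflTransGen.head ?_ ih
    show K _ _
    rw [negLit_negLit]
    exact hK _ _ h

/-- An assignment keeps truth along implications, so a literal cannot reach its negation and come
back. For the converse, Zorn's lemma gives a maximal set of literals that is consistent and closed
under implication; such a set decides every variable and is read as an assignment. -/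
theorem exists_assignment_iff {K : V × Bool → V × Bool → Prop} (hK : ∀ l l', K l l' → K l' l) :
    (∃ τ : V → Bool, ∀ l l', K l l' → τ l.1 = l.2 ∨ τ l'.1 = l'.2) ↔
    ∀ v, ¬ (Relation.ReflTransGen (Implies K) (v, false) (v, true) ∧
      Relation.ReflTransGen (Implies K) (v, true) (v, false)) := by
  constructor
  · rintro ⟨τ, hτ⟩ v ⟨h1, h2⟩
    have key : ∀ u w, Relation.ReflTransGen (Implies K) u w → τ u.1 = u.2 → τ w.1 = w.2 := by
      intro u w h hu
      induction h with
      | refl => exact hu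
      | @tail b c _ h ih =>
        rcases hτ _ _ h with h3 | h3
        · simp only [negLit] at h3
          rw [ih] at h3
          simp at h3
        · exact h3
    cases hv : τ v
    · have := key _ _ h1 hv
      simp [hv] at this
    · have := key _ _ h2 hv
      simp [hv] at this
  · intro h
    let 𝒮 : Set (Set (V × Bool)) := {S | (∀ u ∈ S, negLit u ∉ S) ∧
      ∀ u ∈ S, ∀ w, Relation.ReflTransGen (Implies K) u w → w ∈ S}
    obtain ⟨S, hS⟩ := zorn_subset 𝒮 (fun c hc hchain => by
      refine ⟨⋃₀ c, ⟨?_, ?_⟩, fun s hs => Set.subset_sUnion_of_mem hs⟩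
      · rintro u ⟨s, hs, hu⟩ ⟨s', hs', hu'⟩
        rcases hchain.total hs hs' with h1 | h1
        · exact (hc hs').1 u (h1 hu) hu'
        · exact (hc hs).1 u hu (h1 hu')
      · rintro u ⟨s, hs, hu⟩ w hw
        exact ⟨s, hs, (hc hs).2 u hu w hw⟩)
    obtain ⟨⟨hcons, hclosed⟩, hmax⟩ := hS
    have htotal : ∀ v b, (v, b) ∈ S ∨ (v, !b) ∈ S := by
      intro v b
      by_contra hno
      rw [not_or] at hno
      -- If `v` is undecided, one of its two literals does not reach its negation; that literal and
      -- all that it implies will be added.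
      have hex : ∃ l : V × Bool, l.1 = v ∧ ¬ Relation.ReflTransGen (Implies K) l (negLit l) := by
        by_contra hall
        push Not at hall
        exact h v ⟨hall (v, false) rfl, hall (v, true) rfl⟩
      obtain ⟨l, hl, hpath⟩ := hex
      have hlS : l ∉ S ∧ negLit l ∉ S := by
        obtain ⟨w, b'⟩ := l
        obtain rfl : w = v := hl
        cases b <;> cases b' <;> simp_all [negLit]
      -- If `l` reached both `u` and its negation, contraposition would lead from `u` to the
      -- negation of `l`, and hence from `l` to it. If one of the two lies in `S` and the other is
      -- reached from `l`, the negation of `l` would lie in the closed set `S`.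
      have hmem : S ∪ {w | Relation.ReflTransGen (Implies K) l w} ∈ 𝒮 := by
        constructor
        · rintro u (hu | hu) (hu' | hu')
          · exact hcons u hu hu'
          · have := reflTransGen_implies_neg hK hu'
            rw [negLit_negLit] at this
            exact hlS.2 (hclosed u hu _ this)
          · have := reflTransGen_implies_neg hK hu
            exact hlS.2 (hclosed _ hu' _ this)
          · have := reflTransGen_implies_neg hK hu'
            rw [negLit_negLit] at this
            exact hpath (hu.trans this)
        · rintro u (hu | hu) w hw
          · exact Or.inl (hclosed u hu w hw)
          · exact Or.inr (hu.trans hw)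
      exact hlS.1 (hmax hmem Set.subset_union_left (Or.inr .refl))
    classical
    refine ⟨fun v => decide ((v, true) ∈ S), fun l l' hl => ?_⟩
    have htrue : ∀ u ∈ S, decide ((u.1, true) ∈ S) = u.2 := by
      rintro ⟨v, b⟩ hu
      cases b
      · simpa [negLit] using hcons _ hu
      · simpa using hu
    rcases htotal l.1 l.2 with h1 | h1
    · exact Or.inl (htrue _ h1)
    · refine Or.inr (htrue _ (hclosed _ h1 _ (.single ?_)))
      show K _ _
      simpa [negLit] using hl

end ImplicationGraph

/-! ## Lists of clauses as lists of tokens -/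

section Tokens

variable {α : Type}

/-- The literals of each clause are followed by a terminator. -/
def clauseTokens (cl : List (List α)) : List (Option α) := cl.flatMap (fun c => c.map some ++ [none])

def litAt (T : List (Option α)) (i : ℕ) : Option α := T[i]?.join

/-- Two positions belong to the same clause; they are equal iff it is a unit clause. -/
def Linked (T : List (Option α)) (i j : ℕ) : Prop :=
  litAt T i ≠ none ∧ litAt T j ≠ none ∧
    (j = i + 1 ∨ i = j + 1 ∨ (i = j ∧ litAt T (i + 1) = none ∧ (i = 0 ∨ litAt T (i - 1) = none)))

theorem Linked.symm {T : List (Option α)} {i j : ℕ} (h : Linked T i j) : Linked T j i := by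
  obtain ⟨h1, h2, h3 | h3 | ⟨rfl, h3⟩⟩ := h
  · exact ⟨h2, h1, Or.inr (Or.inl h3)⟩
  · exact ⟨h2, h1, Or.inl h3⟩
  · exact ⟨h2, h1, Or.inr (Or.inr ⟨rfl, h3⟩)⟩

variable (c : List α) (cl : List (List α))

theorem clauseTokens_cons :
    clauseTokens (c :: cl) = c.map some ++ none :: clauseTokens cl := by simp [clauseTokens]

theorem litAt_lt_length {T : List (Option α)} {i : ℕ} (h : litAt T i ≠ none) : i < T.length := by
  by_contra hi
  exact h (by simp [litAt, List.getElem?_eq_none (not_lt.1 hi)])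

theorem litAt_cons_lt {i : ℕ} (h : i < c.length) : litAt (clauseTokens (c :: cl)) i = some (c)[i] := by
  rw [clauseTokens_cons, litAt, List.getElem?_append_left (by simpa)]
  simp [h]

theorem litAt_cons_length : litAt (clauseTokens (c :: cl)) c.length = none := by
  rw [clauseTokens_cons, litAt, List.getElem?_append_right (by simp)]
  simp

theorem litAt_cons_add (i : ℕ) :
    litAt (clauseTokens (c :: cl)) (c.length + 1 + i) = litAt (clauseTokens cl) i := by
  rw [clauseTokens_cons, litAt, List.getElem?_append_right (by simp; omega), List.length_map,
    show c.length + 1 + i - c.length = i + 1 by omega]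
  rfl

theorem linked_cons_add (i j : ℕ) :
    Linked (clauseTokens (c :: cl)) (c.length + 1 + i) (c.length + 1 + j) ↔
      Linked (clauseTokens cl) i j := by
  unfold Linked
  rw [litAt_cons_add, litAt_cons_add, add_assoc _ i 1, litAt_cons_add]
  have h1 : (c.length + 1 + i = 0 ∨ litAt (clauseTokens (c :: cl)) (c.length + 1 + i - 1) = none) ↔
      (i = 0 ∨ litAt (clauseTokens cl) (i - 1) = none) := by
    cases i with
    | zero => simp [litAt_cons_length]
    | succ i =>
      rw [show c.length + 1 + (i + 1) - 1 = c.length + 1 + i by omega, litAt_cons_add]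
      simp
  rw [h1]
  refine and_congr_right fun _ => and_congr_right fun _ => or_congr (by omega) (or_congr (by omega)
    (and_congr_left fun _ => by omega))

theorem linked_cons_cases {i j : ℕ} (h : Linked (clauseTokens (c :: cl)) i j) :
    (i < c.length ∧ j < c.length) ∨ ∃ i' j', i = c.length + 1 + i' ∧ j = c.length + 1 + j' ∧
      Linked (clauseTokens cl) i' j' := by
  have hi : i ≠ c.length := by
    rintro rfl
    exact h.1 (litAt_cons_length c cl)
  have hj : j ≠ c.length := by
    rintro rfl
    exact h.2.1 (litAt_cons_length c cl)
  have h3 := h.2.2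
  by_cases h4 : i < c.length
  · left
    omega
  · right
    obtain ⟨i', rfl⟩ := Nat.exists_eq_add_of_le (show c.length + 1 ≤ i by omega)
    obtain ⟨j', rfl⟩ := Nat.exists_eq_add_of_le (show c.length + 1 ≤ j by omega)
    exact ⟨i', j', rfl, rfl, (linked_cons_add c cl i' j').1 h⟩

variable {cl}

/-- Unit clauses fit in because their only position is linked with itself: the disjunction then
reads `R l ∨ R l`. -/
theorem forall_linked_iff (hcl : ∀ c ∈ cl, c.length = 1 ∨ c.length = 2) (R : α → Prop) :
    (∀ i j l l', Linked (clauseTokens cl) i j → litAt (clauseTokens cl) i = some l →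
      litAt (clauseTokens cl) j = some l' → R l ∨ R l') ↔ ∀ c ∈ cl, ∃ l ∈ c, R l := by
  induction cl with
  | nil =>
    simp only [List.not_mem_nil, false_implies, implies_true, iff_true]
    intro i j l l' h
    exact absurd (litAt_lt_length h.1) (by simp [clauseTokens])
  | cons c cl ih =>
    rw [List.forall_mem_cons, ← ih fun c hc => hcl c (by simp [hc])]
    have hc := hcl c (by simp)
    constructor
    · intro h
      refine ⟨?_, fun i j l l' h1 h2 h3 => h _ _ l l' ((linked_cons_add c cl i j).2 h1)
        (by rwa [litAt_cons_add]) (by rwa [litAt_cons_add])⟩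
      rcases hc with hc | hc
      · obtain ⟨a, rfl⟩ := List.length_eq_one_iff.1 hc
        have h0 := litAt_cons_lt [a] cl (i := 0) (by simp)
        have h1 := litAt_cons_length [a] cl
        have := h 0 0 a a ⟨by simp [h0], by simp [h0], Or.inr (Or.inr ⟨rfl, h1, Or.inl rfl⟩)⟩ h0 h0
        exact ⟨a, by simp, by simpa using this⟩
      · obtain ⟨a, b, rfl⟩ := List.length_eq_two.1 hc
        have h0 := litAt_cons_lt [a, b] cl (i := 0) (by simp)
        have h1 := litAt_cons_lt [a, b] cl (i := 1) (by simp)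
        rcases h 0 1 a b ⟨by simp [h0], by simp [h1], Or.inl rfl⟩ h0 h1 with h2 | h2
        · exact ⟨a, by simp, h2⟩
        · exact ⟨b, by simp, h2⟩
    · rintro ⟨⟨a, ha, hR⟩, h⟩ i j l l' h1 h2 h3
      rcases linked_cons_cases c cl h1 with ⟨hi, hj⟩ | ⟨i', j', rfl, rfl, h4⟩
      · rw [litAt_cons_lt c cl hi, Option.some_inj] at h2
        rw [litAt_cons_lt c cl hj, Option.some_inj] at h3
        subst h2 h3
        rcases hc with hc | hc
        · obtain ⟨b, rfl⟩ := List.length_eq_one_iff.1 hc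
          simp at ha
          subst ha
          exact Or.inl (by simpa using hR)
        · obtain ⟨b, d, rfl⟩ := List.length_eq_two.1 hc
          have g0 := litAt_cons_lt [b, d] cl (i := 0) (by simp)
          have g1 := litAt_cons_lt [b, d] cl (i := 1) (by simp)
          simp only [List.length_cons, List.length_nil] at hi hj
          have h5 := h1.2.2
          interval_cases i <;> interval_cases j
          · simp [g1] at h5
          · simp at ha ⊢; rcases ha with rfl | rfl <;> tauto
          · simp at ha ⊢; rcases ha with rfl | rfl <;> tauto
          · simp [g0] at h5
      · rw [litAt_cons_add] at h2 h3
        exact h _ _ _ _ h4 h2 h3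

theorem not_three_lits (hcl : ∀ c ∈ cl, c.length = 1 ∨ c.length = 2) (i : ℕ) :
    litAt (clauseTokens cl) i = none ∨ litAt (clauseTokens cl) (i + 1) = none ∨
      litAt (clauseTokens cl) (i + 2) = none := by
  induction cl generalizing i with
  | nil => left; simp [clauseTokens, litAt]
  | cons c cl ih =>
    have hc := hcl c (by simp)
    have h0 := litAt_cons_length c cl
    rcases lt_or_ge c.length i with h | h
    · obtain ⟨k, rfl⟩ := Nat.exists_eq_add_of_le (Nat.succ_le_of_lt h)
      rw [Nat.succ_eq_add_one, add_assoc _ k 1, add_assoc _ k 2, litAt_cons_add, litAt_cons_add,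
        litAt_cons_add]
      exact ih (fun c hc => hcl c (by simp [hc])) k
    · have : c.length = i ∨ c.length = i + 1 ∨ c.length = i + 2 := by omega
      rcases this with e | e | e <;> rw [e] at h0 <;> tauto

/-- A literal with neighbours on both sides would be the middle one of three consecutive literals,
which clauses of length at most two exclude; a position linked with itself has no neighbour. So each
occurrence yields at most one partner, which is the core of the degree bound. -/
theorem Linked.right_unique (hcl : ∀ c ∈ cl, c.length = 1 ∨ c.length = 2) {i j k : ℕ}
    (hj : Linked (clauseTokens cl) i j) (hk : Linked (clauseTokens cl) i k) : j = k := by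
  obtain ⟨h1, h2, h3⟩ := hj
  obtain ⟨-, g2, g3⟩ := hk
  rcases h3 with rfl | rfl | ⟨rfl, h4, h5⟩ <;> rcases g3 with rfl | g3 | ⟨g3, g4, g5⟩
  · rfl
  · subst g3
    rcases not_three_lits hcl k with h | h | h <;> contradiction
  · exact absurd g4 h2
  · rcases not_three_lits hcl j with h | h | h <;> contradiction
  · omega
  · rcases g5 with g5 | g5
    · omega
    · exact absurd g5 h2
  · exact absurd h4 g2
  · subst g3
    rcases h5 with h5 | h5
    · omega
    · exact absurd h5 g2
  · exact g3

theorem card_lits_eq (p : α → Prop) [DecidablePred p] :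
    ((Finset.range (clauseTokens cl).length).filter
      (fun i => ∃ l, litAt (clauseTokens cl) i = some l ∧ p l)).card =
    cl.flatten.countP (fun l => p l) := by
  classical
  have h1 : ((Finset.range (clauseTokens cl).length).filter
      (fun i => ∃ l, litAt (clauseTokens cl) i = some l ∧ p l)).card =
      (Finset.univ.filter (fun i : Fin (clauseTokens cl).length =>
        ∃ l, (clauseTokens cl)[i] = some l ∧ p l)).card := by
    symm
    refine Finset.card_bij (fun i _ => (i : ℕ)) ?_ ?_ ?_
    · intro i hi
      have e : (clauseTokens cl)[(i : ℕ)]? = some (clauseTokens cl)[i] :=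
        List.getElem?_eq_getElem i.2
      simp only [Finset.mem_filter, Finset.mem_univ, true_and] at hi
      refine Finset.mem_filter.2 ⟨Finset.mem_range.2 i.2, ?_⟩
      show ∃ l, ((clauseTokens cl)[(i : ℕ)]?).join = some l ∧ p l
      rw [e]
      exact hi
    · intro i _ j _ h
      exact Fin.ext h
    · intro i hi
      simp only [Finset.mem_filter, Finset.mem_range] at hi
      exact ⟨⟨i, hi.1⟩, by simpa [litAt, hi.1] using hi.2, rfl⟩
  rw [h1, List.card_filter_get (clauseTokens cl) (fun o => ∃ l, o = some l ∧ p l)]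
  clear h1
  induction cl with
  | nil => rfl
  | cons c cl ih =>
    rw [clauseTokens_cons, List.countP_append, List.countP_cons, ih, List.flatten_cons,
      List.countP_append, List.countP_map]
    simp [Function.comp_def]

end Tokens

/-! ## From satisfiability to connectivity -/

namespace ThreeDSTCON

open Classical in
/-- The graph on `0, …, n - 1` with adjacency `A`. -/
noncomputable def ofRel (n : ℕ) (A : ℕ → ℕ → Prop) (s t : ℕ) (hs : s < n) (ht : t < n)
    (hA : ∀ v : Fin n, (Finset.univ.filter (fun u : Fin n => A u v)).card +
      (Finset.univ.filter (fun u : Fin n => A v u)).card ≤ 3) : ThreeDSTCON where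
  n := n
  E := Finset.univ.filter (fun e => A e.1 e.2)
  s := ⟨s, hs⟩
  t := ⟨t, ht⟩
  degree_le v := by
    refine le_trans (add_le_add ?_ ?_) (hA v)
    · refine Finset.card_le_card_of_injOn Prod.fst ?_ ?_
      · rintro ⟨a, b⟩ h
        simp only [Finset.coe_filter, Finset.mem_filter, Finset.mem_univ, true_and,
          Set.mem_ofPred_eq] at h ⊢
        exact h.2 ▸ h.1
      · rintro ⟨a, b⟩ h ⟨a', b'⟩ h' e
        simp only [Finset.coe_filter, Set.mem_ofPred_eq] at h h'
        exact Prod.ext e (h.2.trans h'.2.symm)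
    · refine Finset.card_le_card_of_injOn Prod.snd ?_ ?_
      · rintro ⟨a, b⟩ h
        simp only [Finset.coe_filter, Finset.mem_filter, Finset.mem_univ, true_and,
          Set.mem_ofPred_eq] at h ⊢
        exact h.2 ▸ h.1
      · rintro ⟨a, b⟩ h ⟨a', b'⟩ h' e
        simp only [Finset.coe_filter, Set.mem_ofPred_eq] at h h'
        exact Prod.ext (h.2.trans h'.2.symm) e

variable {n : ℕ} {A : ℕ → ℕ → Prop} {s t : ℕ} {hs : s < n} {ht : t < n}
  {hA : ∀ v : Fin n, (@Finset.filter _ (fun u : Fin n => A u v) (Classical.decPred _)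
    Finset.univ).card + (@Finset.filter _ (fun u : Fin n => A v u) (Classical.decPred _)
    Finset.univ).card ≤ 3}

open Classical in
theorem encode_ofRel : (ofRel n A s t hs ht hA).encode =
    (List.range n).flatMap (fun u => (List.range n).flatMap (fun v =>
      if A u v then [InSym.bit true] else [InSym.bit false]) ++ [InSym.sep]) ++
    ((Nat.bits s).map InSym.bit ++ [InSym.sep] ++
      ((Nat.bits t).map InSym.bit ++ [InSym.sep])) := by
  have h1 : (List.ofFn fun u : Fin n => List.ofFn fun v : Fin n => decide (A u v)) =
      (List.range n).map (fun u => (List.range n).map (fun v => decide (A u v))) := by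
    refine List.ext_getElem (by simp) fun i _ _ => ?_
    simp only [List.getElem_ofFn, List.getElem_map, List.getElem_range]
    exact List.ext_getElem (by simp) fun j _ _ => by simp
  have h2 : (ofRel n A s t hs ht hA).encode = encodeWords ((List.ofFn fun u : Fin n =>
      List.ofFn fun v : Fin n => decide (A u v)) ++ [Nat.bits s, Nat.bits t]) := by
    unfold encode ofRel
    simp
  rw [h2, h1, encodeWords_append]
  congr 1
  · unfold encodeWords
    rw [List.map_map, List.flatMap_map]
    refine List.flatMap_congr fun u _ => ?_
    simp only [Function.comp_apply, List.map_map, List.append_cancel_right_eq]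
    generalize List.range n = L
    induction L with
    | nil => rfl
    | cons a L ih =>
      rw [List.map_cons, List.flatMap_cons, ih]
      by_cases h : A u a <;> simp [h]
  · simp [encodeWords]

open Classical in
theorem mem_ofRel (e : Fin n × Fin n) : e ∈ (ofRel n A s t hs ht hA).E ↔ A e.1 e.2 := by
  show e ∈ Finset.univ.filter (fun e : Fin n × Fin n => A e.1 e.2) ↔ _
  simp

theorem connected_ofRel (hlt : ∀ u v, A u v → u < n ∧ v < n) :
    (ofRel n A s t hs ht hA).Connected ↔ Relation.ReflTransGen A s t := by
  rw [connected_iff]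
  have : (ofRel n A s t hs ht hA).Adj = A := by
    funext u v
    refine propext ⟨?_, fun h => ⟨(⟨u, (hlt u v h).1⟩, ⟨v, (hlt u v h).2⟩), ?_, rfl, rfl⟩⟩
    · rintro ⟨e, he, rfl, rfl⟩
      exact (mem_ofRel e).1 he
    · exact (mem_ofRel (n := n) (⟨u, _⟩, ⟨v, _⟩)).2 h
  rw [this]
  rfl

end ThreeDSTCON

/-! ### The implication graph of a formula -/

namespace TwoSATThree

variable (φ : TwoSATThree)

def tokens : List (Option (ℕ × Bool)) := clauseTokens φ.clauses

def lit (i : ℕ) : Option (ℕ × Bool) := litAt φ.tokens i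

theorem lt_of_lit {i : ℕ} {l : ℕ × Bool} (h : φ.lit i = some l) : i < φ.tokens.length :=
  litAt_lt_length (by rw [show litAt φ.tokens i = some l from h]; simp)

/-- The first position of a variable. -/
noncomputable def varIndex (v : ℕ) : ℕ :=
  leastBelow φ.tokens.length (fun j => ∃ l, φ.lit j = some l ∧ l.1 = v)

theorem varIndex_spec {i : ℕ} {l : ℕ × Bool} (h : φ.lit i = some l) :
    ∃ b, φ.lit (φ.varIndex l.1) = some (l.1, b) := by
  obtain ⟨-, ⟨l', h1, h2⟩, -⟩ := leastBelow_spec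
    (n := φ.tokens.length) (P := fun j => ∃ l', φ.lit j = some l' ∧ l'.1 = l.1)
    ⟨i, φ.lt_of_lit h, l, h, rfl⟩
  exact ⟨l'.2, by rw [show (l.1, l'.2) = l' from Prod.ext h2.symm rfl]; exact h1⟩

/-- The vertex of the implication graph that represents a literal. -/
noncomputable def code (l : ℕ × Bool) : ℕ := 2 * φ.varIndex l.1 + ind (l.2 = true)

/-- The variables must occur in the formula: the first position of an absent variable is the default
`φ.tokens.length`, which all absent variables share. Variables are named by positions since the
numbers themselves may be exponentially large. -/
theorem code_inj {i j : ℕ} {l l' m m' : ℕ × Bool} (hi : φ.lit i = some m) (hj : φ.lit j = some m')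
    (hm : m.1 = l.1) (hm' : m'.1 = l'.1) (h : φ.code l = φ.code l') : l = l' := by
  have h1 : ∀ p : Prop, ind p < 2 := fun p => by
    by_cases hp : p <;> simp [hp]
  have h2 := h1 (l.2 = true)
  have h3 := h1 (l'.2 = true)
  unfold code at h
  obtain ⟨b, hb⟩ := φ.varIndex_spec hi
  obtain ⟨b', hb'⟩ := φ.varIndex_spec hj
  rw [hm] at hb
  rw [hm'] at hb'
  have h4 : φ.varIndex l.1 = φ.varIndex l'.1 := by omega
  rw [h4, hb', Option.some_inj, Prod.mk.injEq] at hb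
  refine Prod.ext hb.1.symm ?_
  have h5 : ind (l.2 = true) = ind (l'.2 = true) := by omega
  cases h6 : l.2 <;> cases h7 : l'.2 <;> simp_all

/-- The edges of the implication graph. -/
def Arc (u w : ℕ) : Prop := ∃ i < φ.tokens.length, ∃ j < φ.tokens.length,
  Linked φ.tokens i j ∧ (∃ l, φ.lit i = some l ∧ u = φ.code (negLit l)) ∧
    ∃ l, φ.lit j = some l ∧ w = φ.code l

/-- The clauses as a relation. -/
def Clause (l l' : ℕ × Bool) : Prop :=
  ∃ i j, Linked φ.tokens i j ∧ φ.lit i = some l ∧ φ.lit j = some l'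

theorem clause_symm (l l' : ℕ × Bool) (h : φ.Clause l l') : φ.Clause l' l := by
  obtain ⟨i, j, h1, h2, h3⟩ := h
  exact ⟨j, i, h1.symm, h3, h2⟩

theorem arc_iff {u w : ℕ} : φ.Arc u w ↔
    ∃ l l', Implies φ.Clause l l' ∧ u = φ.code l ∧ w = φ.code l' := by
  constructor
  · rintro ⟨i, -, j, -, h, ⟨l, hl, rfl⟩, l', hl', rfl⟩
    exact ⟨negLit l, l', ⟨i, j, h, by rw [negLit_negLit]; exact hl, hl'⟩, rfl, rfl⟩
  · rintro ⟨l, l', ⟨i, j, h, hl, hl'⟩, rfl, rfl⟩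
    exact ⟨i, φ.lt_of_lit hl, j, φ.lt_of_lit hl', h, ⟨_, hl, by rw [negLit_negLit]⟩, _, hl', rfl⟩

theorem satisfiable_iff : φ.Satisfiable ↔
    ∀ v, ¬ (Relation.ReflTransGen (Implies φ.Clause) (v, false) (v, true) ∧
      Relation.ReflTransGen (Implies φ.Clause) (v, true) (v, false)) := by
  rw [← exists_assignment_iff φ.clause_symm]
  refine exists_congr fun τ => ?_
  rw [← forall_linked_iff φ.clause_length (fun l => τ l.1 = l.2)]
  constructor
  · rintro h l l' ⟨i, j, h1, h2, h3⟩
    exact h i j l l' h1 h2 h3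
  · exact fun h i j l l' h1 h2 h3 => h l l' ⟨i, j, h1, h2, h3⟩

/-- Arcs join numbers and implications join literals, so a path is lifted literal by literal. Each
step identifies two literals with equal code; this is the reason for carrying along an occurrence of
the current variable. -/
theorem path_of_arcs {l : ℕ × Bool} {i : ℕ} {m : ℕ × Bool} (hi : φ.lit i = some m) (hm : m.1 = l.1)
    {w : ℕ} (h : Relation.ReflTransGen φ.Arc (φ.code l) w) :
    ∃ l', w = φ.code l' ∧ Relation.ReflTransGen (Implies φ.Clause) l l' ∧
      ∃ j m', φ.lit j = some m' ∧ m'.1 = l'.1 := by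
  induction h with
  | refl => exact ⟨l, rfl, .refl, i, m, hi, hm⟩
  | tail _ h ih =>
    obtain ⟨l', rfl, h1, j, m', hj, hm'⟩ := ih
    obtain ⟨a, b, hab, h2, rfl⟩ := φ.arc_iff.1 h
    obtain ⟨i', j', h3, h4, h5⟩ := hab
    obtain rfl := φ.code_inj (l' := a) hj h4 hm' rfl h2
    exact ⟨b, rfl, h1.tail ⟨i', j', h3, h4, h5⟩, j', b, h5, rfl⟩

theorem exists_lit_of_path {l l' : ℕ × Bool} (h : Relation.ReflTransGen (Implies φ.Clause) l l')
    (hne : l ≠ l') : ∃ i m, φ.lit i = some m ∧ m.1 = l.1 := by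
  rcases h.cases_head with h | ⟨c, ⟨i, j, -, h2, -⟩, -⟩
  · exact absurd h hne
  · exact ⟨i, _, h2, rfl⟩

/-- Unsatisfiability is witnessed by two paths. -/
theorem satisfiable_iff_arcs : φ.Satisfiable ↔ ¬ ∃ k < φ.tokens.length,
    Relation.ReflTransGen φ.Arc (2 * k) (2 * k + 1) ∧
    Relation.ReflTransGen φ.Arc (2 * k + 1) (2 * k) := by
  rw [satisfiable_iff, ← not_exists, not_iff_not]
  have hlift : ∀ {l l'}, Relation.ReflTransGen (Implies φ.Clause) l l' →
      Relation.ReflTransGen φ.Arc (φ.code l) (φ.code l') := fun {l l'} h =>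
    Relation.ReflTransGen.lift φ.code (fun a b hab => φ.arc_iff.2 ⟨a, b, hab, rfl, rfl⟩) _ _ h
  have hc : ∀ v, φ.code (v, false) = 2 * φ.varIndex v ∧ φ.code (v, true) = 2 * φ.varIndex v + 1 := by
    intro v
    simp [code]
  constructor
  · rintro ⟨v, h1, h2⟩
    obtain ⟨i, m, hi, hm⟩ := φ.exists_lit_of_path h1 (by simp)
    obtain ⟨b, hb⟩ := φ.varIndex_spec hi
    obtain rfl : m.1 = v := hm
    refine ⟨φ.varIndex m.1, φ.lt_of_lit hb, ?_⟩
    rw [← (hc m.1).2, ← (hc m.1).1]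
    exact ⟨hlift h1, hlift h2⟩
  · rintro ⟨k, hk, h1, h2⟩
    -- The two vertices differ, so there is a first arc; it shows that `k` is the index of a
    -- variable that occurs, although `k` was an arbitrary position.
    rcases h1.cases_head with h | ⟨w, hw, -⟩
    · omega
    obtain ⟨l, l', ⟨i, j, -, hi, -⟩, hl, -⟩ := φ.arc_iff.1 hw
    have hl2 : l = (l.1, false) := by
      refine Prod.ext rfl ?_
      cases hb : l.2
      · rfl
      · exfalso
        simp only [code, hb, ind_true] at hl
        omega
    have e1 : 2 * k = φ.code (l.1, false) := by rw [hl, ← hl2]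
    have e2 : 2 * k + 1 = φ.code (l.1, true) := by
      rw [(hc _).1] at e1
      rw [(hc _).2, e1]
    rw [e2, e1] at h1 h2
    refine ⟨l.1, ?_, ?_⟩
    · obtain ⟨l1, g1, g2, j', m', g3, g4⟩ := φ.path_of_arcs (l := (l.1, false)) hi rfl h1
      obtain rfl := φ.code_inj (l := (l.1, true)) hi g3 rfl g4 g1
      exact g2
    · obtain ⟨l1, g1, g2, j', m', g3, g4⟩ := φ.path_of_arcs (l := (l.1, true)) hi rfl h2
      obtain rfl := φ.code_inj (l := (l.1, false)) hi g3 rfl g4 g1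
      exact g2

theorem code_lt {i : ℕ} {l m : ℕ × Bool} (hi : φ.lit i = some m) (hm : m.1 = l.1) :
    φ.code l < 2 * φ.tokens.length := by
  obtain ⟨b, hb⟩ := φ.varIndex_spec hi
  rw [hm] at hb
  have := φ.lt_of_lit hb
  unfold code
  by_cases h : l.2 = true
  · rw [ind_of h]; omega
  · rw [ind_of_not h]; omega

theorem arc_lt {u w : ℕ} (h : φ.Arc u w) :
    u < 2 * φ.tokens.length + 2 ∧ w < 2 * φ.tokens.length + 2 := by
  obtain ⟨i, -, j, -, -, ⟨l, hl, rfl⟩, l', hl', rfl⟩ := h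
  have h1 := φ.code_lt (l := negLit l) hl rfl
  have h2 := φ.code_lt hl' rfl
  omega

-- An arc into the literal `v` is given by an occurrence of `v` in a clause, an arc out of it by an
-- occurrence of its negation; the partner in the clause is unique and determines the other end.
-- Both kinds together are distinct occurrences of one variable, so there are at most three.
open Classical in
theorem arc_degree_le (n v : ℕ) : (Finset.univ.filter (fun u : Fin n => φ.Arc u v)).card +
      (Finset.univ.filter (fun u : Fin n => φ.Arc v u)).card ≤ 3 := by
  set O₁ := (Finset.range φ.tokens.length).filter (fun i => ∃ l, φ.lit i = some l ∧ v = φ.code l)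
  set O₂ := (Finset.range φ.tokens.length).filter
    (fun i => ∃ l, φ.lit i = some l ∧ v = φ.code (negLit l))
  have h1 : (Finset.univ.filter (fun u : Fin n => φ.Arc u v)).card ≤ O₁.card := by
    have hex : ∀ u : Fin n, ∃ j, φ.Arc u v → j ∈ O₁ ∧ ∃ i, Linked φ.tokens i j ∧
        ∃ l, φ.lit i = some l ∧ (u : ℕ) = φ.code (negLit l) := by
      intro u
      by_cases h : φ.Arc u v
      · obtain ⟨i, hi, j, hj, h1, h2, h3⟩ := h
        exact ⟨j, fun _ => ⟨Finset.mem_filter.2 ⟨Finset.mem_range.2 hj, h3⟩, i, h1, h2⟩⟩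
      · exact ⟨0, fun h' => absurd h' h⟩
    choose f hf using hex
    refine Finset.card_le_card_of_injOn f (fun u hu => (hf u (Finset.mem_filter.1 hu).2).1) ?_
    intro u hu u' hu' he
    obtain ⟨-, i, g1, l, g2, g3⟩ := hf u (Finset.mem_filter.1 hu).2
    obtain ⟨-, i', g1', l', g2', g3'⟩ := hf u' (Finset.mem_filter.1 hu').2
    rw [he] at g1
    obtain rfl := Linked.right_unique φ.clause_length g1.symm g1'.symm
    rw [g2, Option.some_inj] at g2'
    exact Fin.ext (by rw [g3, g3', g2'])
  have h2 : (Finset.univ.filter (fun u : Fin n => φ.Arc v u)).card ≤ O₂.card := by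
    have hex : ∀ u : Fin n, ∃ i, φ.Arc v u → i ∈ O₂ ∧ ∃ j, Linked φ.tokens i j ∧
        ∃ l, φ.lit j = some l ∧ (u : ℕ) = φ.code l := by
      intro u
      by_cases h : φ.Arc v u
      · obtain ⟨i, hi, j, hj, h1, h2, h3⟩ := h
        exact ⟨i, fun _ => ⟨Finset.mem_filter.2 ⟨Finset.mem_range.2 hi, h2⟩, j, h1, h3⟩⟩
      · exact ⟨0, fun h' => absurd h' h⟩
    choose f hf using hex
    refine Finset.card_le_card_of_injOn f (fun u hu => (hf u (Finset.mem_filter.1 hu).2).1) ?_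
    intro u hu u' hu' he
    obtain ⟨-, i, g1, l, g2, g3⟩ := hf u (Finset.mem_filter.1 hu).2
    obtain ⟨-, i', g1', l', g2', g3'⟩ := hf u' (Finset.mem_filter.1 hu').2
    rw [he] at g1
    obtain rfl := Linked.right_unique φ.clause_length g1 g1'
    rw [g2, Option.some_inj] at g2'
    exact Fin.ext (by rw [g3, g3', g2'])
  have hdisj : Disjoint O₁ O₂ := by
    rw [Finset.disjoint_left]
    intro i hi hi'
    obtain ⟨-, l, g1, g2⟩ := Finset.mem_filter.1 hi
    obtain ⟨-, l', g1', g2'⟩ := Finset.mem_filter.1 hi'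
    rw [g1, Option.some_inj] at g1'
    subst g1'
    have := φ.code_inj (l := l) (l' := negLit l) g1 g1 rfl rfl (g2.symm.trans g2')
    have h3 := congrArg Prod.snd this
    simp [negLit] at h3
  refine (add_le_add h1 h2).trans ?_
  rw [← Finset.card_union_of_disjoint hdisj]
  by_cases hne : ∃ i ∈ O₁ ∪ O₂, True
  swap
  · rw [Finset.card_eq_zero.2]
    · omega
    · refine Finset.eq_empty_of_forall_notMem fun i hi => hne ⟨i, hi, trivial⟩
  have hcode : ∀ i ∈ O₁ ∪ O₂, ∃ m l, φ.lit i = some m ∧ m.1 = l.1 ∧ v = φ.code l := by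
    intro i hi
    rcases Finset.mem_union.1 hi with hi | hi
    · obtain ⟨-, l, g1, g2⟩ := Finset.mem_filter.1 hi
      exact ⟨l, l, g1, rfl, g2⟩
    · obtain ⟨-, l, g1, g2⟩ := Finset.mem_filter.1 hi
      exact ⟨l, negLit l, g1, rfl, g2⟩
  obtain ⟨i₀, hi₀, -⟩ := hne
  obtain ⟨m₀, l₀, g1, g2, g3⟩ := hcode i₀ hi₀
  refine le_trans ?_ ((card_lits_eq (cl := φ.clauses) (fun l => l.1 = m₀.1)).trans_le
    (φ.occurrences m₀.1))
  refine Finset.card_le_card fun i hi => ?_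
  obtain ⟨m, l, e1, e2, e3⟩ := hcode i hi
  have := φ.code_inj e1 g1 e2 g2 (e3.symm.trans g3)
  exact Finset.mem_filter.2 ⟨Finset.mem_range.2 (φ.lt_of_lit e1), m, e1, by rw [e2, this, ← g2]⟩

/-- The implication graph, with the vertices `2 * k` and `2 * k + 1`. -/
noncomputable def toGraph (k d : ℕ) : ThreeDSTCON :=
  ThreeDSTCON.ofRel (2 * φ.tokens.length + 2) φ.Arc
    -- The double subtraction is the minimum of `k` and the number of tokens, so a graph is defined
    -- for every `k`. The two vertices beyond the literals are needed when this minimum is the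
    -- number of tokens itself.
    (2 * (k - (k - φ.tokens.length)) + ind (d ≠ 0)) (2 * (k - (k - φ.tokens.length)) + ind (d = 0))
    (by by_cases h : d = 0 <;> simp [h] <;> omega) (by by_cases h : d = 0 <;> simp [h] <;> omega)
    (fun v => φ.arc_degree_le _ v)

theorem toGraph_connected {k : ℕ} (hk : k < φ.tokens.length) :
    ((φ.toGraph k 0).Connected ↔ Relation.ReflTransGen φ.Arc (2 * k) (2 * k + 1)) ∧
    ((φ.toGraph k 1).Connected ↔ Relation.ReflTransGen φ.Arc (2 * k + 1) (2 * k)) := by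
  unfold toGraph
  rw [ThreeDSTCON.connected_ofRel fun u w h => φ.arc_lt h,
    ThreeDSTCON.connected_ofRel fun u w h => φ.arc_lt h]
  have : k - (k - φ.tokens.length) = k := by omega
  simp [this]

theorem length_flatten_le : φ.clauses.flatten.length ≤ 3 * φ.numVars := by
  unfold numVars
  set L := φ.clauses.flatten.map Prod.fst with hL
  have h1 : φ.clauses.flatten.length = ∑ v ∈ L.toFinset, L.count v := by
    rw [List.sum_toFinset_count_eq_length, hL, List.length_map]
  rw [h1, mul_comm]
  refine Finset.sum_le_card_nsmul _ _ _ fun v _ => ?_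
  rw [hL, List.count, List.countP_map]
  exact (List.countP_congr (by simp)).trans_le (φ.occurrences v)

/-- Each clause contains a literal, so there are at most as many terminators as literals, and there
are at most three literals per variable. -/
theorem length_tokens_le : φ.tokens.length ≤ 6 * φ.numVars := by
  have h1 := φ.length_flatten_le
  have h2 : ∀ cl : List (List (ℕ × Bool)), (∀ c ∈ cl, c.length = 1 ∨ c.length = 2) →
      (clauseTokens cl).length ≤ 2 * cl.flatten.length := by
    intro cl hcl
    induction cl with
    | nil => simp [clauseTokens]
    | cons c cl ih =>
      have h3 := ih fun c hc => hcl c (by simp [hc])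
      have h4 := hcl c (by simp)
      rw [clauseTokens_cons]
      simp only [List.length_append, List.length_map, List.length_cons, List.flatten_cons]
      omega
  have h3 := h2 φ.clauses φ.clause_length
  unfold tokens
  omega

/-! ### The graph in logarithmic space -/

def words : List (List Bool) := φ.tokens.map (fun o => o.elim [] literalWord)

theorem encode_eq : φ.encode = encodeWords φ.words := by
  unfold encode words tokens clauseTokens tableWords
  rw [List.map_flatMap, List.flatMap_map]
  congr 1
  refine List.flatMap_congr fun c _ => ?_
  simp

theorem wordAt_words (i : ℕ) : wordAt φ.words i = (φ.lit i).elim [] literalWord := by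
  unfold wordAt words lit litAt
  rw [List.getD_eq_getElem?_getD, List.getElem?_map]
  rcases φ.tokens[i]? with _ | (_ | l) <;> rfl

variable {H : TwoSATThree → Scope B} {F K : TwoSATThree → γ → ℕ}

theorem ls_length : LS B encode H (fun φ (_ : γ) => φ.tokens.length) :=
  (LS.wordCount encode_eq).congr fun φ _ => by simp [words]

/-- The word of a literal contains at least its sign, so empty words are exactly the terminators and
the default beyond the end. -/
theorem lsp_isLit (hF : LS B encode H F) : LSP B encode H (fun φ g => φ.lit (F φ g) ≠ none) :=
  (LSP.eq (LSW.word encode_eq hF).length (LS.const 0)).not.congr fun φ g => by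
    rw [wordAt_words]
    cases φ.lit (F φ g) <;> simp [literalWord]

theorem lsp_sameVar (hF : LS B encode H F) (hK : LS B encode H K) : LSP B encode H
    (fun φ g => ∃ l l', φ.lit (F φ g) = some l ∧ φ.lit (K φ g) = some l' ∧ l.1 = l'.1) := by
  refine ((lsp_isLit hF).and ((lsp_isLit hK).and (LSW.eq (LSW.word encode_eq hF).tail
    (LSW.word encode_eq hK).tail))).congr fun φ g => ?_
  rw [wordAt_words, wordAt_words]
  rcases φ.lit (F φ g) with _ | l <;> rcases φ.lit (K φ g) with _ | l' <;>
    simp [literalWord, natBits_injective.eq_iff]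

theorem lsp_sign (hF : LS B encode H F) :
    LSP B encode H (fun φ g => ∃ l, φ.lit (F φ g) = some l ∧ l.2 = true) :=
  ((LSW.word encode_eq hF).bit_at (LS.const 0)).congr fun φ g => by
    rw [wordAt_words]
    rcases φ.lit (F φ g) with _ | l <;> simp [literalWord]

/-- The vertex of the literal at a position, or of its negation. -/
noncomputable def vertexAt (s : Prop) (i : ℕ) : ℕ :=
  2 * leastBelow φ.tokens.length
    (fun j => ∃ l l', φ.lit j = some l ∧ φ.lit i = some l' ∧ l.1 = l'.1) +
  ind ((∃ l, φ.lit i = some l ∧ l.2 = true) ↔ s)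

theorem vertexAt_of_lit {i : ℕ} {l : ℕ × Bool} (h : φ.lit i = some l) :
    φ.vertexAt True i = φ.code l ∧ φ.vertexAt False i = φ.code (negLit l) := by
  unfold vertexAt code varIndex negLit
  simp [h]

theorem ls_vertexAt {s : Prop} (hF : LS B encode H F) :
    LS B encode H (fun φ g => φ.vertexAt s (F φ g)) := by
  have hs : LSP B encode H (fun _ (_ : γ) => s) := LS.const (ind s)
  have hv : LS B encode H (fun φ g => leastBelow φ.tokens.length (fun j => ∃ l l',
      φ.lit j = some l ∧ φ.lit (F φ g) = some l' ∧ l.1 = l'.1)) :=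
    LS.least (P := fun φ g j => ∃ l l', φ.lit j = some l ∧ φ.lit (F φ g) = some l' ∧ l.1 = l'.1)
      ls_length (lsp_sameVar LS.last hF.weaken)
  exact ((LS.const 2).mul hv).add (LSP.iff (lsp_sign hF) hs)

theorem lsp_linked (hF : LS B encode H F) (hK : LS B encode H K) :
    LSP B encode H (fun φ g => Linked φ.tokens (F φ g) (K φ g)) :=
  ((lsp_isLit hF).and ((lsp_isLit hK).and ((LSP.eq hK hF.succ).or ((LSP.eq hF hK.succ).or
    ((LSP.eq hF hK).and ((lsp_isLit hF.succ).not.and ((LSP.eq hF (LS.const 0)).or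
      (lsp_isLit hF.pred).not))))))).congr fun φ g => by
  simp only [not_not]
  exact Iff.rfl

theorem lsp_arc (hF : LS B encode H F) (hK : LS B encode H K) :
    LSP B encode H (fun φ g => φ.Arc (F φ g) (K φ g)) := by
  refine (LSP.ex (P := fun φ g i => ∃ j < φ.tokens.length, Linked φ.tokens i j ∧
    F φ g = φ.vertexAt False i ∧ K φ g = φ.vertexAt True j) ls_length
    (LSP.ex (γ := γ × ℕ) (P := fun φ g j => Linked φ.tokens g.2 j ∧
      F φ g.1 = φ.vertexAt False g.2 ∧ K φ g.1 = φ.vertexAt True j) ls_length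
    ((lsp_linked LS.last.weaken LS.last).and ((LSP.eq hF.weaken.weaken
      (ls_vertexAt LS.last.weaken)).and (LSP.eq hK.weaken.weaken
      (ls_vertexAt LS.last)))))).congr fun φ g => ?_
  unfold Arc
  refine exists_congr fun i => and_congr_right fun _ => exists_congr fun j => and_congr_right
    fun _ => and_congr_right fun h => ?_
  obtain ⟨l, hl⟩ := Option.ne_none_iff_exists'.1 h.1
  obtain ⟨l', hl'⟩ := Option.ne_none_iff_exists'.1 h.2.1
  have e1 : φ.lit i = some l := hl
  have e2 : φ.lit j = some l' := hl'
  simp [e1, e2, (φ.vertexAt_of_lit e1).2, (φ.vertexAt_of_lit e2).1]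

theorem lsl_toGraph (hF : LS B encode H F) (hK : LS B encode H K) :
    LSL B encode H (fun φ g => (φ.toGraph (F φ g) (K φ g)).encode) := by
  classical
  have hn : ∀ {γ : Type} [Ctx γ], LS B encode H (fun φ (_ : γ) => 2 * φ.tokens.length + 2) :=
    ((LS.const 2).mul ls_length).add (LS.const 2)
  have hk : LS B encode H (fun φ g => 2 * (F φ g - (F φ g - φ.tokens.length))) :=
    (LS.const 2).mul (hF.sub (hF.sub ls_length))
  have hd : LSP B encode H (fun φ g => K φ g = 0) := LSP.eq hK (LS.const 0)
  refine LSL.congr ?_ fun φ g => ThreeDSTCON.encode_ofRel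
  refine LSL.append (LSL.flatMap (S := fun φ g u => (List.range (2 * φ.tokens.length + 2)).flatMap
    (fun v => if φ.Arc u v then [InSym.bit true] else [InSym.bit false]) ++ [InSym.sep]) hn
    (LSL.append (LSL.flatMap (γ := γ × ℕ) (S := fun φ g v => if φ.Arc g.2 v then [InSym.bit true]
      else [InSym.bit false]) hn (LSL.ite (lsp_arc LS.last.weaken LS.last) (LSL.singleton _)
      (LSL.singleton _))) (LSL.singleton _))) ?_
  exact ((LSL.bits (hk.add hd.not)).append (LSL.singleton _)).append
    ((LSL.bits (hk.add hd)).append (LSL.singleton _))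

end TwoSATThree

/-! ## Arithmetic with large numbers in logarithmic space -/

theorem leastBelow_of_not {n : ℕ} {P : ℕ → Prop} (h : ∀ i < n, ¬ P i) : leastBelow n P = n := by
  unfold leastBelow
  rw [@Finset.filter_true_of_mem _ _ (Classical.decPred _), Finset.card_range]
  exact fun i hi j hj => h j (by have := Finset.mem_range.1 hi; omega)

/-- Numbers that are given by digits, which may exceed the base two. -/
def LSN (B : MultiTapeTM InSym) (str : ι → List InSym) (H : ι → Scope B) (N : ι → γ → ℕ) : Prop :=
  ∃ (p : ι → γ → Polynomial ℕ) (K : ι → γ → ℕ), (∀ x g, N x g = (p x g).eval 2) ∧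
    LS B str H (fun x (g : γ × ℕ) => (p x g.1).coeff g.2) ∧ LS B str H K ∧
    ∀ x g, (p x g).natDegree < K x g

/-- The number with given binary digits, least significant digit first. -/
noncomputable def wordVal (L : List Bool) : ℕ :=
  ∑ i ∈ Finset.range L.length, ind (L[i]? = some true) * 2 ^ i

theorem wordVal_bits (n : ℕ) : wordVal (Nat.bits n) = n := by
  have h : ∀ L : List Bool, wordVal L = Nat.ofDigits 2 (L.map (fun b => cond b 1 0)) := by
    intro L
    induction L with
    | nil => simp [wordVal]
    | cons b L ih =>
      rw [List.map_cons, Nat.ofDigits_cons, ← ih, wordVal, List.length_cons,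
        Finset.sum_range_succ', wordVal, Finset.mul_sum, add_comm]
      congr 1
      · cases b <;> simp
      · refine Finset.sum_congr rfl fun i _ => ?_
        rw [List.getElem?_cons_succ]
        ring
  rw [h, ← Nat.digits_two_eq_bits, Nat.ofDigits_digits]

namespace LSN

variable {N M : ι → γ → ℕ}

theorem zero : LSN B str H (fun _ (_ : γ) => 0) :=
  ⟨fun _ _ => 0, fun _ _ => 1, by simp, LS.zero.congr (by simp), LS.const 1, by simp⟩

theorem one : LSN B str H (fun _ (_ : γ) => 1) :=
  ⟨fun _ _ => 1, fun _ _ => 1, by simp,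
    (LS.ite (LSP.eq LS.last (LS.const 0)) (LS.const 1) (LS.const 0)).congr
      (fun x g => Polynomial.coeff_one), LS.const 1, by simp⟩

theorem add (hN : LSN B str H N) (hM : LSN B str H M) :
    LSN B str H (fun x g => N x g + M x g) := by
  obtain ⟨p, K, h1, h2, h3, h4⟩ := hN
  obtain ⟨p', K', h1', h2', h3', h4'⟩ := hM
  refine ⟨fun x g => p x g + p' x g, fun x g => K x g + K' x g, fun x g => ?_,
    (h2.add h2').congr fun x g => ?_, h3.add h3', fun x g => ?_⟩
  · beta_reduce
    rw [Polynomial.eval_add, h1, h1']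
  · rw [Polynomial.coeff_add]
  · refine (Polynomial.natDegree_add_le _ _).trans_lt ?_
    beta_reduce
    have := h4 x g
    have := h4' x g
    omega

/-- Numbers with polynomially many digits do not fit into counters, but coefficients do. As no
carries are performed, a coefficient of the product is just a convolution of given coefficients,
computed on demand. -/
theorem mul (hN : LSN B str H N) (hM : LSN B str H M) :
    LSN B str H (fun x g => N x g * M x g) := by
  obtain ⟨p, K, h1, h2, h3, h4⟩ := hN
  obtain ⟨p', K', h1', h2', h3', h4'⟩ := hM
  have ha : LS B str H (fun x (g : (γ × ℕ) × ℕ) => (p x g.1.1).coeff g.2) :=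
    LS.mid (F := fun x g i => (p x g).coeff i) h2
  have hb : LS B str H (fun x (g : (γ × ℕ) × ℕ) => (p' x g.1.1).coeff (g.1.2 - g.2)) :=
    LS.bind (γ := (γ × ℕ) × ℕ) (F := fun _ g => g.1.2 - g.2) (G := fun x g i => (p' x g.1.1).coeff i)
      (LS.last.weaken.sub LS.last)
      (LS.mid (γ := γ × ℕ) (F := fun x g i => (p' x g.1).coeff i)
        (LS.mid (F := fun x g i => (p' x g).coeff i) h2'))
  refine ⟨fun x g => p x g * p' x g, fun x g => K x g + K' x g, fun x g => ?_,
    (LS.sum (γ := γ × ℕ) (F := fun _ g => g.2 + 1)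
      (G := fun x g i => (p x g.1).coeff i * (p' x g.1).coeff (g.2 - i))
      LS.last.succ (ha.mul hb)).congr fun x g => ?_, h3.add h3', fun x g => ?_⟩
  · beta_reduce
    rw [Polynomial.eval_mul, h1, h1']
  · rw [Polynomial.coeff_mul, Finset.Nat.sum_antidiagonal_eq_sum_range_succ
      (fun i j => (p x g.1).coeff i * (p' x g.1).coeff j)]
  · refine (Polynomial.natDegree_mul_le).trans_lt ?_
    beta_reduce
    have := h4 x g
    have := h4' x g
    omega

theorem ite {P : ι → γ → Prop} [∀ x g, Decidable (P x g)] (hP : LSP B str H P)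
    (hN : LSN B str H N) (hM : LSN B str H M) :
    LSN B str H (fun x g => if P x g then N x g else M x g) := by
  obtain ⟨p, K, h1, h2, h3, h4⟩ := hN
  obtain ⟨p', K', h1', h2', h3', h4'⟩ := hM
  refine ⟨fun x g => if P x g then p x g else p' x g, fun x g => K x g + K' x g, fun x g => ?_,
    (LS.ite hP.weaken h2 h2').congr fun x g => ?_, h3.add h3', fun x g => ?_⟩
  · beta_reduce
    split_ifs
    · rw [h1]
    · rw [h1']
  · beta_reduce
    split_ifs <;> rfl
  · beta_reduce
    have := h4 x g
    have := h4' x g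
    split_ifs <;> omega

theorem word {L : ι → γ → List Bool} (hL : LSW B str H L) :
    LSN B str H (fun x g => wordVal (L x g)) := by
  refine ⟨fun x g => ∑ i ∈ Finset.range (L x g).length,
    Polynomial.C (ind ((L x g)[i]? = some true)) * Polynomial.X ^ i, fun x g => (L x g).length + 1,
    fun x g => ?_, LS.congr hL.bit fun x g => ?_, hL.length.succ, fun x g => ?_⟩
  · simp [wordVal, Polynomial.eval_finsetSum]
  · simp only [Polynomial.finsetSum_coeff, Polynomial.coeff_C_mul_X_pow, Finset.sum_ite_eq,
      Finset.mem_range]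
    split_ifs with h
    · rfl
    · rw [List.getElem?_eq_none (by omega)]
      simp
  · refine Nat.lt_succ_of_le (Polynomial.natDegree_sum_le_of_forall_le _ _ fun i hi => ?_)
    exact (Polynomial.natDegree_C_mul_X_pow_le _ _).trans (Finset.mem_range.1 hi).le

/-- Comparison of two sums of powers of two with carries. -/
theorem carry_spec (P N : ℕ → ℕ) (O K : ℕ) (hP : ∀ k < K, P k ≤ O) (hN : ∀ k < K, N k ≤ O) :
    ∀ k ≤ K, (Nat.rec O (fun j s => (s + O + P j - N j) / 2) k : ℕ) ≤ 2 * O ∧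
    ∃ r < 2 ^ k, (∑ i ∈ Finset.range k, P i * 2 ^ i : ℤ) - ∑ i ∈ Finset.range k, (N i * 2 ^ i : ℤ) =
      (((Nat.rec O (fun j s => (s + O + P j - N j) / 2) k : ℕ) : ℤ) - O) * 2 ^ k + (r : ℕ) := by
  -- The invariant says that `s - O` is the floor of the partial difference divided by `2 ^ k`. The
  -- offset `O` keeps everything in the natural numbers, and since no coefficient exceeds `O`, the
  -- value `s` never leaves the range up to `2 * O`.
  intro k
  induction k with
  | zero => exact fun _ => ⟨by simp; omega, 0, by simp, by simp⟩
  | succ k ih =>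
    intro hk
    obtain ⟨h1, r, hr, h2⟩ := ih (by omega)
    have h3 := hP k hk
    have h4 := hN k hk
    simp only at h1 h2 ⊢
    set s : ℕ := Nat.rec O (fun j s => (s + O + P j - N j) / 2) k
    -- The bit lost in the halving becomes bit `k` of the remainder.
    refine ⟨by omega, r + 2 ^ k * ((s + O + P k - N k) % 2), ?_, ?_⟩
    · have : (s + O + P k - N k) % 2 ≤ 1 := by omega
      have := Nat.mul_le_mul_left (2 ^ k) this
      rw [pow_succ]
      omega
    · rw [Finset.sum_range_succ, Finset.sum_range_succ]
      have h5 : (s : ℤ) + O + P k - N k = 2 * ((s + O + P k - N k) / 2 : ℕ) +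
          ((s + O + P k - N k) % 2 : ℕ) := by omega
      push_cast at h2 ⊢
      push_cast at h5
      rw [pow_succ]
      linear_combination h2 + (2 ^ k : ℤ) * h5

/-- The difference of the two numbers is the last carry times a power of two plus a remainder that
is nonnegative and smaller than this power. Its sign is therefore decided by the carry, and the
carry is small enough for a counter. -/
theorem le (hN : LSN B str H N) (hM : LSN B str H M) : LSP B str H (fun x g => N x g ≤ M x g) := by
  obtain ⟨p, K, h1, h2, h3, h4⟩ := hN
  obtain ⟨p', K', h1', h2', h3', h4'⟩ := hM
  have hK := h3.add h3'
  have hO : LS B str H (fun x g => ∑ i ∈ Finset.range (K x g + K' x g),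
      ((p x g).coeff i + (p' x g).coeff i)) :=
    LS.sum (G := fun x g i => (p x g).coeff i + (p' x g).coeff i) hK (h2.add h2')
  set O : ι → γ → ℕ := fun x g => ∑ i ∈ Finset.range (K x g + K' x g),
      ((p x g).coeff i + (p' x g).coeff i) with hOdef
  have hle : ∀ x g, ∀ k < K x g + K' x g, (p x g).coeff k + (p' x g).coeff k ≤ O x g :=
    fun x g k hk => Finset.single_le_sum (f := fun i => (p x g).coeff i + (p' x g).coeff i)
      (fun _ _ => Nat.zero_le _) (Finset.mem_range.2 hk)
  have hspec := fun x g => carry_spec (p' x g).coeff (p x g).coeff (O x g) (K x g + K' x g)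
    (fun k hk => (Nat.le_add_left _ _).trans (hle x g k hk))
    (fun k hk => (Nat.le_add_right _ _).trans (hle x g k hk))
  have hiter : LS B str H (fun x g => Nat.rec (O x g)
      (fun j s => (s + O x g + (p' x g).coeff j - (p x g).coeff j) / 2) (K x g + K' x g)) := by
    refine LS.iterate (S := fun x g s j => (s + O x g + (p' x g).coeff j - (p x g).coeff j) / 2)
      hK hO (LS.div ((((LS.last.weaken).add hO.weaken.weaken).add ?_).sub ?_) (LS.const 2)) ?_
    · exact LS.mid (F := fun x g i => (p' x g).coeff i) h2'
    · exact LS.mid (F := fun x g i => (p x g).coeff i) h2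
    · refine ((PB.const 2).mul hO.pb).weaken.mono fun x g => ?_
      split_ifs with h
      · exact (hspec x g.1 g.2 h).1
      · exact Nat.zero_le _
  refine (LSP.le hO hiter).congr fun x g => ?_
  obtain ⟨-, r, hr, h5⟩ := hspec x g _ le_rfl
  have e1 : (N x g : ℤ) = ∑ i ∈ Finset.range (K x g + K' x g), ((p x g).coeff i * 2 ^ i : ℤ) := by
    rw [h1, Polynomial.eval_eq_sum_range' ((h4 x g).trans_le (Nat.le_add_right _ _))]
    push_cast
    rfl
  have e2 : (M x g : ℤ) = ∑ i ∈ Finset.range (K x g + K' x g), ((p' x g).coeff i * 2 ^ i : ℤ) := by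
    rw [h1', Polynomial.eval_eq_sum_range' ((h4' x g).trans_le (Nat.le_add_left _ _))]
    push_cast
    rfl
  rw [← e1, ← e2] at h5
  set s : ℕ := Nat.rec (O x g)
      (fun j s => (s + O x g + (p' x g).coeff j - (p x g).coeff j) / 2) (K x g + K' x g)
  have hr' : (r : ℤ) < 2 ^ (K x g + K' x g) := by exact_mod_cast hr
  have hpos : (0 : ℤ) < 2 ^ (K x g + K' x g) := by positivity
  constructor
  · intro h
    have h6 : (N x g : ℤ) ≤ M x g := by exact_mod_cast h
    by_contra hlt
    have h7 : (s : ℤ) - O x g ≤ -1 := by omega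
    have := mul_le_mul_of_nonneg_right h7 hpos.le
    linarith
  · intro h
    have h7 : (0 : ℤ) ≤ (s : ℤ) - O x g := by omega
    have := mul_nonneg h7 hpos.le
    have h8 : (N x g : ℤ) ≤ M x g := by linarith [Int.natCast_nonneg r]
    exact_mod_cast h8

end LSN

/-- Rational numbers that are given as quotients. -/
def LSQ (B : MultiTapeTM InSym) (str : ι → List InSym) (H : ι → Scope B) (q : ι → γ → ℚ) : Prop :=
  ∃ a b d : ι → γ → ℕ, LSN B str H a ∧ LSN B str H b ∧ LSN B str H d ∧
    ∀ x g, 0 < d x g ∧ q x g = ((a x g : ℚ) - b x g) / d x g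

namespace LSQ

variable {q r : ι → γ → ℚ}

theorem zero : LSQ B str H (fun _ (_ : γ) => 0) :=
  ⟨_, _, _, LSN.zero, LSN.zero, LSN.one, fun x g => ⟨one_pos, by simp⟩⟩

theorem add (hq : LSQ B str H q) (hr : LSQ B str H r) : LSQ B str H (fun x g => q x g + r x g) := by
  obtain ⟨a, b, d, ha, hb, hd, h⟩ := hq
  obtain ⟨a', b', d', ha', hb', hd', h'⟩ := hr
  refine ⟨_, _, _, (ha.mul hd').add (ha'.mul hd), (hb.mul hd').add (hb'.mul hd), hd.mul hd',
    fun x g => ⟨Nat.mul_pos (h x g).1 (h' x g).1, ?_⟩⟩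
  have h1 : (d x g : ℚ) ≠ 0 := by exact_mod_cast (h x g).1.ne'
  have h2 : (d' x g : ℚ) ≠ 0 := by exact_mod_cast (h' x g).1.ne'
  beta_reduce
  rw [(h x g).2, (h' x g).2]
  push_cast
  field_simp
  ring

theorem ite {P : ι → γ → Prop} [∀ x g, Decidable (P x g)] (hP : LSP B str H P)
    (hq : LSQ B str H q) (hr : LSQ B str H r) :
    LSQ B str H (fun x g => if P x g then q x g else r x g) := by
  obtain ⟨a, b, d, ha, hb, hd, h⟩ := hq
  obtain ⟨a', b', d', ha', hb', hd', h'⟩ := hr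
  refine ⟨_, _, _, LSN.ite hP ha ha', LSN.ite hP hb hb', LSN.ite hP hd hd', fun x g => ?_⟩
  beta_reduce
  split_ifs
  · exact h x g
  · exact h' x g

theorem le (hq : LSQ B str H q) (hr : LSQ B str H r) : LSP B str H (fun x g => q x g ≤ r x g) := by
  obtain ⟨a, b, d, ha, hb, hd, h⟩ := hq
  obtain ⟨a', b', d', ha', hb', hd', h'⟩ := hr
  refine (LSN.le ((ha.mul hd').add (hb'.mul hd)) ((ha'.mul hd).add (hb.mul hd'))).congr
    fun x g => ?_
  have h1 : (0 : ℚ) < d x g := by exact_mod_cast (h x g).1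
  have h2 : (0 : ℚ) < d' x g := by exact_mod_cast (h' x g).1
  rw [(h x g).2, (h' x g).2, div_le_div_iff₀ h1 h2, ← Nat.cast_le (α := ℚ)]
  push_cast
  constructor <;> intro h3 <;> linarith

end LSQ

/-! ## Reading a linear program -/

theorem List.getElem?_flatMap_of_length {α β : Type*} (l : List α) (g : α → List β) (L : ℕ)
    (hg : ∀ a ∈ l, (g a).length = L) (i k : ℕ) (hk : k < L) :
    (l.flatMap g)[i * L + k]? = l[i]?.bind (fun a => (g a)[k]?) := by
  induction l generalizing i with
  | nil => simp
  | cons a l ih =>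
    have ha := hg a (by simp)
    rw [List.flatMap_cons]
    cases i with
    | zero =>
      rw [List.getElem?_append_left (by omega)]
      simp
    | succ i =>
      rw [List.getElem?_append_right (by rw [ha, add_mul]; omega), List.getElem?_cons_succ,
        ← ih (fun a ha => hg a (by simp [ha])) i, ha]
      congr 1
      rw [add_mul]
      omega

namespace LPTwoThree

variable (P : LPTwoThree)

/-- The entries of the matrix and, in column `n`, of the vector. -/
def cell (i j : ℕ) : ℚ :=
  if hi : i < P.m then (if hj : j < P.n then P.A ⟨i, hi⟩ ⟨j, hj⟩ else if j = P.n then P.b ⟨i, hi⟩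
    else 0) else 0

def rowWords (i : Fin P.m) : List (List Bool) := (List.ofFn (P.A i) ++ [P.b i]).flatMap ratWords

def words : List (List Bool) := tableWords (List.ofFn P.rowWords)

theorem encode_eq : P.encode = encodeWords P.words := rfl

theorem length_rowWords (i : Fin P.m) : (P.rowWords i).length = 2 * P.n + 2 := by
  have h : ∀ L : List ℚ, (L.flatMap ratWords).length = 2 * L.length := by
    intro L
    induction L with
    | nil => rfl
    | cons q L ih =>
      rw [List.flatMap_cons, List.length_append, ih]
      simp [ratWords]
      ring
  rw [rowWords, h]
  simp
  ring

theorem length_words : P.words.length = P.m * (2 * P.n + 3) := by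
  have h : ∀ L : List (List (List Bool)), (∀ r ∈ L, r.length = 2 * P.n + 2) →
      (tableWords L).length = L.length * (2 * P.n + 3) := by
    intro L hL
    induction L with
    | nil => simp [tableWords]
    | cons r L ih =>
      have h1 := ih fun r hr => hL r (by simp [hr])
      have h2 := hL r (by simp)
      unfold tableWords at h1 ⊢
      rw [List.flatMap_cons, List.length_append, h1, List.length_append, h2, List.length_cons]
      simp
      ring
  rw [words, h]
  · simp
  · simp only [List.mem_ofFn]
    rintro r ⟨i, rfl⟩
    exact P.length_rowWords i

theorem getElem?_words (i : Fin P.m) (k : ℕ) (hk : k < 2 * P.n + 3) :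
    P.words[i * (2 * P.n + 3) + k]? = (P.rowWords i ++ [[]])[k]? := by
  unfold words tableWords
  rw [List.getElem?_flatMap_of_length _ _ (2 * P.n + 3) _ _ _ hk]
  · simp
  · simp only [List.mem_ofFn]
    rintro r ⟨i, rfl⟩
    simp [P.length_rowWords i]

theorem getElem?_rowWords (i : Fin P.m) (j e : ℕ) (hj : j ≤ P.n) (he : e < 2) :
    (P.rowWords i)[j * 2 + e]? = (ratWords (P.cell i j))[e]? := by
  unfold rowWords
  rw [List.getElem?_flatMap_of_length _ _ 2 (fun q _ => rfl) _ _ he]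
  have : (List.ofFn (P.A i) ++ [P.b i])[j]? = some (P.cell i j) := by
    unfold cell
    rw [dif_pos i.2]
    by_cases h : j < P.n
    · rw [List.getElem?_append_left (by simpa using h), dif_pos h]
      simp [h]
    · obtain rfl : j = P.n := by omega
      rw [List.getElem?_append_right (by simp)]
      simp
  rw [this]
  rfl

theorem wordAt_num {i j : ℕ} (hi : i < P.m) (hj : j ≤ P.n) :
    wordAt P.words (i * (2 * P.n + 3) + j * 2) =
      decide ((P.cell i j).num < 0) :: Nat.bits (P.cell i j).num.natAbs := by
  unfold wordAt
  have h1 := P.getElem?_words ⟨i, hi⟩ (j * 2 + 0) (by omega)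
  rw [List.getElem?_append_left (by rw [length_rowWords]; omega),
    getElem?_rowWords _ _ _ _ hj (by omega)] at h1
  rw [List.getD_eq_getElem?_getD]
  rw [add_zero] at h1
  simp only at h1
  rw [h1]
  rfl

theorem wordAt_den {i j : ℕ} (hi : i < P.m) (hj : j ≤ P.n) :
    wordAt P.words (i * (2 * P.n + 3) + j * 2 + 1) = Nat.bits (P.cell i j).den := by
  unfold wordAt
  have h1 := P.getElem?_words ⟨i, hi⟩ (j * 2 + 1) (by omega)
  rw [List.getElem?_append_left (by rw [length_rowWords]; omega),
    getElem?_rowWords _ _ _ _ hj (by omega)] at h1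
  rw [List.getD_eq_getElem?_getD, add_assoc]
  simp only at h1
  rw [h1]
  rfl

/-- A numerator word contains its sign bit and a denominator is not zero, so no word of an entry is
empty. The first empty word ends row `0`, after two words for each of the `n + 1` numbers; from this
the number of columns is recovered. -/
theorem least_empty_word :
    leastBelow P.words.length (fun k => (wordAt P.words k).length = 0) = 2 * P.n + 2 := by
  have h0 : ∀ k, (wordAt P.words k) = (wordAt P.words (0 * (2 * P.n + 3) + k)) := by simp
  refine leastBelow_eq ?_ ?_ ?_
  · rw [length_words]
    have := P.m_pos
    nlinarith
  · have h1 := P.getElem?_words ⟨0, P.m_pos⟩ (2 * P.n + 2) (by omega)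
    rw [List.getElem?_append_right (by rw [length_rowWords]), length_rowWords] at h1
    rw [h0, wordAt, List.getD_eq_getElem?_getD, h1]
    simp
  · intro k hk h
    have hw : (wordAt P.words k) = [] := List.eq_nil_of_length_eq_zero h
    rcases Nat.even_or_odd' k with ⟨j, rfl | rfl⟩
    · rw [h0, mul_comm 2 j, P.wordAt_num P.m_pos (by omega)] at hw
      simp at hw
    · rw [h0, mul_comm 2 j, ← add_assoc, P.wordAt_den P.m_pos (by omega)] at hw
      exact (P.cell 0 j).den_ne_zero (natBits_injective (hw.trans Nat.zero_bits.symm))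

variable {H : LPTwoThree → Scope B} {F K : LPTwoThree → γ → ℕ}

theorem ls_n : LS B encode H (fun P (_ : γ) => P.n) :=
  (LS.div ((LS.least (P := fun P _ k => (wordAt P.words k).length = 0) (LS.wordCount encode_eq)
    (LSP.eq (LSW.word encode_eq LS.last).length (LS.const 0))).sub (LS.const 2))
    (LS.const 2)).congr fun P g => by
      rw [least_empty_word]
      omega

theorem ls_m : LS B encode H (fun P (_ : γ) => P.m) :=
  (LS.div (LS.wordCount encode_eq) (((LS.const 2).mul ls_n).add (LS.const 3))).congr fun P g => by
    rw [length_words, Nat.mul_div_cancel _ (by omega)]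

theorem lsp_inside (hF : LS B encode H F) (hK : LS B encode H K) :
    LSP B encode H (fun P g => F P g < P.m ∧ K P g ≤ P.n) :=
  (LSP.lt hF ls_m).and (LSP.le hK ls_n)

theorem ls_numIndex (hF : LS B encode H F) (hK : LS B encode H K) :
    LS B encode H (fun P g => F P g * (2 * P.n + 3) + K P g * 2) :=
  (hF.mul (((LS.const 2).mul ls_n).add (LS.const 3))).add (hK.mul (LS.const 2))

theorem cell_eq_zero {i j : ℕ} (h : ¬ (i < P.m ∧ j ≤ P.n)) : P.cell i j = 0 := by
  unfold cell
  split_ifs <;> first | rfl | omega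

/-- An entry is nonzero iff its numerator word is longer than the sign bit, so no arithmetic is
needed. -/
theorem lsp_cell_ne_zero (hF : LS B encode H F) (hK : LS B encode H K) :
    LSP B encode H (fun P g => P.cell (F P g) (K P g) ≠ 0) := by
  refine ((lsp_inside hF hK).and (LSP.lt (LS.const 1)
    (LSW.word encode_eq (ls_numIndex hF hK)).length)).congr fun P g => ?_
  by_cases h : F P g < P.m ∧ K P g ≤ P.n
  · rw [P.wordAt_num h.1 h.2]
    simp only [h, true_and, List.length_cons, Nat.lt_add_left_iff_pos, List.length_pos_iff,
      and_self]
    rw [not_iff_not]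
    constructor
    · intro h1
      simp [h1]
    · intro h1
      have := natBits_injective (h1.trans Nat.zero_bits.symm)
      simpa using this
  · simp [h, P.cell_eq_zero h]

/-- The sign bit decides whether the absolute value of the numerator is used as the positive or as
the negative part. Outside the table the denominator `1` keeps the quotient meaningful. -/
theorem lsq_cell (hF : LS B encode H F) (hK : LS B encode H K) :
    LSQ B encode H (fun P g => P.cell (F P g) (K P g)) := by
  classical
  have hin := lsp_inside hF hK
  have hword := LSW.word encode_eq (ls_numIndex hF hK)
  have hsign := hword.bit_at (LS.const 0)
  have hval := LSN.word hword.tail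
  have hden := LSN.word (LSW.word encode_eq (ls_numIndex hF hK).succ)
  refine ⟨_, _, _, LSN.ite hin (LSN.ite hsign LSN.zero hval) LSN.zero,
    LSN.ite hin (LSN.ite hsign hval LSN.zero) LSN.zero, LSN.ite hin hden LSN.one, fun P g => ?_⟩
  beta_reduce
  by_cases h : F P g < P.m ∧ K P g ≤ P.n
  · simp only [if_pos h, P.wordAt_num h.1 h.2, P.wordAt_den h.1 h.2, wordVal_bits, List.tail_cons]
    refine ⟨Nat.pos_of_ne_zero (P.cell _ _).den_ne_zero, ?_⟩
    generalize P.cell (F P g) (K P g) = q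
    conv_lhs => rw [← Rat.num_div_den q]
    congr 1
    by_cases hq : q.num < 0
    · have : (q.num.natAbs : ℚ) = -(q.num : ℚ) := by
        rw [← Int.cast_natCast, ← Int.cast_neg]
        congr 1
        omega
      simp only [List.getElem?_cons_zero, hq, decide_true, if_true]
      rw [Nat.cast_zero, this]
      ring
    · have : (q.num.natAbs : ℚ) = (q.num : ℚ) := by
        rw [← Int.cast_natCast]
        congr 1
        omega
      simp only [List.getElem?_cons_zero, hq, decide_false, Option.some_inj, Bool.false_eq_true,
        if_false]
      rw [Nat.cast_zero, this]
      ring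
  · simp [h, P.cell_eq_zero h]

end LPTwoThree

/-! ## Cyclic orders on finite sets of numbers -/

section Cycle

open Classical in
/-- The successor of `t` in the cyclic order of the numbers below `M` with property `N`. -/
noncomputable def cyclicNext (M : ℕ) (N : ℕ → Prop) (t : ℕ) : ℕ :=
  if ∃ t' < M, t < t' ∧ N t' then leastBelow M (fun t' => t < t' ∧ N t') else leastBelow M N

variable {M : ℕ} {N : ℕ → Prop} {t t' : ℕ}

theorem cyclicNext_of_lt (hN : ∀ t, N t → t < M) (ht' : N t') (h : t < t') :
    N (cyclicNext M N t) ∧ t < cyclicNext M N t ∧ cyclicNext M N t ≤ t' := by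
  have hex : ∃ t' < M, t < t' ∧ N t' := ⟨t', hN _ ht', h, ht'⟩
  rw [cyclicNext, if_pos hex]
  obtain ⟨h1, h2, h3⟩ := leastBelow_spec hex
  exact ⟨h2.2, h2.1, not_lt.1 fun h4 => h3 _ h4 ⟨h, ht'⟩⟩

theorem cyclicNext_of_last (hN : ∀ t, N t → t < M) (ht : N t) (h : ∀ t', N t' → t' ≤ t) :
    N (cyclicNext M N t) ∧ ∀ t', N t' → cyclicNext M N t ≤ t' := by
  have hex : ¬ ∃ t' < M, t < t' ∧ N t' := by
    rintro ⟨t', -, h1, h2⟩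
    exact absurd (h t' h2) (by omega)
  rw [cyclicNext, if_neg hex]
  obtain ⟨h1, h2, h3⟩ := leastBelow_spec ⟨t, hN _ ht, ht⟩
  exact ⟨h2, fun t' ht' => not_lt.1 fun h4 => h3 _ h4 ht'⟩

theorem cyclicNext_spec (hN : ∀ t, N t → t < M) (ht : N t) : N (cyclicNext M N t) := by
  by_cases h : ∃ t', N t' ∧ t < t'
  · obtain ⟨t', h1, h2⟩ := h
    exact (cyclicNext_of_lt hN h1 h2).1
  · push Not at h
    exact (cyclicNext_of_last hN ht h).1

/-- For the smaller `t` the successor lies above `t` and at most at `t'`. For `t'` it lies above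
`t'`, or else it is the least element and hence at most `t`. -/
theorem cyclicNext_inj_aux (hN : ∀ t, N t → t < M) (ht : N t) (ht' : N t') (hlt : t < t') :
    cyclicNext M N t ≠ cyclicNext M N t' := by
  intro h
  obtain ⟨h1, h2, h3⟩ := cyclicNext_of_lt hN ht' hlt
  by_cases h4 : ∃ t'', N t'' ∧ t' < t''
  · obtain ⟨t'', h5, h6⟩ := h4
    obtain ⟨-, h7, -⟩ := cyclicNext_of_lt hN h5 h6
    omega
  · push Not at h4
    have := (cyclicNext_of_last hN ht' h4).2 t ht
    omega

theorem cyclicNext_inj (hN : ∀ t, N t → t < M) (ht : N t) (ht' : N t')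
    (h : cyclicNext M N t = cyclicNext M N t') : t = t' := by
  rcases lt_trichotomy t t' with h1 | h1 | h1
  · exact absurd h (cyclicNext_inj_aux hN ht ht' h1)
  · exact h1
  · exact absurd h.symm (cyclicNext_inj_aux hN ht' ht h1)

/-- The successor map runs through the whole set: a property is carried up to the largest element,
then to the least one, and from there up to any `t'`. -/
theorem cyclicNext_induction (hN : ∀ t, N t → t < M) {R : ℕ → Prop}
    (hR : ∀ t, N t → R t → R (cyclicNext M N t)) (ht : N t) (ht' : N t') (h : R t) : R t' := by
  have up : ∀ d t, N t → R t → ∀ t', N t' → t ≤ t' → t' - t = d → R t' := by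
    intro d
    induction d using Nat.strong_induction_on with
    | _ d ih =>
      intro t ht h t' ht' hle hd
      rcases hle.eq_or_lt with rfl | hlt
      · exact h
      · obtain ⟨h1, h2, h3⟩ := cyclicNext_of_lt hN ht' hlt
        exact ih _ (by omega) _ h1 (hR t ht h) t' ht' h3 rfl
  have down : ∀ d t, N t → R t → M - t = d → R t' := by
    intro d
    induction d using Nat.strong_induction_on with
    | _ d ih =>
      intro t ht h hd
      by_cases h4 : ∃ t'', N t'' ∧ t < t''
      · obtain ⟨t'', h5, h6⟩ := h4
        obtain ⟨h7, h8, h9⟩ := cyclicNext_of_lt hN h5 h6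
        have := hN _ h5
        exact ih _ (by omega) _ h7 (hR t ht h) rfl
      · push Not at h4
        obtain ⟨h7, h8⟩ := cyclicNext_of_last hN ht h4
        exact up _ _ h7 (hR t ht h) t' ht' (h8 t' ht') rfl
  exact down _ t ht h rfl

end Cycle

/-! ### Counting occurrences in lists of clauses -/

theorem sum_ind_le_one (M n : ℕ) (Q : ℕ → ℕ → Prop)
    (hQ : ∀ t j t' j', Q t j → Q t' j' → t = t' ∧ j = j') :
    ∑ t ∈ Finset.range M, ∑ j ∈ Finset.range n, ind (Q t j) ≤ 1 := by
  by_cases h : ∃ t₀ j₀, Q t₀ j₀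
  · obtain ⟨t₀, j₀, h⟩ := h
    have h1 : ∀ t j, ind (Q t j) ≤ if t = t₀ then (if j = j₀ then 1 else 0) else 0 := by
      intro t j
      by_cases h2 : Q t j
      · obtain ⟨rfl, rfl⟩ := hQ _ _ _ _ h2 h
        simp [h2]
      · simp [ind_of_not h2]
    refine (Finset.sum_le_sum fun t _ => Finset.sum_le_sum fun j _ => h1 t j).trans ?_
    have h2 : ∀ t, ∑ j ∈ Finset.range n, (if t = t₀ then (if j = j₀ then 1 else 0) else 0) ≤
        if t = t₀ then 1 else 0 := by
      intro t
      split_ifs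
      · rw [Finset.sum_ite_eq']
        split_ifs <;> omega
      · simp
    refine (Finset.sum_le_sum fun t _ => h2 t).trans ?_
    rw [Finset.sum_ite_eq']
    split_ifs <;> omega
  · push Not at h
    simp [h]

theorem List.countP_flatten_flatMap {α β : Type*} (l : List α) (f : α → List (List β))
    (p : β → Bool) :
    (l.flatMap f).flatten.countP p = (l.map (fun a => (f a).flatten.countP p)).sum := by
  induction l with
  | nil => rfl
  | cons a l ih => simp [ih]

theorem List.countP_map_filter {α β : Type*} (l : List α) (P : α → Prop) [DecidablePred P]
    (f : α → β) (p : β → Prop) [DecidablePred p] :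
    ((l.filter (fun a => P a)).map f).countP (fun b => p b) =
      (l.map (fun a => ind (P a ∧ p (f a)))).sum := by
  induction l with
  | nil => rfl
  | cons a l ih =>
    by_cases h : P a
    · by_cases h' : p (f a)
      · simp [h, h', ih]
        ring
      · simp [h, h', ih]
    · simp [h, ih]

theorem List.countP_flatten_map_filter {α β : Type*} (l : List α) (P : α → Prop) [DecidablePred P]
    (f g : α → β) (p : β → Prop) [DecidablePred p] :
    ((l.filter (fun a => P a)).map (fun a => [f a, g a])).flatten.countP (fun b => p b) =
      (l.map (fun a => ind (P a ∧ p (f a)))).sum + (l.map (fun a => ind (P a ∧ p (g a)))).sum := by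
  induction l with
  | nil => rfl
  | cons a l ih =>
    by_cases h : P a
    · by_cases h1 : p (f a) <;> by_cases h2 : p (g a) <;> simp [h, h1, h2, ih] <;> ring
    · simp [h, ih]

/-! ## From linear programs to satisfiability -/

namespace LPTwoThree

variable (P : LPTwoThree)

def NZ (i j : ℕ) : Prop := j < P.n ∧ P.cell i j ≠ 0

theorem NZ.lt {P : LPTwoThree} {i j : ℕ} (h : P.NZ i j) : i < P.m ∧ j < P.n := by
  refine ⟨?_, h.1⟩
  by_contra hi
  exact h.2 (P.cell_eq_zero fun h' => hi h'.1)

theorem cell_fin (i : Fin P.m) (j : Fin P.n) : P.cell i j = P.A i j := by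
  simp [cell]

theorem cell_n (i : Fin P.m) : P.cell i P.n = P.b i := by
  simp [cell]

open Classical in
theorem card_row_le (i : ℕ) : ((Finset.range P.n).filter (fun j => P.NZ i j)).card ≤ 2 := by
  by_cases hi : i < P.m
  · refine le_trans ?_ (P.row_sparse ⟨i, hi⟩)
    refine (Finset.card_le_card (t := (Finset.univ.filter
      (fun j => P.A ⟨i, hi⟩ j ≠ 0)).image (fun j : Fin P.n => (j : ℕ))) fun j hj => ?_).trans
      Finset.card_image_le
    have h := (Finset.mem_filter.1 hj).2
    refine Finset.mem_image.2 ⟨⟨j, h.1⟩, Finset.mem_filter.2 ⟨Finset.mem_univ _, ?_⟩, rfl⟩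
    rw [← cell_fin]
    exact h.2
  · rw [Finset.filter_false_of_mem fun j _ h => hi h.lt.1]
    simp

open Classical in
theorem card_col_le (j : ℕ) : ((Finset.range P.m).filter (fun i => P.NZ i j)).card ≤ 3 := by
  by_cases hj : j < P.n
  · refine le_trans ?_ (P.col_sparse ⟨j, hj⟩)
    refine (Finset.card_le_card (t := (Finset.univ.filter
      (fun i => P.A i ⟨j, hj⟩ ≠ 0)).image (fun i : Fin P.m => (i : ℕ))) fun i hi => ?_).trans
      Finset.card_image_le
    have h := (Finset.mem_filter.1 hi).2
    refine Finset.mem_image.2 ⟨⟨i, h.lt.1⟩, Finset.mem_filter.2 ⟨Finset.mem_univ _, ?_⟩, rfl⟩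
    rw [← cell_fin]
    exact h.2
  · rw [Finset.filter_false_of_mem fun i _ h => hj h.1]
    simp

/-- The columns of the nonzero entries of a row. -/
noncomputable def firstCol (i : ℕ) : ℕ := leastBelow P.n (P.NZ i)

noncomputable def secondCol (i : ℕ) : ℕ :=
  leastBelow P.n (fun j => P.NZ i j ∧ P.firstCol i < j)

/-- Any further column would be a third nonzero entry in the row. -/
theorem NZ.eq_first_or_second {P : LPTwoThree} {i j : ℕ} (h : P.NZ i j) :
    j = P.firstCol i ∨ j = P.secondCol i := by
  classical
  by_contra hne
  rw [not_or] at hne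
  obtain ⟨h1, h2, h3⟩ := leastBelow_spec ⟨j, h.1, h⟩
  change P.firstCol i < P.n at h1
  change P.NZ i (P.firstCol i) at h2
  have h4 : P.firstCol i < j := by
    rcases lt_trichotomy j (P.firstCol i) with h5 | h5 | h5
    · exact absurd h (h3 j h5)
    · exact absurd h5 hne.1
    · exact h5
  obtain ⟨h5, h6, h7⟩ := leastBelow_spec (P := fun j => P.NZ i j ∧ P.firstCol i < j)
    ⟨j, h.1, h, h4⟩
  change P.secondCol i < P.n at h5
  change P.NZ i (P.secondCol i) ∧ P.firstCol i < P.secondCol i at h6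
  have h8 := P.card_row_le i
  have h9 : ({P.firstCol i, P.secondCol i, j} : Finset ℕ) ⊆
      (Finset.range P.n).filter (fun j => P.NZ i j) := by
    intro k hk
    simp only [Finset.mem_insert, Finset.mem_singleton] at hk
    rw [Finset.mem_filter, Finset.mem_range]
    rcases hk with rfl | rfl | rfl
    · exact ⟨h1, h2⟩
    · exact ⟨h5, h6.1⟩
    · exact ⟨h.1, h⟩
  have h10 := Finset.card_le_card h9
  rw [Finset.card_insert_of_notMem, Finset.card_insert_of_notMem, Finset.card_singleton] at h10
  · omega
  · simp [Ne.symm hne.2]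
  · simp only [Finset.mem_insert, Finset.mem_singleton, not_or]
    omega

/-- A row with a single nonzero entry has the default `P.n` as its second column, which is not a
column at all. -/
theorem secondCol_ne {i : ℕ} (h : P.firstCol i < P.n) : P.secondCol i ≠ P.firstCol i := by
  by_cases h1 : ∃ j < P.n, P.NZ i j ∧ P.firstCol i < j
  · exact (leastBelow_spec h1).2.1.2.ne'
  · have : P.secondCol i = P.n := leastBelow_of_not fun j hj h2 => h1 ⟨j, hj, h2⟩
    omega

/-- The value that the assignment `s < 4` of row `i` gives to column `j`. -/
def Bit (i s j : ℕ) : Prop := (j = P.firstCol i ∧ s / 2 = 1) ∨ (¬ j = P.firstCol i ∧ s % 2 = 1)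

/-- The left-hand side of row `i` under the assignment `s`. -/
noncomputable def lhs (i s : ℕ) : ℚ :=
  (if P.firstCol i < P.n ∧ s / 2 = 1 then P.cell i (P.firstCol i) else 0) +
  (if P.secondCol i < P.n ∧ s % 2 = 1 then P.cell i (P.secondCol i) else 0)

theorem sum_cell_eq_lhs {i s : ℕ} {X : ℕ → ℚ} (hX : ∀ j, P.NZ i j → X j = ind (P.Bit i s j)) :
    ∑ j ∈ Finset.range P.n, P.cell i j * X j = P.lhs i s := by
  have key : ∀ j ∈ Finset.range P.n, P.cell i j * X j =
      (if j = P.firstCol i then (if s / 2 = 1 then P.cell i (P.firstCol i) else 0) else 0) +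
      (if j = P.secondCol i then (if s % 2 = 1 then P.cell i (P.secondCol i) else 0) else 0) := by
    intro j hj
    rw [Finset.mem_range] at hj
    by_cases h : P.NZ i j
    · rw [hX j h]
      by_cases h1 : j = P.firstCol i
      · have h2 : j ≠ P.secondCol i := fun h2 => P.secondCol_ne (h1 ▸ hj) (h2.symm.trans h1)
        rw [if_pos h1, if_neg h2, ← h1, add_zero]
        by_cases h3 : s / 2 = 1
        · rw [ind_of (show P.Bit i s j from Or.inl ⟨h1, h3⟩)]; simp [h3]
        · rw [ind_of_not (by unfold Bit; tauto)]; simp [h3]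
      · have h2 := h.eq_first_or_second.resolve_left h1
        rw [if_neg h1, if_pos h2, ← h2, zero_add]
        by_cases h3 : s % 2 = 1
        · rw [ind_of (show P.Bit i s j from Or.inr ⟨h1, h3⟩)]; simp [h3]
        · rw [ind_of_not (by unfold Bit; tauto)]; simp [h3]
    · have h0 : P.cell i j = 0 := by
        by_contra h0
        exact h ⟨hj, h0⟩
      rw [h0, zero_mul]
      split_ifs with h1 h2 h3 h4 h5 h6 <;> simp_all
  rw [Finset.sum_congr rfl key, Finset.sum_add_distrib, Finset.sum_ite_eq', Finset.sum_ite_eq']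
  simp only [Finset.mem_range, lhs, ite_and]

theorem feasible_iff : P.Feasible ↔ ∃ X : ℕ → ℚ, (∀ j, X j = 0 ∨ X j = 1) ∧
    ∀ i < P.m, P.cell i P.n ≤ ∑ j ∈ Finset.range P.n, P.cell i j * X j := by
  constructor
  · rintro ⟨x, hx, h⟩
    refine ⟨fun j => if hj : j < P.n then x ⟨j, hj⟩ else 0, fun j => ?_, fun i hi => ?_⟩
    · dsimp only
      split_ifs
      · exact hx _
      · exact Or.inl rfl
    · refine (P.cell_n ⟨i, hi⟩).trans_le ((h ⟨i, hi⟩).trans (le_of_eq ?_))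
      rw [Finset.sum_range]
      show ∑ j, P.A ⟨i, hi⟩ j * x j = _
      refine Finset.sum_congr rfl fun j _ => ?_
      rw [← cell_fin]
      simp
  · rintro ⟨X, hX, h⟩
    refine ⟨fun j => X j, fun j => hX j, fun i => ?_⟩
    refine (P.cell_n i).symm.trans_le ((h i i.2).trans (le_of_eq ?_))
    rw [Finset.sum_range]
    show _ = ∑ j, P.A i j * X j
    refine Finset.sum_congr rfl fun j _ => ?_
    rw [← cell_fin]

def Violated (i s : ℕ) : Prop := P.lhs i s < P.cell i P.n

/-- There are four copies of each column for each row in which its entry is nonzero. -/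
def Copy (j t : ℕ) : Prop := P.NZ (t / 4) j

theorem Copy.lt {P : LPTwoThree} (j t : ℕ) (h : P.Copy j t) : t < 4 * P.m := by
  have := NZ.lt h
  omega

/-- Pairs of a slot `t < 4 * P.m` and a column are numbered below `4 * P.m * P.n`, which leaves this
last number for the auxiliary variable of a hopeless row. Slot `t` stands for row `t / 4` under its
assignment `t % 4`. -/
def var (t j : ℕ) : ℕ := t * P.n + j

theorem var_inj {t j t' j' : ℕ} (hj : j < P.n) (hj' : j' < P.n) (h : P.var t j = P.var t' j') :
    t = t' ∧ j = j' := by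
  have h1 : t = t' := by
    have := congrArg (· / P.n) h
    simpa [var, Nat.add_comm (_ * _), Nat.add_mul_div_right _ _ P.n_pos, Nat.div_eq_of_lt hj,
      Nat.div_eq_of_lt hj'] using this
  subst h1
  exact ⟨rfl, by simpa [var] using h⟩

theorem Copy.var_lt {P : LPTwoThree} {j t : ℕ} (h : P.Copy j t) : P.var t j < 4 * P.m * P.n := by
  have h1 := h.lt
  have h2 : j < P.n := NZ.lt h |>.2
  have h3 := Nat.mul_le_mul_right P.n (Nat.succ_le_of_lt h1)
  unfold var
  rw [Nat.succ_mul] at h3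
  omega

noncomputable def nextCopy (j t : ℕ) : ℕ := cyclicNext (4 * P.m) (P.Copy j) t

-- Each clause says that a copy implies the next one. As the order is cyclic, all copies of a column
-- receive the same value.
open Classical in
noncomputable def cycleClauses (t : ℕ) : List (List (ℕ × Bool)) :=
  ((List.range P.n).filter (fun j => P.Copy j t)).map
    (fun j => [(P.var t j, false), (P.var (P.nextCopy j t) j, true)])

-- Each literal is the negation of what the assignment of the slot prescribes, so the clause fails
-- under this assignment and no other.
open Classical in
noncomputable def rowClause (t : ℕ) : List (ℕ × Bool) :=
  ((List.range P.n).filter (fun j => P.Copy j t)).map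
    (fun j => (P.var t j, decide (¬ P.Bit (t / 4) (t % 4) j)))

/-- The assignment of slot `t` violates its row. -/
def Excluded (t : ℕ) : Prop := (∃ j < P.n, P.Copy j t) ∧ P.Violated (t / 4) (t % 4)

/-- Some row is not satisfied by any assignment, and all its entries are zero. -/
def Hopeless : Prop := ∃ i < P.m, ¬ (∃ j < P.n, P.NZ i j) ∧ ¬ P.cell i P.n ≤ 0

open Classical in
noncomputable def formula : List (List (ℕ × Bool)) :=
  (List.range (4 * P.m)).flatMap
    (fun t => P.cycleClauses t ++ if P.Excluded t then [P.rowClause t] else []) ++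
  if P.Hopeless then [[(4 * P.m * P.n, true)], [(4 * P.m * P.n, false)]] else []

theorem mem_formula {c : List (ℕ × Bool)} : c ∈ P.formula ↔
    (∃ j t, P.Copy j t ∧ c = [(P.var t j, false), (P.var (P.nextCopy j t) j, true)]) ∨
    (∃ t, P.Excluded t ∧ c = P.rowClause t) ∨
    (P.Hopeless ∧ (c = [(4 * P.m * P.n, true)] ∨ c = [(4 * P.m * P.n, false)])) := by
  unfold formula
  rw [List.mem_append, List.mem_flatMap, ← or_assoc]
  refine or_congr ⟨?_, ?_⟩ (by split_ifs with h <;> simp [h])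
  · rintro ⟨t, ht, hc⟩
    rcases List.mem_append.1 hc with hc | hc
    · left
      simp only [cycleClauses, List.mem_map, List.mem_filter, decide_eq_true_eq] at hc
      obtain ⟨j, ⟨-, hj⟩, rfl⟩ := hc
      exact ⟨j, t, hj, rfl⟩
    · right
      split_ifs at hc with h
      · exact ⟨t, h, by simpa using hc⟩
      · simp at hc
  · rintro (⟨j, t, h, rfl⟩ | ⟨t, h, rfl⟩)
    · refine ⟨t, List.mem_range.2 h.lt, List.mem_append_left _ ?_⟩
      simp only [cycleClauses, List.mem_map, List.mem_filter, decide_eq_true_eq]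
      exact ⟨j, ⟨List.mem_range.2 (NZ.lt h).2, h⟩, rfl⟩
    · obtain ⟨⟨j, hj, hc⟩, -⟩ := id h
      refine ⟨t, List.mem_range.2 hc.lt, List.mem_append_right _ ?_⟩
      rw [if_pos h]
      simp

theorem mem_rowClause {t : ℕ} {l : ℕ × Bool} : l ∈ P.rowClause t ↔
    ∃ j, P.Copy j t ∧ l.1 = P.var t j ∧ (l.2 = true ↔ ¬ P.Bit (t / 4) (t % 4) j) := by
  simp only [rowClause, List.mem_map, List.mem_filter, decide_eq_true_eq]
  constructor
  · rintro ⟨j, ⟨-, hj⟩, rfl⟩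
    exact ⟨j, hj, rfl, by simp⟩
  · rintro ⟨j, hj, h1, h2⟩
    refine ⟨j, ⟨List.mem_range.2 (NZ.lt hj).2, hj⟩, Prod.ext h1.symm ?_⟩
    rw [Bool.eq_iff_iff, h2]
    simp

theorem formula_clause_length : ∀ c ∈ P.formula, c.length = 1 ∨ c.length = 2 := by
  classical
  intro c hc
  rw [mem_formula] at hc
  rcases hc with ⟨j, t, -, rfl⟩ | ⟨t, ⟨⟨j, hj, h⟩, -⟩, rfl⟩ | ⟨-, rfl | rfl⟩
  · simp
  · have h1 : (P.rowClause t).length = ((Finset.range P.n).filter (fun j => P.NZ (t / 4) j)).card := by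
      rw [rowClause, List.length_map, ← List.toFinset_card_of_nodup (List.nodup_range.filter _)]
      congr 1
      ext k
      simp only [List.mem_toFinset, List.mem_filter, List.mem_range, Finset.mem_filter,
        Finset.mem_range, decide_eq_true_eq]
      rfl
    have h2 := P.card_row_le (t / 4)
    have h3 : 0 < ((Finset.range P.n).filter (fun j => P.NZ (t / 4) j)).card :=
      Finset.card_pos.2 ⟨j, Finset.mem_filter.2 ⟨Finset.mem_range.2 hj, h⟩⟩
    omega
  · simp
  · simp

/-- A copy occurs once as the premise and once as the conclusion of an implication in its cycle, the
latter because the successor map is injective, and at most once in the clause of its own slot. The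
auxiliary variable occurs at most twice and is not a copy. -/
theorem formula_occurrences (v : ℕ) : P.formula.flatten.countP (fun l => l.1 = v) ≤ 3 := by
  classical
  set S := ∑ t ∈ Finset.range (4 * P.m), ∑ j ∈ Finset.range P.n, ind (P.Copy j t ∧ P.var t j = v)
    with hS
  set S' := ∑ t ∈ Finset.range (4 * P.m), ∑ j ∈ Finset.range P.n,
    ind (P.Copy j t ∧ P.var (P.nextCopy j t) j = v) with hS'
  have h1 : P.formula.flatten.countP (fun l => l.1 = v) ≤
      (S + S' + S) + if v = 4 * P.m * P.n then 2 else 0 := by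
    unfold formula
    rw [List.flatten_append, List.countP_append, List.countP_flatten_flatMap, sum_map_range]
    refine add_le_add ?_ ?_
    · rw [hS, hS', ← Finset.sum_add_distrib, ← Finset.sum_add_distrib]
      refine Finset.sum_le_sum fun t _ => ?_
      rw [List.flatten_append, List.countP_append]
      refine add_le_add (le_of_eq ?_) ?_
      · rw [cycleClauses, List.countP_flatten_map_filter (p := fun l : ℕ × Bool => l.1 = v),
          sum_map_range, sum_map_range]
      · split_ifs
        · rw [List.flatten_singleton, rowClause,
            List.countP_map_filter (p := fun l : ℕ × Bool => l.1 = v), sum_map_range]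
        · simp
    · by_cases h : P.Hopeless
      · rw [if_pos h]
        by_cases hv : v = 4 * P.m * P.n
        · simp [hv]
        · simp [hv, Ne.symm hv]
      · simp [h]
  have h2 : S ≤ 1 := sum_ind_le_one _ _ _ fun t j t' j' h h' =>
    P.var_inj (NZ.lt h.1).2 (NZ.lt h'.1).2 (h.2.trans h'.2.symm)
  have h3 : S' ≤ 1 := sum_ind_le_one _ _ _ fun t j t' j' h h' => by
    obtain ⟨e1, rfl⟩ := P.var_inj (NZ.lt h.1).2 (NZ.lt h'.1).2 (h.2.trans h'.2.symm)
    exact ⟨cyclicNext_inj (Copy.lt j) h.1 h'.1 e1, rfl⟩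
  by_cases hv : v = 4 * P.m * P.n
  · have h4 : S = 0 := Finset.sum_eq_zero fun t _ => Finset.sum_eq_zero fun j _ =>
      ind_of_not fun h => (h.1.var_lt.ne (h.2.trans hv))
    have h5 : S' = 0 := Finset.sum_eq_zero fun t _ => Finset.sum_eq_zero fun j _ =>
      ind_of_not fun h => ((cyclicNext_spec (Copy.lt j) h.1 : P.Copy j _).var_lt.ne (h.2.trans hv))
    rw [h4, h5, if_pos hv] at h1
    omega
  · rw [if_neg hv] at h1
    omega

noncomputable def toTwoSAT : TwoSATThree where
  clauses := P.formula
  clause_length := P.formula_clause_length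
  occurrences := P.formula_occurrences

/-- The cycles turn an assignment of the copies into one of the columns. If a row with nonzero
entries were violated, the clause of the slot that describes this violation would fail; a violated
row without such entries makes the instance hopeless. Conversely, all copies take the value of their
column, and a failing row clause would mean that its row is violated. -/
theorem toTwoSAT_satisfiable : P.toTwoSAT.Satisfiable ↔ P.Feasible := by
  classical
  rw [feasible_iff]
  constructor
  · rintro ⟨τ, hτ⟩
    have h1 : ∀ j t t', P.Copy j t → P.Copy j t' → τ (P.var t j) = true → τ (P.var t' j) = true := by
      intro j t t' ht ht'
      refine cyclicNext_induction (Copy.lt j) (R := fun t => τ (P.var t j) = true) ?_ ht ht'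
      intro t ht hR
      obtain ⟨l, hl, h⟩ := hτ _ (P.mem_formula.2 (Or.inl ⟨j, t, ht, rfl⟩))
      simp only [List.mem_cons, List.not_mem_nil, or_false] at hl
      rcases hl with rfl | rfl
      · simp [hR] at h
      · exact h
    let X : ℕ → Prop := fun j => ∃ t, P.Copy j t ∧ τ (P.var t j) = true
    have hX : ∀ j t, P.Copy j t → (τ (P.var t j) = true ↔ X j) := fun j t h =>
      ⟨fun h' => ⟨t, h, h'⟩, fun ⟨t', h', h2⟩ => h1 j t' t h' h h2⟩
    refine ⟨fun j => ind (X j), fun j => ?_, fun i hi => ?_⟩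
    · by_cases h : X j
      · right; simp [ind_of h]
      · left; simp [ind_of_not h]
    -- The two values are packed into the number of an assignment. If the second column is the
    -- default `P.n`, it has no copies, so its value counts as `0`.
    · set s := 2 * ind (X (P.firstCol i)) + ind (X (P.secondCol i)) with hs
      have hind : ∀ p : Prop, ind p < 2 ∧ (ind p = 1 ↔ p) := fun p => by
        by_cases hp : p <;> simp [hp]
      have ha := hind (X (P.firstCol i))
      have hb := hind (X (P.secondCol i))
      have hbit : ∀ j, P.NZ i j → (P.Bit i s j ↔ X j) := by
        intro j hj
        unfold Bit
        by_cases h : j = P.firstCol i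
        · have : s / 2 = ind (X (P.firstCol i)) := by omega
          simp only [h, this, not_true, false_and, or_false, true_and]
          exact ha.2
        · have : s % 2 = ind (X (P.secondCol i)) := by omega
          simp only [h, this, not_false_iff, false_and, false_or, true_and]
          rw [← hj.eq_first_or_second.resolve_left h] at hb ⊢
          exact hb.2
      have hsum : ∑ j ∈ Finset.range P.n, P.cell i j * (ind (X j) : ℚ) = P.lhs i s :=
        P.sum_cell_eq_lhs (X := fun j => ind (X j)) fun j hj => by
          rw [propext (hbit j hj)]
      by_contra hlt
      beta_reduce at hlt
      rw [hsum, not_le] at hlt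
      have hs4 : s < 4 := by omega
      have e1 : (4 * i + s) / 4 = i := by omega
      have e2 : (4 * i + s) % 4 = s := by omega
      by_cases hne : ∃ j < P.n, P.NZ i j
      · have hex : P.Excluded (4 * i + s) := by
          unfold Excluded Copy
          rw [e1, e2]
          exact ⟨hne, hlt⟩
        obtain ⟨l, hl, h⟩ := hτ _ (P.mem_formula.2 (Or.inr (Or.inl ⟨_, hex, rfl⟩)))
        obtain ⟨j, hj, h2, h3⟩ := P.mem_rowClause.1 hl
        rw [e1, e2] at h3
        have hj' : P.NZ i j := by
          unfold Copy at hj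
          rwa [e1] at hj
        rw [h2] at h
        have h4 := hX j _ hj
        rw [h, h3, hbit j hj'] at h4
        exact iff_not_self h4.symm
      · have h0 : P.lhs i s = 0 := by
          rw [← hsum]
          refine Finset.sum_eq_zero fun j hj => ?_
          have : P.cell i j = 0 := by
            by_contra h0
            exact hne ⟨j, Finset.mem_range.1 hj, Finset.mem_range.1 hj, h0⟩
          rw [this, zero_mul]
        have hh : P.Hopeless := ⟨i, hi, hne, by rw [← h0]; exact not_le.2 hlt⟩
        obtain ⟨l, hl, h⟩ := hτ _ (P.mem_formula.2 (Or.inr (Or.inr ⟨hh, Or.inl rfl⟩)))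
        obtain ⟨l', hl', h'⟩ := hτ _ (P.mem_formula.2 (Or.inr (Or.inr ⟨hh, Or.inr rfl⟩)))
        simp only [List.mem_cons, List.not_mem_nil, or_false] at hl hl'
        subst hl hl'
        simp only at h h'
        rw [h] at h'
        simp at h'
  · rintro ⟨X, hX, h⟩
    have hvar : ∀ t j, j < P.n → P.var t j % P.n = j := by
      intro t j hj
      simp [var, Nat.mod_eq_of_lt hj]
    refine ⟨fun v => decide (X (v % P.n) = 1), fun c hc => ?_⟩
    rcases P.mem_formula.1 hc with ⟨j, t, hj, rfl⟩ | ⟨t, ⟨⟨j₀, -, hj₀⟩, hv⟩, rfl⟩ | ⟨⟨i, hi, h1, h2⟩, -⟩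
    · have h2 := (NZ.lt hj).2
      by_cases h1 : X j = 1
      · exact ⟨(P.var (P.nextCopy j t) j, true), by simp, by simp [hvar _ _ h2, h1]⟩
      · exact ⟨(P.var t j, false), by simp, by simp [hvar _ _ h2, h1]⟩
    · by_contra hno
      have hi := (NZ.lt hj₀).1
      refine not_le.2 hv ((h _ hi).trans (le_of_eq (P.sum_cell_eq_lhs fun j hj => ?_)))
      have h3 : ¬ (decide (X (P.var t j % P.n) = 1) = decide (¬ P.Bit (t / 4) (t % 4) j)) :=
        fun h3 => hno ⟨(P.var t j, decide (¬ P.Bit (t / 4) (t % 4) j)),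
          P.mem_rowClause.2 ⟨j, hj, rfl, by simp⟩, h3⟩
      rw [hvar _ _ hj.1] at h3
      rcases hX j with h4 | h4
      · rw [h4] at h3 ⊢
        rw [ind_of_not]
        · simp
        · intro h5
          simp [h5] at h3
      · rw [h4] at h3 ⊢
        rw [ind_of]
        · simp
        · by_contra h5
          simp [h5] at h3
    · refine absurd ((h i hi).trans_eq (Finset.sum_eq_zero fun j hj => ?_)) h2
      have : P.cell i j = 0 := by
        by_contra h0
        exact h1 ⟨j, Finset.mem_range.1 hj, Finset.mem_range.1 hj, h0⟩
      rw [this, zero_mul]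

/-! ### The number of variables -/

open Classical in
noncomputable def copies : Finset (ℕ × ℕ) :=
  (Finset.range (4 * P.m) ×ˢ Finset.range P.n).filter (fun e => P.Copy e.2 e.1)

theorem mem_copies {e : ℕ × ℕ} : e ∈ P.copies ↔ P.Copy e.2 e.1 := by
  simp only [copies, Finset.mem_filter, Finset.mem_product, Finset.mem_range]
  exact ⟨fun h => h.2, fun h => ⟨⟨h.lt, (NZ.lt h).2⟩, h⟩⟩

theorem numVars_toTwoSAT_le : P.toTwoSAT.numVars ≤ P.copies.card + 1 := by
  classical
  have h1 : (P.toTwoSAT.clauses.flatten.map Prod.fst).toFinset ⊆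
      insert (4 * P.m * P.n) (P.copies.image (fun e => P.var e.1 e.2)) := by
    intro v hv
    rw [List.mem_toFinset, List.mem_map] at hv
    obtain ⟨l, hl, rfl⟩ := hv
    obtain ⟨c, hc, hl⟩ := List.mem_flatten.1 hl
    rw [Finset.mem_insert, Finset.mem_image]
    rcases P.mem_formula.1 hc with ⟨j, t, h, rfl⟩ | ⟨t, -, rfl⟩ | ⟨-, rfl | rfl⟩
    · right
      simp only [List.mem_cons, List.not_mem_nil, or_false] at hl
      rcases hl with rfl | rfl
      · exact ⟨(t, j), P.mem_copies.2 h, rfl⟩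
      · exact ⟨(P.nextCopy j t, j), P.mem_copies.2 (cyclicNext_spec (Copy.lt j) h), rfl⟩
    · right
      obtain ⟨j, hj, h2, -⟩ := P.mem_rowClause.1 hl
      exact ⟨(t, j), P.mem_copies.2 hj, h2.symm⟩
    · left
      simp only [List.mem_cons, List.not_mem_nil, or_false] at hl
      rw [hl]
    · left
      simp only [List.mem_cons, List.not_mem_nil, or_false] at hl
      rw [hl]
  refine (Finset.card_le_card h1).trans ((Finset.card_insert_le _ _).trans ?_)
  exact Nat.succ_le_succ Finset.card_image_le

/-- Each of the `4 * m` slots involves at most two columns. -/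
theorem card_copies_le_m : P.copies.card ≤ 8 * P.m := by
  classical
  have := Finset.card_le_mul_card_image_of_maps_to (s := P.copies) (t := Finset.range (4 * P.m))
    (f := Prod.fst) (fun e he => Finset.mem_range.2 (Copy.lt _ _ (P.mem_copies.1 he))) 2
    (fun t _ => by
      refine (Finset.card_le_card_of_injOn Prod.snd ?_ ?_).trans (P.card_row_le (t / 4))
      · rintro ⟨t', j⟩ he
        simp only [Finset.coe_filter, mem_copies, Set.mem_ofPred_eq] at he
        obtain ⟨h, rfl⟩ := he
        simpa using ⟨(NZ.lt h).2, h⟩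
      · rintro ⟨t', j⟩ he ⟨t'', j'⟩ he' h
        simp only [Finset.coe_filter, Set.mem_ofPred_eq] at he he'
        exact Prod.ext (he.2.trans he'.2.symm) h)
  rw [Finset.card_range] at this
  omega

/-- Each column meets at most three rows, and each of these has four slots. -/
theorem card_copies_le_n : P.copies.card ≤ 12 * P.n := by
  classical
  have := Finset.card_le_mul_card_image_of_maps_to (s := P.copies) (t := Finset.range P.n)
    (f := Prod.snd) (fun e he => Finset.mem_range.2 (NZ.lt (P.mem_copies.1 he)).2) 12
    (fun j _ => by
      have h2 := Finset.card_le_mul_card_image_of_maps_to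
        (s := P.copies.filter (fun e => e.2 = j))
        (t := (Finset.range P.m).filter (fun i => P.NZ i j)) (f := fun e => e.1 / 4)
        (fun e he => by
          rw [Finset.mem_filter, mem_copies] at he
          obtain ⟨h, rfl⟩ := he
          exact Finset.mem_filter.2 ⟨Finset.mem_range.2 (NZ.lt h).1, h⟩) 4
        (fun i _ => by
          refine (Finset.card_le_card_of_injOn (t := Finset.range 4) (fun e => e.1 % 4) ?_ ?_).trans
            (by simp)
          · rintro e -
            simpa using Nat.mod_lt _ (by norm_num)
          · rintro ⟨t', j'⟩ he ⟨t'', j''⟩ he' h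
            simp only [Finset.coe_filter, Finset.mem_filter, Set.mem_ofPred_eq] at he he' h
            exact Prod.ext (by dsimp only; omega) (he.1.2.trans he'.1.2.symm))
      have h3 := P.card_col_le j
      omega)
  rwa [Finset.card_range] at this

/-! ### The formula in logarithmic space -/

theorem encodeWords_map {α : Type*} (f : α → List Bool) (l : List α) :
    encodeWords (l.map f) = l.flatMap fun a => encodeWords [f a] := by
  rw [← encodeWords_flatMap, ← List.map_eq_flatMap]

theorem encode_toTwoSAT : P.toTwoSAT.encode =
    P.formula.flatMap (fun c => encodeWords (c.map TwoSATThree.literalWord) ++ [InSym.sep]) := by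
  unfold TwoSATThree.encode tableWords
  rw [encodeWords_flatMap, List.flatMap_map]
  refine List.flatMap_congr fun c _ => ?_
  rw [encodeWords_append]
  rfl

variable {H : LPTwoThree → Scope B} {F K : LPTwoThree → γ → ℕ}

theorem lsp_nz (hF : LS B encode H F) (hK : LS B encode H K) :
    LSP B encode H (fun P g => P.NZ (F P g) (K P g)) :=
  (LSP.lt hK ls_n).and (lsp_cell_ne_zero hF hK)

theorem ls_firstCol (hF : LS B encode H F) : LS B encode H (fun P g => P.firstCol (F P g)) :=
  LS.least (P := fun P g j => P.NZ (F P g) j) ls_n (lsp_nz hF.weaken LS.last)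

theorem ls_secondCol (hF : LS B encode H F) : LS B encode H (fun P g => P.secondCol (F P g)) :=
  LS.least (P := fun P g j => P.NZ (F P g) j ∧ P.firstCol (F P g) < j) ls_n
    ((lsp_nz hF.weaken LS.last).and (LSP.lt (ls_firstCol hF).weaken LS.last))

theorem lsp_copy (hF : LS B encode H F) (hK : LS B encode H K) :
    LSP B encode H (fun P g => P.Copy (F P g) (K P g)) :=
  lsp_nz (LS.div hK (LS.const 4)) hF

theorem ls_var (hF : LS B encode H F) (hK : LS B encode H K) :
    LS B encode H (fun P g => P.var (F P g) (K P g)) :=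
  (hF.mul ls_n).add hK

theorem ls_slots : LS B encode H (fun P (_ : γ) => 4 * P.m) := (LS.const 4).mul ls_m

theorem ls_nextCopy (hF : LS B encode H F) (hK : LS B encode H K) :
    LS B encode H (fun P g => P.nextCopy (F P g) (K P g)) := by
  classical
  have h1 : LSP B encode H (fun P (g : γ × ℕ) => K P g.1 < g.2 ∧ P.Copy (F P g.1) g.2) :=
    (LSP.lt hK.weaken LS.last).and (lsp_copy hF.weaken LS.last)
  refine (LS.ite (LSP.ex (P := fun P g t => K P g < t ∧ P.Copy (F P g) t) ls_slots h1)
    (LS.least (P := fun P g t => K P g < t ∧ P.Copy (F P g) t) ls_slots h1)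
    (LS.least (P := fun P g t => P.Copy (F P g) t) ls_slots (lsp_copy hF.weaken LS.last))).congr
    fun P g => ?_
  unfold nextCopy cyclicNext
  rfl

theorem lsp_bit {J : LPTwoThree → γ → ℕ} (hF : LS B encode H F) (hK : LS B encode H K)
    (hJ : LS B encode H J) : LSP B encode H (fun P g => P.Bit (F P g) (K P g) (J P g)) :=
  ((LSP.eq hJ (ls_firstCol hF)).and (LSP.eq (LS.div hK (LS.const 2)) (LS.const 1))).or
    ((LSP.eq hJ (ls_firstCol hF)).not.and (LSP.eq (LS.mod hK (LS.const 2)) (LS.const 1)))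

theorem lsp_violated (hF : LS B encode H F) (hK : LS B encode H K) :
    LSP B encode H (fun P g => P.Violated (F P g) (K P g)) := by
  have h1 := LSQ.ite ((LSP.lt (ls_firstCol hF) ls_n).and
    (LSP.eq (LS.div hK (LS.const 2)) (LS.const 1))) (lsq_cell hF (ls_firstCol hF)) LSQ.zero
  have h2 := LSQ.ite ((LSP.lt (ls_secondCol hF) ls_n).and
    (LSP.eq (LS.mod hK (LS.const 2)) (LS.const 1))) (lsq_cell hF (ls_secondCol hF)) LSQ.zero
  exact (LSQ.le (lsq_cell hF ls_n) (h1.add h2)).not.congr fun P g => not_le.symm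

theorem lsp_excluded (hF : LS B encode H F) :
    LSP B encode H (fun P g => P.Excluded (F P g)) :=
  have h : LSP B encode H (fun P g => ∃ j < P.n, P.Copy j (F P g)) :=
    LSP.ex (P := fun P g j => P.Copy j (F P g)) ls_n (lsp_copy LS.last hF.weaken)
  h.and (lsp_violated (LS.div hF (LS.const 4)) (LS.mod hF (LS.const 4)))

theorem lsp_hopeless : LSP B encode H (fun P (_ : γ) => P.Hopeless) :=
  LSP.ex (P := fun P _ i => ¬ (∃ j < P.n, P.NZ i j) ∧ ¬ P.cell i P.n ≤ 0) ls_m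
    ((LSP.ex (γ := γ × ℕ) (P := fun P g j => P.NZ g.2 j) ls_n
      (lsp_nz LS.last.weaken LS.last)).not.and (LSQ.le (lsq_cell LS.last ls_n) LSQ.zero).not)

theorem lsl_literal {Q : LPTwoThree → γ → Prop} [∀ P g, Decidable (Q P g)] (hF : LS B encode H F)
    (hQ : LSP B encode H Q) : LSL B encode H
      (fun P g => encodeWords [TwoSATThree.literalWord (F P g, decide (Q P g))]) :=
  ((LSL.ite hQ (LSL.singleton (.bit true)) (LSL.singleton (.bit false))).append
    ((LSL.bits hF).append (LSL.singleton .sep))).congr fun P g => by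
      by_cases h : Q P g <;> simp [encodeWords, TwoSATThree.literalWord, h]

theorem lsl_literal_const (hF : LS B encode H F) (b : Bool) : LSL B encode H
      (fun P g => encodeWords [TwoSATThree.literalWord (F P g, b)]) :=
  ((LSL.singleton (.bit b)).append ((LSL.bits hF).append (LSL.singleton .sep))).congr
    fun P g => by simp [encodeWords, TwoSATThree.literalWord]

theorem lsl_toTwoSAT : LSL B encode H (fun P (_ : γ) => P.toTwoSAT.encode) := by
  classical
  set E : List (ℕ × Bool) → List InSym :=
    fun c => encodeWords (c.map TwoSATThree.literalWord) ++ [InSym.sep] with hE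
  have hcopy : LSP B encode H (fun P (g : (γ × ℕ) × ℕ) => P.Copy g.2 g.1.2) :=
    lsp_copy LS.last LS.last.weaken
  have hvar : LS B encode H (fun P (g : (γ × ℕ) × ℕ) => P.var g.1.2 g.2) :=
    ls_var LS.last.weaken LS.last
  have hvar' : LS B encode H (fun P (g : (γ × ℕ) × ℕ) => P.var (P.nextCopy g.2 g.1.2) g.2) :=
    ls_var (ls_nextCopy LS.last LS.last.weaken) LS.last
  have hcycle : LSL B encode H (fun P (g : γ × ℕ) => (P.cycleClauses g.2).flatMap E) := by
    refine (LSL.flatMap (γ := γ × ℕ) (S := fun P g j => if P.Copy j g.2 then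
      encodeWords [TwoSATThree.literalWord (P.var g.2 j, false)] ++
        (encodeWords [TwoSATThree.literalWord (P.var (P.nextCopy j g.2) j, true)] ++ [InSym.sep])
      else []) ls_n (LSL.ite hcopy ((lsl_literal_const hvar false).append
        ((lsl_literal_const hvar' true).append (LSL.singleton .sep))) LSL.nil)).congr fun P g => ?_
    rw [cycleClauses, List.flatMap_map, List.flatMap_filter_eq]
    refine List.flatMap_congr fun j _ => ?_
    split_ifs
    · simp [hE, encodeWords]
    · rfl
  have hrow : LSL B encode H (fun P (g : γ × ℕ) => E (P.rowClause g.2)) := by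
    refine ((LSL.flatMap (γ := γ × ℕ) (S := fun P g j => if P.Copy j g.2 then
      encodeWords [TwoSATThree.literalWord (P.var g.2 j, decide (¬ P.Bit (g.2 / 4) (g.2 % 4) j))]
      else []) ls_n (LSL.ite hcopy (lsl_literal hvar (lsp_bit (LS.div LS.last.weaken (LS.const 4))
        (LS.mod LS.last.weaken (LS.const 4)) LS.last).not) LSL.nil)).append
      (LSL.singleton .sep)).congr fun P g => ?_
    simp only [hE]
    congr 1
    rw [rowClause, List.map_map, encodeWords_map, List.flatMap_filter_eq]
    rfl
  have hz : LS B encode H (fun P (_ : γ) => 4 * P.m * P.n) := ls_slots.mul ls_n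
  have hend : LSL B encode H (fun P (_ : γ) =>
      (if P.Hopeless then [[(4 * P.m * P.n, true)], [(4 * P.m * P.n, false)]] else []).flatMap E) := by
    refine (LSL.ite lsp_hopeless (((lsl_literal_const hz true).append (LSL.singleton .sep)).append
      ((lsl_literal_const hz false).append (LSL.singleton .sep))) LSL.nil).congr fun P g => ?_
    split_ifs
    · simp [hE]
    · rfl
  refine ((LSL.flatMap (S := fun P _ t => (P.cycleClauses t).flatMap E ++
    if P.Excluded t then E (P.rowClause t) else []) ls_slots
    (hcycle.append (LSL.ite (lsp_excluded LS.last) hrow LSL.nil))).append hend).congr fun P g => ?_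
  rw [encode_toTwoSAT, formula, List.flatMap_append, List.flatMap_assoc]
  congr 1
  refine List.flatMap_congr fun t _ => ?_
  rw [List.flatMap_append]
  congr 1
  split_ifs
  · simp [hE]
  · rfl

end LPTwoThree

/-! ### The reductions that connect the five statements -/

theorem ThreeDSTCON.card_edges_le (G : ThreeDSTCON) : G.E.card ≤ 3 * G.n := by
  have h : G.E.card ≤ ∑ v : Fin G.n, (G.E.filter (fun e => e.2 = v)).card := by
    exact (Finset.card_eq_sum_card_fiberwise (f := Prod.snd) (t := Finset.univ)
      fun _ _ => Finset.mem_univ _).le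
  refine h.trans ((Finset.sum_le_card_nsmul _ _ 3 fun v _ => ?_).trans (by simp [mul_comm]))
  have := G.degree_le v
  omega

/-- The identity serves only in this direction, because isolated vertices make the number of
vertices unbounded in terms of the edges. The way back leads through linear programs and formulas.
-/
theorem threeDSTCONEdg_of_threeDSTCONVer : LSH threeDSTCONVer → LSH threeDSTCONEdg :=
  LSH.of_manyOne (P := threeDSTCONVer) (Q := threeDSTCONEdg) id 3 (fun _ _ => LSL.self)
    (fun G => (ThreeDSTCON.card_edges_le G).trans (Nat.mul_le_mul_left _ (le_max_right _ _)))
    fun _ => Iff.rfl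

/-- A many-one reduction to the complement. -/
theorem LSH.of_manyOne_compl {P Q : ParamProblem} (f : P.Inst → Q.Inst) (C : ℕ)
    (hf : ∀ (B : MultiTapeTM InSym) (H : P.Inst → Scope B),
      LSL B P.encode H (fun x (_ : Unit) => Q.encode (f x)))
    (hsize : ∀ x, Q.size (f x) ≤ C * max 1 (P.size x))
    (hyes : ∀ x, Q.yes (f x) ↔ ¬ P.yes x)
    (hP : LSH P) : LSH Q := by
  obtain ⟨c, hc⟩ := (hf _ (fun _ => Scope.init (oracleBase
    ⟨0, Unit, Unit, inferInstance, inferInstance, (), (), ∅, fun _ _ _ => none⟩) 0)).pb 0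
  exact LSH.of_reduction (γ := Unit) (fun x _ => f x) C c hf (fun x _ => hc x () trivial)
    (fun x _ => hsize x) (fun B H h => h.not.congr fun x _ => by rw [hyes x, not_not]) hP

theorem lpTwoThreeRow_of_threeDSTCONEdg : LSH threeDSTCONEdg → LSH lpTwoThreeRow :=
  LSH.of_manyOne_compl (P := threeDSTCONEdg) (Q := lpTwoThreeRow) ThreeDSTCON.toLP 2
    (fun _ _ => ThreeDSTCON.lsl_toLP)
    (fun G => G.toLP_m_le.trans (by show _ ≤ 2 * max 1 G.E.card; omega))
    fun G => G.toLP_feasible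

theorem lpTwoThreeCol_of_threeDSTCONEdg : LSH threeDSTCONEdg → LSH lpTwoThreeCol :=
  LSH.of_manyOne_compl (P := threeDSTCONEdg) (Q := lpTwoThreeCol) ThreeDSTCON.toLP 3
    (fun _ _ => ThreeDSTCON.lsl_toLP)
    (fun G => G.toLP_n_le.trans (by show _ ≤ 3 * max 1 G.E.card; omega))
    fun G => G.toLP_feasible

theorem twoSATThree_of_lpTwoThreeRow : LSH lpTwoThreeRow → LSH twoSATThree :=
  LSH.of_manyOne (P := lpTwoThreeRow) (Q := twoSATThree) LPTwoThree.toTwoSAT 9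
    (fun _ _ => LPTwoThree.lsl_toTwoSAT)
    (fun P => by
      show P.toTwoSAT.numVars ≤ 9 * max 1 P.m
      have := P.numVars_toTwoSAT_le
      have := P.card_copies_le_m
      omega)
    fun P => P.toTwoSAT_satisfiable.symm

theorem twoSATThree_of_lpTwoThreeCol : LSH lpTwoThreeCol → LSH twoSATThree :=
  LSH.of_manyOne (P := lpTwoThreeCol) (Q := twoSATThree) LPTwoThree.toTwoSAT 13
    (fun _ _ => LPTwoThree.lsl_toTwoSAT)
    (fun P => by
      show P.toTwoSAT.numVars ≤ 13 * max 1 P.n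
      have := P.numVars_toTwoSAT_le
      have := P.card_copies_le_n
      omega)
    fun P => P.toTwoSAT_satisfiable.symm

namespace TwoSATThree

/-- The general polynomial bound for produced strings holds only for bounded arguments, whereas
`LSH.of_reduction` asks for a bound for all of them. By clamping, every graph occurs already for
small arguments. -/
theorem toGraph_clamp (φ : TwoSATThree) (k d : ℕ) :
    φ.toGraph k d = φ.toGraph (min k φ.tokens.length) (min d 1) := by
  have h1 : min k φ.tokens.length - (min k φ.tokens.length - φ.tokens.length) =
      k - (k - φ.tokens.length) := by omega
  have h2 : min d 1 = 0 ↔ d = 0 := by omega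
  simp only [toGraph, h1, h2, ne_eq]

theorem exists_length_encode_toGraph_le : ∃ c, ∀ (φ : TwoSATThree) (k d : ℕ),
    (φ.toGraph k d).encode.length ≤ (φ.encode.length + 2) ^ c := by
  let H : TwoSATThree → Scope (oracleBase
    ⟨0, Unit, Unit, inferInstance, inferInstance, (), (), ∅, fun _ _ _ => none⟩) :=
    fun _ => Scope.init _ 0
  obtain ⟨a, ha⟩ := (ls_length (γ := Unit) (H := H)).pb 0
  obtain ⟨c, hc⟩ := (lsl_toGraph (γ := (Unit × ℕ) × ℕ) (H := H) LS.last.weaken LS.last).pb a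
  refine ⟨c, fun φ k d => ?_⟩
  rw [toGraph_clamp]
  exact hc φ (((), min k φ.tokens.length), min d 1)
    ⟨⟨trivial, (min_le_right _ _).trans (ha φ () trivial)⟩,
      (min_le_right _ _).trans (Nat.one_le_pow _ _ (by omega))⟩

end TwoSATThree

/-- For every position `k` two questions are asked, one for each direction between `2 * k` and `2 *
k + 1`; the formula is satisfiable iff no `k` gets two positive answers. The constant `14` comes
from two vertices for each of at most `6` tokens per variable and two more vertices. -/
theorem threeDSTCONVer_of_twoSATThree : LSH twoSATThree → LSH threeDSTCONVer := by
  obtain ⟨c, hc⟩ := TwoSATThree.exists_length_encode_toGraph_le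
  refine LSH.of_reduction (P := twoSATThree) (Q := threeDSTCONVer) (γ := (Unit × ℕ) × ℕ)
    (fun φ g => TwoSATThree.toGraph φ g.1.2 g.2) 14 c
    (fun _ _ => TwoSATThree.lsl_toGraph LS.last.weaken LS.last) (fun φ g => hc φ g.1.2 g.2)
    (fun φ g => ?_) fun B H h => ?_
  · show 2 * (TwoSATThree.tokens φ).length + 2 ≤ 14 * max 1 (TwoSATThree.numVars φ)
    have := TwoSATThree.length_tokens_le φ
    omega
  · have h0 : LSP B TwoSATThree.encode H (fun φ (g : Unit × ℕ) => (φ.toGraph g.2 0).Connected) :=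
      LSP.bind (γ := Unit × ℕ) (P := fun φ g d => (TwoSATThree.toGraph φ g.2 d).Connected)
        (LS.const 0) h
    have h1 : LSP B TwoSATThree.encode H (fun φ (g : Unit × ℕ) => (φ.toGraph g.2 1).Connected) :=
      LSP.bind (γ := Unit × ℕ) (P := fun φ g d => (TwoSATThree.toGraph φ g.2 d).Connected)
        (LS.const 1) h
    refine (LSP.ex (P := fun φ _ k => (TwoSATThree.toGraph φ k 0).Connected ∧
      (TwoSATThree.toGraph φ k 1).Connected) TwoSATThree.ls_length (h0.and h1)).not.congr
      fun φ _ => ?_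
    refine (TwoSATThree.satisfiable_iff_arcs φ).trans (not_congr (exists_congr fun k =>
      and_congr_right fun hk => ?_))
    rw [(φ.toGraph_connected hk).1, (φ.toGraph_connected hk).2]

theorem theorem5 :
    [LSH twoSATThree,
     LSH lpTwoThreeRow,
     LSH lpTwoThreeCol,
     LSH threeDSTCONVer,
     LSH threeDSTCONEdg].TFAE := by
  tfae_have 4 → 5 := threeDSTCONEdg_of_threeDSTCONVer
  tfae_have 5 → 2 := lpTwoThreeRow_of_threeDSTCONEdg
  tfae_have 5 → 3 := lpTwoThreeCol_of_threeDSTCONEdg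
  tfae_have 2 → 1 := twoSATThree_of_lpTwoThreeRow
  tfae_have 3 → 1 := twoSATThree_of_lpTwoThreeCol
  tfae_have 1 → 4 := threeDSTCONVer_of_twoSATThree
  tfae_finish
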